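/- Let $r=(r_{ij})_{0\le i\le j\le n}$ be non-negative integers that can occur as rank conditions, i.e. there are vector spaces and linear maps $V_0\to V_1\to\dots\to V_n$ over $\mathbb C$ with $\dim V_i=r_{ii}$ and $\operatorname{rank}(V_i\to V_j)=r_{ij}$ for $i<j$. For $0\le i<j\le n$ let $R_{ij}$ be the rectangle with $r_{i+1,j}-r_{ij}$ rows and $r_{i,j-1}-r_{ij}$ columns (it is empty if one of these numbers is $0$). The rectangles $R_{i,i+k}$, $0\le i\le n-k$, form the $k$-th row of the rectangle diagram. *Coefficients.* Let $\Lambda=\mathbb Z[h_1,h_2,\dots]$, $h_0=1$, $h_{-q}=0$ for $q>0$, let $s_I=\det(h_{a_i+j-i})_{1\le i,j\le p}$ for $I=(a_1,\dots,a_p)$, and let $c^{\mu}_{\sigma\tau}$ be the Littlewood–Richardson coefficients, $s_\sigma s_\tau=\sum_\mu c^\mu_{\sigma\tau}s_\mu$. Define $P_r\in\Lambda^{\otimes n}$ and $c_\mu(r)\in\mathbb Z$, for sequences of partitions $\mu=(\mu_1,\dots,\mu_n)$, by $P_r=\sum_\mu c_\mu(r)\,s_{\mu_1}\otimes\dots\otimes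 s_{\mu_n}$ and by induction on $n$: for $n=1$, $P_r=s_{R_{01}}$. For $n\ge2$ let $\bar r$ be $r$ without its top row, $\bar r_{ij}=r_{i,j+1}$ for $0\le i\le j\le n-1$; then $P_r$ is obtained from $P_{\bar r}$ by replacing each $s_{\mu_1}\otimes\dots\otimes s_{\mu_{n-1}}$ with $$\sum_{\sigma,\tau}\Big(\prod_{i=1}^{n-1}c^{\mu_i}_{\sigma_i\tau_i}\Big)\,s_{I_1}\otimes\dots\otimes s_{I_n},$$ the sum being over partitions $\sigma_1,\dots,\sigma_{n-1},\tau_1,\dots,\tau_{n-1}$ such that $\sigma_i$ has at most as many rows as $R_{i-1,i}$; here $I_i$ is the sequence of row lengths of the diagram consisting of $R_{i-1,i}$ with $\sigma_i$ attached to its right side and $\tau_{i-1}$ attached beneath it, $\tau_0=\sigma_n=\emptyset$ (if $R_{i-1,i}$ has $a$ rows and $b$ columns, $I_i$ is $b+\sigma_{i,1},\dots,b+\sigma_{i,a}$ followed by the parts of $\tau_{i-1}$). *Factor sequences.* A tableau diagram for $r$ is a family of semistandard Young tableaux $T_{ij}$ ($0\le i<j\le n$) with integer entries such that $T_{ij}$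 has shape $R_{ij}$ and its entries are strictly larger than those of every $T_{kl}$ with $i\le k<l\le j$, $(k,l)\ne(i,j)$. Its factor sequences $(W_1,\dots,W_n)$ are defined by induction on $n$: for $n=1$ the only one is $(T_{01})$; for $n\ge2$ they are the sequences $$(T_{01}\cdot P_1,\;Q_1\cdot T_{12}\cdot P_2,\;\dots,\;Q_{n-1}\cdot T_{n-1,n}),$$ where $(P_1\cdot Q_1,\dots,P_{n-1}\cdot Q_{n-1})$ is, for some tableaux $P_i,Q_i$, a factor sequence for the tableau diagram without its top row. The product of tableaux is the usual one, given by row insertion. **Statement.** Suppose that every rectangle $R_{ij}$ with $j-i\ge4$ is empty and that no two neighboring rectangles $R_{i,i+3}$, $R_{i+1,i+4}$ in the third row are both non-empty. Then for every tableau diagram for $r$ and every sequence of partitions $\mu=(\mu_1,\dots,\mu_n)$, the coefficient $c_\mu(r)$ is equal to the (finite) number of different factor sequences $(W_1,\dots,W_n)$ of this tableau diagram such that $W_i$ has shape $\mu_i$ for each $i$. The two conditions hold for all rank conditions with $n\le3$, that is, with at most four vector bundles. -/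

import Mathlib

open scoped TensorProduct

namespace QuiverFactor

/-- The ring of symmetric functions `ℤ[h₁, h₂, …]`; the variable `X k` is `h_{k+1}`. -/
abbrev SymFun : Type := MvPolynomial ℕ ℤ

/-- The complete symmetric function `h_k`, with `h_0 = 1` and `h_k = 0` for `k < 0`. -/
noncomputable def hSym : ℤ → SymFun
  | Int.ofNat 0 => 1
  | Int.ofNat (k + 1) => MvPolynomial.X k
  | Int.negSucc _ => 0

/-- The Schur function `s_I = det (h_{a_i + j - i})` of a sequence `I = (a_1, …, a_p)`. -/
noncomputable def schur (I : List ℕ) : SymFun :=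
  Matrix.det (Matrix.of fun i j : Fin I.length =>
    hSym ((I.get i : ℤ) + ((j : ℕ) : ℤ) - ((i : ℕ) : ℤ)))

/-! ### The Schur functions of partitions form a basis -/

theorem triangular_basis {ι R M : Type*} [CommRing R] [AddCommGroup M] [Module R M]
    (b : Module.Basis ι R M) (v : ι → M) (rk : ι → ℕ)
    (h : ∀ i j, rk i ≤ rk j → b.repr (v i - b i) j = 0) :
    LinearIndependent R v ∧ ⊤ ≤ Submodule.span R (Set.range v) := by
  constructor
  · rw [linearIndependent_iff]
    intro c hc
    by_contra hne
    obtain ⟨i, hi, hmax⟩ := Finset.exists_max_image c.support rk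
      (Finsupp.support_nonempty_iff.2 hne)
    have h0 : b.repr (Finsupp.linearCombination R v c) i = 0 := by simp [hc]
    rw [Finsupp.linearCombination_apply, Finsupp.sum, map_sum, Finsupp.finsetSum_apply] at h0
    rw [Finset.sum_eq_single i] at h0
    · have := h i i le_rfl
      simp only [map_sub, Finsupp.coe_sub, Pi.sub_apply, Module.Basis.repr_self,
        Finsupp.single_eq_same, sub_eq_zero] at this
      simp [this] at h0
      exact (Finsupp.mem_support_iff.1 hi) h0
    · intro j hj hji
      have := h j i (hmax j hj)
      simp only [map_sub, Finsupp.coe_sub, Pi.sub_apply, Module.Basis.repr_self,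
        sub_eq_zero, Finsupp.single_eq_of_ne hji.symm] at this
      simp [this]
    · intro hi'
      exact absurd hi hi'
  · have key : ∀ N i, rk i < N → b i ∈ Submodule.span R (Set.range v) := by
      intro N
      induction N with
      | zero => intro i hi; omega
      | succ N ih =>
        intro i hi
        have e : b i = v i - (v i - b i) := by abel
        rw [e]
        refine Submodule.sub_mem _ (Submodule.subset_span ⟨i, rfl⟩) ?_
        rw [← b.linearCombination_repr (v i - b i), Finsupp.linearCombination_apply, Finsupp.sum]
        refine Submodule.sum_mem _ fun j hj => Submodule.smul_mem _ _ (ih j ?_)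
        by_contra hlt
        exact (Finsupp.mem_support_iff.1 hj) (h i j (by omega))
    rw [← b.span_eq]
    exact Submodule.span_le.2 fun x ⟨i, hi⟩ => hi ▸ key _ i (Nat.lt_succ_self _)

/-- The exponent of the monomial `h_k`. -/
noncomputable def hExp : ℤ → (ℕ →₀ ℕ)
  | Int.ofNat 0 => 0
  | Int.ofNat (k + 1) => Finsupp.single k 1
  | Int.negSucc _ => 0

theorem hSym_eq (a : ℤ) : hSym a = if a < 0 then 0 else MvPolynomial.monomial (hExp a) 1 := by
  match a with
  | Int.ofNat 0 => simp [hSym, hExp]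
  | Int.ofNat (k + 1) => 
    rw [if_neg (by simp; omega)]; rfl
  | Int.negSucc k => rw [if_pos (Int.negSucc_lt_zero k)]; rfl

/-- `∑ m_k (k+1)^e`. -/
noncomputable def powSum (e : ℕ) : (ℕ →₀ ℕ) →+ ℤ :=
  Finsupp.liftAddHom fun k => ((AddMonoidHom.mulRight (((k : ℤ) + 1) ^ e)).comp
    (Nat.castAddMonoidHom ℤ))

theorem powSum_apply (e : ℕ) (m : ℕ →₀ ℕ) :
    powSum e m = m.sum fun k c => (c : ℤ) * ((k : ℤ) + 1) ^ e := rfl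

theorem powSum_hExp (e : ℕ) (he : e ≠ 0) (a : ℤ) (ha : 0 ≤ a) : powSum e (hExp a) = a ^ e := by
  match a with
  | Int.ofNat 0 => simp [hExp, he]
  | Int.ofNat (k + 1) => simp [hExp, powSum_apply]
  | Int.negSucc k => exact absurd ha (not_le.2 (Int.negSucc_lt_zero k))

theorem powSum_two_le (m : ℕ →₀ ℕ) : powSum 2 m ≤ powSum 1 m ^ 2 := by
  have h1 : ∀ k ∈ m.support, (k : ℤ) + 1 ≤ powSum 1 m := by
    intro k hk
    rw [powSum_apply, Finsupp.sum]
    refine le_trans ?_ (Finset.single_le_sum (fun i _ => by positivity) hk)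
    have : (1 : ℤ) ≤ m k := by
      have := Finsupp.mem_support_iff.1 hk
      exact_mod_cast Nat.one_le_iff_ne_zero.2 this
    nlinarith [Int.natCast_nonneg k]
  rw [pow_two (powSum 1 m)]
  nth_rewrite 2 [powSum_apply]
  rw [powSum_apply, Finsupp.sum, Finsupp.sum, Finset.sum_mul]
  refine Finset.sum_le_sum fun k hk => ?_
  have := h1 k hk
  have h2 : (0 : ℤ) ≤ (m k : ℤ) * ((k : ℤ) + 1) := by positivity
  nlinarith

/-- The order statistic for triangularity. -/
noncomputable def expRank (m : ℕ →₀ ℕ) : ℕ := (powSum 1 m ^ 2 - powSum 2 m).toNat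

/-- The exponent of the monomial `∏ h_{a_i}`. -/
noncomputable def listExp (I : List ℕ) : ℕ →₀ ℕ := (I.map fun a : ℕ => hExp a).sum

theorem prod_hSym {p : ℕ} (a : Fin p → ℤ) :
    ∏ i, hSym (a i) = if ∃ i, a i < 0 then 0 else
      MvPolynomial.monomial (∑ i, hExp (a i)) 1 := by
  split_ifs with h
  · obtain ⟨i, hi⟩ := h
    exact Finset.prod_eq_zero (Finset.mem_univ i) (by rw [hSym_eq, if_pos hi])
  · push Not at h
    have : ∀ i, hSym (a i) = MvPolynomial.monomial (hExp (a i)) 1 := fun i => by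
      rw [hSym_eq, if_neg (not_lt.2 (h i))]
    simp only [this]
    rw [MvPolynomial.monomial_sum_one]

theorem schur_triangular (I : List ℕ) (hI : I.SortedGE) (m : ℕ →₀ ℕ)
    (hm : expRank (listExp I) ≤ expRank m) :
    MvPolynomial.coeff m (schur I - MvPolynomial.monomial (listExp I) 1) = 0 := by
  have hlist : listExp I = ∑ i : Fin I.length, hExp (I.get i) := by
    rw [listExp, ← List.sum_ofFn]
    congr 1
    conv_lhs => rw [← List.ofFn_get I]
    rw [List.map_ofFn]; rfl
  have h1 : ∀ p : Equiv.Perm (Fin I.length), p ≠ 1 →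
      MvPolynomial.coeff m (∏ i, hSym ((I.get (p i) : ℤ) + ((i : ℕ) : ℤ) - ((p i : ℕ) : ℤ))) = 0 := by
    intro p hp
    rw [prod_hSym]
    split_ifs with hneg
    · simp
    · push Not at hneg
      rw [MvPolynomial.coeff_monomial, if_neg]
      intro heq
      have w1 : ∀ e, e ≠ 0 → powSum e m =
          ∑ i, ((I.get (p i) : ℤ) + ((i : ℕ) : ℤ) - ((p i : ℕ) : ℤ)) ^ e := by
        intro e he
        rw [← heq, map_sum]
        exact Finset.sum_congr rfl fun i _ => powSum_hExp e he _ (hneg i)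
      have w2 : ∀ e, e ≠ 0 → powSum e (listExp I) = ∑ i, (I.get i : ℤ) ^ e := by
        intro e he
        rw [hlist, map_sum]
        exact Finset.sum_congr rfl fun i _ => powSum_hExp e he _ (by positivity)
      have s1 : powSum 1 m = powSum 1 (listExp I) := by
        rw [w1 1 one_ne_zero, w2 1 one_ne_zero]
        simp only [pow_one, Finset.sum_sub_distrib, Finset.sum_add_distrib]
        rw [Equiv.sum_comp p (fun i => (I.get i : ℤ)),
          Equiv.sum_comp p (fun i => ((i : ℕ) : ℤ))]
        ring
      have s2 : powSum 2 (listExp I) < powSum 2 m := by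
        rw [w1 2 two_ne_zero, w2 2 two_ne_zero]
        set f : Fin I.length → ℤ := fun i => (I.get i : ℤ) - ((i : ℕ) : ℤ) with hf
        set g : Fin I.length → ℤ := fun i => ((i : ℕ) : ℤ) with hg
        have fanti : StrictAnti f := by
          intro i j hij
          have : I.get j ≤ I.get i := hI.getElem_ge_getElem_of_le (Fin.le_def.1 hij.le)
          have h2 : (i : ℕ) < (j : ℕ) := hij
          simp only [hf]
          omega
        have gmono : StrictMono g := fun i j hij => by simpa [hg] using hij
        have av : Antivary f g := fun i j hij => (fanti.antitone (gmono.lt_iff_lt.1 hij).le)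
        have lt : ∑ i, f i * g i < ∑ i, f (p i) * g i := by
          rw [av.sum_mul_lt_sum_comp_perm_mul_iff]
          intro hav
          apply hp
          have pm : Monotone p := by
            intro i j hij
            rcases hij.eq_or_lt with rfl | hij
            · exact le_rfl
            · exact fanti.le_iff_ge.1 (hav (gmono hij))
          have : StrictMono p := pm.strictMono_of_injective p.injective
          ext i
          have := congrFun (Subsingleton.elim (α := Fin I.length ≃o Fin I.length)
            (this.orderIsoOfSurjective p p.surjective) (OrderIso.refl _) ▸ rfl :
              ((this.orderIsoOfSurjective p p.surjective : Fin I.length ≃o Fin I.length) :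
                Fin I.length → Fin I.length) = (OrderIso.refl _)) i
          simpa using congrArg Fin.val this
        have e1 : ∀ i, ((I.get (p i) : ℤ) + ((i : ℕ) : ℤ) - ((p i : ℕ) : ℤ)) ^ 2
            = (fun i => f i ^ 2) (p i) + 2 * (f (p i) * g i) + g i ^ 2 := by
          intro i; simp only [hf, hg]; ring
        have e2 : ∀ i, ((I.get i : ℤ)) ^ 2 = f i ^ 2 + 2 * (f i * g i) + g i ^ 2 := by
          intro i; simp only [hf, hg]; ring
        rw [Finset.sum_congr rfl fun i _ => e1 i, Finset.sum_congr rfl fun i _ => e2 i]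
        simp only [Finset.sum_add_distrib, ← Finset.mul_sum]
        rw [Equiv.sum_comp p (fun i => f i ^ 2)]
        linarith
      have b1 := powSum_two_le m
      have b2 := powSum_two_le (listExp I)
      rw [expRank, expRank, s1] at hm
      rw [s1] at b1
      omega
  rw [schur, Matrix.det_apply, ← Finset.add_sum_erase _ _ (Finset.mem_univ (1 : Equiv.Perm (Fin I.length))),
    MvPolynomial.coeff_sub, MvPolynomial.coeff_add, MvPolynomial.coeff_sum,
    Finset.sum_eq_zero, add_zero, sub_eq_zero]
  · simp only [Equiv.Perm.sign_one, one_smul, Equiv.Perm.one_apply, Matrix.of_apply]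
    rw [hlist, prod_hSym, if_neg (by push Not; intro i; simp)]
    simp
  · intro p hp
    have h2 := h1 p (Finset.ne_of_mem_erase hp)
    rcases Int.units_eq_one_or (Equiv.Perm.sign p) with h | h <;>
      simpa [h, Matrix.of_apply, Units.smul_def] using h2

theorem listExp_apply (I : List ℕ) (k : ℕ) : listExp I k = I.count (k + 1) := by
  induction I with
  | nil => simp [listExp]
  | cons a I ih =>
    rw [listExp, List.map_cons, List.sum_cons, Finsupp.add_apply, ← listExp, ih, List.count_cons]
    cases a with
    | zero => simp [hExp]
    | succ a =>
      have : hExp ((a + 1 : ℕ) : ℤ) = Finsupp.single a 1 := rfl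
      rw [this, Finsupp.single_apply]
      simp [add_comm]

/-- The bijection between partitions and monomials in the `h_k`. -/
theorem listExp_bijective :
    Function.Bijective fun μ : YoungDiagram => listExp μ.rowLens := by
  constructor
  · intro μ ν h
    have hc : ∀ k, μ.rowLens.count k = ν.rowLens.count k := by
      intro k
      cases k with
      | zero =>
        rw [List.count_eq_zero.2 fun h => (μ.pos_of_mem_rowLens 0 h).ne rfl,
          List.count_eq_zero.2 fun h => (ν.pos_of_mem_rowLens 0 h).ne rfl]
      | succ k => rw [← listExp_apply, ← listExp_apply]; exact DFunLike.congr_fun h k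
    apply YoungDiagram.equivListRowLens.injective
    apply Subtype.ext
    exact (List.perm_iff_count.2 hc).eq_of_pairwise (fun _ _ _ _ h1 h2 => le_antisymm h2 h1) μ.rowLens_sorted.pairwise
      ν.rowLens_sorted.pairwise
  · intro m
    let s : Multiset ℕ := m.toMultiset.map (· + 1)
    let w : List ℕ := s.sort (· ≥ ·)
    have hw : w.SortedGE := (Multiset.pairwise_sort s (· ≥ ·)).sortedGE
    have hpos : ∀ x ∈ w, 0 < x := by
      intro x hx
      have : x ∈ s := (Multiset.mem_sort (r := (· ≥ ·))).1 hx
      obtain ⟨y, _, rfl⟩ := Multiset.mem_map.1 this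
      omega
    refine ⟨YoungDiagram.ofRowLens w hw, ?_⟩
    ext k
    show listExp (YoungDiagram.ofRowLens w hw).rowLens k = m k
    rw [YoungDiagram.rowLens_ofRowLens_eq_self hpos, listExp_apply]
    rw [← Multiset.coe_count, Multiset.sort_eq,
      Multiset.count_map_eq_count' _ _ (fun a b h => Nat.succ_injective h), Finsupp.count_toMultiset]

/-- The basis `s_λ`, `λ` a partition, of the ring of symmetric functions. -/
theorem schur_basis_aux :
    LinearIndependent ℤ (fun μ : YoungDiagram => schur μ.rowLens) ∧
      ⊤ ≤ Submodule.span ℤ (Set.range fun μ : YoungDiagram => schur μ.rowLens) := by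
  let e : YoungDiagram ≃ (ℕ →₀ ℕ) := Equiv.ofBijective _ listExp_bijective
  refine triangular_basis ((MvPolynomial.basisMonomials ℕ ℤ).reindex e.symm) _
    (fun μ => expRank (listExp μ.rowLens)) ?_
  intro μ ν h
  rw [Module.Basis.repr_reindex_apply, Module.Basis.reindex_apply]
  exact schur_triangular μ.rowLens μ.rowLens_sorted (listExp ν.rowLens) h

/-- The Schur functions of partitions, as a basis of the ring of symmetric functions. -/
noncomputable def schurBasis : Module.Basis YoungDiagram ℤ SymFun :=
  Module.Basis.mk schur_basis_aux.1 schur_basis_aux.2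

/-- The Littlewood-Richardson coefficient `c^μ_{σ τ}`: the coefficient of `s_μ` in `s_σ s_τ`. -/
noncomputable def lrCoeff (μ σ τ : YoungDiagram) : ℤ :=
  schurBasis.repr (schur σ.rowLens * schur τ.rowLens) μ

/-- The basis `s_{μ_1} ⊗ ⋯ ⊗ s_{μ_n}` of the `n`-th tensor power of the ring of symmetric
functions, indexed by sequences of partitions. -/
noncomputable def tensorBasis (n : ℕ) :
    Module.Basis (Fin n → YoungDiagram) ℤ (⨂[ℤ] _ : Fin n, SymFun) :=
  Basis.piTensorProduct fun _ => schurBasis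

/-! ### Rank conditions and rectangle diagrams -/

/-- The composite `V_i → V_{i+1} → ⋯ → V_{i+k}` of a sequence of linear maps, `V_i = ℂ^{d_i}`. -/
noncomputable def compMap {d : ℕ → ℕ}
    (f : ∀ i, (Fin (d i) → ℂ) →ₗ[ℂ] (Fin (d (i + 1)) → ℂ)) (i : ℕ) :
    ∀ k : ℕ, (Fin (d i) → ℂ) →ₗ[ℂ] (Fin (d (i + k)) → ℂ)
  | 0 => LinearMap.id
  | k + 1 => (f (i + k)).comp (compMap f i k)

/-- The numbers `r i j`, `0 ≤ i ≤ j ≤ n`, can occur as rank conditions: there are vector spaces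
and linear maps `V_0 → V_1 → ⋯ → V_n` with `dim V_i = r i i` and `rank (V_i → V_j) = r i j`.
(The values of `r` outside the range `i ≤ j ≤ n` play no role.) -/
def CanOccur (n : ℕ) (r : ℕ → ℕ → ℕ) : Prop :=
  ∃ f : ∀ i, (Fin (r i i) → ℂ) →ₗ[ℂ] (Fin (r (i + 1) (i + 1)) → ℂ),
    ∀ i k, i + k ≤ n →
      Module.finrank ℂ (LinearMap.range (compMap (d := fun i => r i i) f i k)) = r i (i + k)

/-- The number of rows of the rectangle `R_{ij}`. -/
def rectRows (r : ℕ → ℕ → ℕ) (i j : ℕ) : ℕ := r (i + 1) j - r i j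

/-- The number of columns of the rectangle `R_{ij}`. -/
def rectCols (r : ℕ → ℕ → ℕ) (i j : ℕ) : ℕ := r i (j - 1) - r i j

/-- The rectangle `R_{ij}` has no boxes. -/
def RectEmpty (r : ℕ → ℕ → ℕ) (i j : ℕ) : Prop := rectRows r i j = 0 ∨ rectCols r i j = 0

/-- Removal of the top row of a triangular diagram (of ranks or of tableaux). -/
def dropTop {α : Type*} (x : ℕ → ℕ → α) : ℕ → ℕ → α := fun i j => x i (j + 1)

/-- All rectangles in and below the fourth row of the rectangle diagram are empty, and no two
non-empty rectangles in the third row are neighbors. The `k`-th row consists of the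
rectangles `R_{i,i+k}` with `0 ≤ i` and `i + k ≤ n`. -/
def SparseBelow (n : ℕ) (r : ℕ → ℕ → ℕ) : Prop :=
  (∀ i j, i + 4 ≤ j → j ≤ n → RectEmpty r i j) ∧
  (∀ i, i + 4 ≤ n → RectEmpty r i (i + 3) ∨ RectEmpty r (i + 1) (i + 4))

/-! ### The coefficients `c_μ(r)` -/

/-- The row lengths of the diagram consisting of a rectangle with `a` rows and `b` columns, with
`σ` (a partition with at most `a` rows) attached to its right side and `τ` attached beneath. -/
def attach (a b : ℕ) (σ τ : YoungDiagram) : List ℕ :=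
  (List.range a).map (fun k => b + σ.rowLen k) ++ τ.rowLens

open scoped Classical in
/-- The element that replaces the basis element `s_{μ_1} ⊗ ⋯ ⊗ s_{μ_n}`: the sum over all
partitions `σ_i`, `τ_i`, where `σ_i` has at most as many rows as the `i`-th rectangle in the top
row, of `∏ c^{μ_i}_{σ_i τ_i}` times the tensor product whose `i`-th factor is given by the `i`-th
rectangle in the top row with `σ_i` to its right and `τ_{i-1}` beneath (`τ_0 = σ_{n+1} = ∅`). -/
noncomputable def replaceBasis (n : ℕ) (r : ℕ → ℕ → ℕ) (μ : Fin n → YoungDiagram) :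
    ⨂[ℤ] _ : Fin (n + 1), SymFun :=
  ∑ᶠ p : (Fin n → YoungDiagram) × (Fin n → YoungDiagram),
    if ∀ i : Fin n, (p.1 i).colLen 0 ≤ rectRows r i (i + 1) then
      (∏ i, lrCoeff (μ i) (p.1 i) (p.2 i)) •
        ⨂ₜ[ℤ] i : Fin (n + 1), schur (attach (rectRows r i (i + 1)) (rectCols r i (i + 1))
          ((Fin.snoc p.1 ⊥ : Fin (n + 1) → YoungDiagram) i)
          ((Fin.cons ⊥ p.2 : Fin (n + 1) → YoungDiagram) i))
    else 0

/-- The element `P_r` of the `n`-th tensor power of the ring of symmetric functions. -/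
noncomputable def quiverP : (n : ℕ) → (ℕ → ℕ → ℕ) → ⨂[ℤ] _ : Fin n, SymFun
  | 0, _ => ⨂ₜ[ℤ] _ : Fin 0, (1 : SymFun)
  | 1, r => ⨂ₜ[ℤ] _ : Fin 1, schur (List.replicate (rectRows r 0 1) (rectCols r 0 1))
  | n + 2, r => ((tensorBasis (n + 1)).repr (quiverP (n + 1) (dropTop r))).sum
      fun μ c => c • replaceBasis (n + 1) r μ

/-- The coefficient `c_μ(r)` of `s_{μ_1} ⊗ ⋯ ⊗ s_{μ_n}` in `P_r`. -/
noncomputable def quiverCoeff (n : ℕ) (r : ℕ → ℕ → ℕ) (μ : Fin n → YoungDiagram) : ℤ :=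
  (tensorBasis n).repr (quiverP n r) μ

/-! ### Tableaux and factor sequences -/

/-- A filling of a diagram with integers, as the list of its rows from top to bottom. -/
abbrev Filling : Type := List (List ℤ)

/-- Semistandard Young tableaux: no row is empty, rows increase weakly, each row is at most as
long as the row above it, and columns increase strictly. -/
def IsTableau (T : Filling) : Prop :=
  (∀ s ∈ T, s ≠ [] ∧ s.Pairwise (· ≤ ·)) ∧
    T.IsChain fun s t => List.Forall₂ (· < ·) (s.take t.length) t

/-- The shape of a tableau, as the list of its row lengths. -/
def shape (T : Filling) : List ℕ := T.map List.length

/-- Row bumping in a single row: `x` replaces the first entry that is strictly larger than `x`,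
which is bumped out, or is put at the end if there is no such entry. -/
def bumpRow (x : ℤ) : List ℤ → List ℤ × Option ℤ
  | [] => ([x], none)
  | y :: s => if x < y then (x :: s, some y) else ((y :: (bumpRow x s).1), (bumpRow x s).2)

/-- Row insertion of an integer into a tableau. -/
def rowInsert : Filling → ℤ → Filling
  | [], x => [[x]]
  | s :: T, x =>
    match bumpRow x s with
    | (s', none) => s' :: T
    | (s', some y) => s' :: rowInsert T y

/-- The product `T · U` of tableaux: the entries of `U` are row inserted into `T`, from left to
right in each row, starting with the bottom row. -/
def tabMul (T U : Filling) : Filling := U.reverse.flatten.foldl rowInsert T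

/-- Tableau diagrams for the rank conditions `r`: each `T i j`, `0 ≤ i < j ≤ n`, is a tableau
whose shape is the rectangle `R_{ij}`, and its entries are strictly larger than the
entries of all other `T k l` with `i ≤ k < l ≤ j`. -/
def IsTableauDiagram (n : ℕ) (r : ℕ → ℕ → ℕ) (T : ℕ → ℕ → Filling) : Prop :=
  ∀ i j, i < j → j ≤ n →
    IsTableau (T i j) ∧
    shape (T i j) =
      (if rectCols r i j = 0 then [] else List.replicate (rectRows r i j) (rectCols r i j)) ∧
    ∀ k l, i ≤ k → k < l → l ≤ j → (k, l) ≠ (i, j) →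
      ∀ x ∈ (T i j).flatten, ∀ y ∈ (T k l).flatten, y < x

/-- `W` is a factor sequence for the tableau diagram `T` with `n` rows. -/
def IsFactorSeq : (n : ℕ) → (ℕ → ℕ → Filling) → (Fin n → Filling) → Prop
  | 0, _, _ => True
  | 1, T, W => W 0 = T 0 1
  | n + 2, T, W => ∃ U P Q : Fin (n + 1) → Filling,
      IsFactorSeq (n + 1) (dropTop T) U ∧
      (∀ i, IsTableau (P i) ∧ IsTableau (Q i) ∧ U i = tabMul (P i) (Q i)) ∧
      ∀ i : Fin (n + 2), W i =
        tabMul (tabMul ((Fin.cons [] Q : Fin (n + 2) → Filling) i) (T i (i + 1)))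
          ((Fin.snoc P [] : Fin (n + 2) → Filling) i)

/-- The set of factor sequences `(W_1, …, W_n)` for `T` such that `W_i` has shape `μ_i`. -/
def factorSeqs (n : ℕ) (T : ℕ → ℕ → Filling) (μ : Fin n → YoungDiagram) :
    Set (Fin n → Filling) :=
  {W | IsFactorSeq n T W ∧ ∀ i, shape (W i) = (μ i).rowLens}

end QuiverFactor

/-! Tableaux are the elements of the plactic monoid (`cl_injOn`, `cl_tab`), so a factor sequence is
a sequence of plactic classes produced by factoring and multiplying; `isFactorSeq_iff` is this
translation. The theorem follows from a sharper identity, `SparseDiagram.exists_quiverP_eq`: $P_r$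
is the sum of $\bigotimes_i s_{\mathrm{shape}(W_i)}$ over the factor sequences $W$, each taken once.
It is proved by induction on $n$.

Let $U$ run through the factor sequences of the diagram without its top row. By the plactic
Littlewood-Richardson rule (`lrCoeff_ydiag`), $c^{\mu_i}_{\sigma\tau}$ with $\mu_i$ the shape of
$U_i$ counts the factorizations of $U_i$ into classes of shapes $\sigma$ and $\tau$. Hence $P_r$ is
a sum over sequences of pairs $(q_i,p_i)$ with $q_0=1$ and $p_iq_{i+1}=U_i$, where $p_i$ has at most
as many rows as the rectangle $R_i$ of the top row. The term is a tensor product of determinants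
$s_I$, where $I$ is $R_i$ with the shape of $p_i$ to its right and that of $q_i$ beneath. Two things
are wrong with this sum: $I$ need not be a partition, and different sequences can have the same
products $W_i=q_iR_ip_i$.

Both are repaired at one junction $i$ at a time. A pair is good if attaching the tableaux themselves
to $R_i$ gives a tableau. This tableau is then that of $q_iR_ip_i$, its Schur function is $s_I$, and
it determines the pair (`rowsOf_tab_good`, `schur_ydiag_good`, `good_injective`). Bad pairs cancel
(`sum_junction`): the rows of $p_i$ and $q_i$ are read as one array, and behind the first bad
position the tails of two rows are replaced by the unique pair of rows with the same product and
exchanged lengths (`swapPair`). This reflects $I$ and changes the sign of the determinant. On the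
other side, straightening turns every $(q_i,p_i)$ into a good pair with the same product $q_iR_ip_i$
(`exists_good`). The same cancellation (`sum_arrays_eq_sum_good`) computes the image of a Schur
function in the plactic algebra and so gives the Littlewood-Richardson rule.

Letters pass between $q_i$ and $p_i$ in both processes, that is, between $U_{i-1}$ and $U_i$. What
remains is that the changed sequence $U$ is again a factor sequence (`Layer.junctionClosed`), and
here sparseness enters. Below the top row only two rows of classes are non-trivial, say $M$ and $S$,
so $U_i=Y_iM_iX_i$ with $X_iY_{i+1}=S_i$; moreover no two neighbors $S_i$, $S_{i+1}$ are both
non-trivial. So where $S_{i-1}\ne1$, $U_{i-1}=M_{i-1}X$ and $U_i=YM_i$ with $XY=S_{i-1}$. The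
letters that move are larger than those of $M_{i-1}$ and $M_i$, and moving them only gives another
factorization of $S_{i-1}$ (`exchange_letters`, `move_rows`). The required comparisons between sides
of rectangles come from the rank inequality `CanOccur.add_le_add`. -/

namespace QuiverFactor

/-! ### The plactic monoid -/

/-- The elementary Knuth relations. -/
inductive KnuthRel : FreeMonoid ℤ → FreeMonoid ℤ → Prop
  | right {x y z : ℤ} (hxy : x < y) (hyz : y ≤ z) :
      KnuthRel (FreeMonoid.ofList [y, z, x]) (FreeMonoid.ofList [y, x, z])
  | left {x y z : ℤ} (hxy : x ≤ y) (hyz : y < z) :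
      KnuthRel (FreeMonoid.ofList [x, z, y]) (FreeMonoid.ofList [z, x, y])

/-- The plactic monoid on the alphabet `ℤ`. -/
abbrev Plactic : Type := (conGen KnuthRel).Quotient

/-- The plactic class of a word. -/
def pl (w : List ℤ) : Plactic := ((FreeMonoid.ofList w : FreeMonoid ℤ) : (conGen KnuthRel).Quotient)

@[simp] theorem pl_nil : pl [] = 1 := rfl

@[simp] theorem pl_append (u v : List ℤ) : pl (u ++ v) = pl u * pl v := rfl

theorem pl_cons (a : ℤ) (u : List ℤ) : pl (a :: u) = pl [a] * pl u := rfl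

theorem pl_surjective : Function.Surjective pl := by
  intro V
  induction V using Con.induction_on with
  | H w => exact ⟨FreeMonoid.toList w, rfl⟩

theorem pl_right {x y z : ℤ} (hxy : x < y) (hyz : y ≤ z) : pl [y, z, x] = pl [y, x, z] :=
  (Con.eq _).2 (ConGen.Rel.of _ _ (KnuthRel.right hxy hyz))

theorem pl_left {x y z : ℤ} (hxy : x ≤ y) (hyz : y < z) : pl [x, z, y] = pl [z, x, y] :=
  (Con.eq _).2 (ConGen.Rel.of _ _ (KnuthRel.left hxy hyz))

/-- A congruence on words that contains the Knuth relations holds for plactically equal words. -/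
theorem rel_of_pl_eq (R : List ℤ → List ℤ → Prop) (hR : Equivalence R)
    (happ : ∀ {u u' v v'}, R u u' → R v v' → R (u ++ v) (u' ++ v'))
    (h1 : ∀ {x y z : ℤ}, x < y → y ≤ z → R [y, z, x] [y, x, z])
    (h2 : ∀ {x y z : ℤ}, x ≤ y → y < z → R [x, z, y] [z, x, y])
    {u v : List ℤ} (h : pl u = pl v) : R u v := by
  let c : Con (FreeMonoid ℤ) :=
    { r := fun a b => R (FreeMonoid.toList a) (FreeMonoid.toList b)
      iseqv := ⟨fun _ => hR.refl _, fun h => hR.symm h, fun h h' => hR.trans h h'⟩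
      mul' := fun h h' => happ h h' }
  have hle : conGen KnuthRel ≤ c := by
    refine Con.conGen_le.2 ?_
    intro a b hab
    cases hab with
    | right hxy hyz => exact h1 hxy hyz
    | left hxy hyz => exact h2 hxy hyz
  exact hle ((Con.eq _).1 h)

/-- Lifting a function on words to the plactic monoid, as a homomorphism. -/
theorem exists_hom {N : Type*} [Monoid N] (f : List ℤ → N) (h1 : f [] = 1)
    (hm : ∀ u v, f (u ++ v) = f u * f v)
    (hr : ∀ {x y z : ℤ}, x < y → y ≤ z → f [y, z, x] = f [y, x, z])
    (hl : ∀ {x y z : ℤ}, x ≤ y → y < z → f [x, z, y] = f [z, x, y]) :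
    ∃ g : Plactic →* N, ∀ w, g (pl w) = f w := by
  let f' : FreeMonoid ℤ →* N :=
    { toFun := fun w => f (FreeMonoid.toList w), map_one' := h1, map_mul' := fun u v => hm _ _ }
  have : conGen KnuthRel ≤ Con.ker f' := by
    refine Con.conGen_le.2 ?_
    intro a b hab
    cases hab with
    | right hxy hyz => exact hr hxy hyz
    | left hxy hyz => exact hl hxy hyz
  exact ⟨Con.lift _ f' this, fun w => rfl⟩

/-- Each Knuth relation only permutes its three letters, so the multiset of letters is an invariant
of the class. -/
theorem perm_of_pl_eq {u v : List ℤ} (h : pl u = pl v) : u.Perm v := by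
  refine rel_of_pl_eq List.Perm ⟨List.Perm.refl, List.Perm.symm, List.Perm.trans⟩
    (fun h h' => h.append h') (fun _ _ => ?_) (fun _ _ => ?_) h
  · exact List.Perm.cons _ (List.Perm.swap _ _ _)
  · exact List.Perm.swap _ _ _

theorem mem_iff_of_pl_eq {u v : List ℤ} (h : pl u = pl v) (x : ℤ) : x ∈ u ↔ x ∈ v :=
  (perm_of_pl_eq h).mem_iff

theorem eq_nil_of_pl_eq_one {u : List ℤ} (h : pl u = 1) : u = [] :=
  List.perm_nil.1 (perm_of_pl_eq (h.trans pl_nil.symm))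

/-- `x` is a letter of the plactic class `V`. -/
def IsLetter (x : ℤ) (V : Plactic) : Prop := ∃ w, pl w = V ∧ x ∈ w

@[simp] theorem isLetter_pl {x : ℤ} {w : List ℤ} : IsLetter x (pl w) ↔ x ∈ w :=
  ⟨fun ⟨_, hw, hx⟩ => (mem_iff_of_pl_eq hw x).1 hx, fun h => ⟨w, rfl, h⟩⟩

@[simp] theorem isLetter_mul {x : ℤ} {U V : Plactic} :
    IsLetter x (U * V) ↔ IsLetter x U ∨ IsLetter x V := by
  obtain ⟨u, rfl⟩ := pl_surjective U
  obtain ⟨v, rfl⟩ := pl_surjective V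
  rw [← pl_append, isLetter_pl, isLetter_pl, isLetter_pl, List.mem_append]

@[simp] theorem not_isLetter_one {x : ℤ} : ¬ IsLetter x (1 : Plactic) := by
  rw [← pl_nil, isLetter_pl]; simp

/-- Restriction of plactic classes to the letters at most `t`. -/
theorem exists_small_hom (t : ℤ) :
    ∃ g : Plactic →* Plactic, ∀ w, g (pl w) = pl (w.filter (· ≤ t)) := by
  -- When large letters are deleted, a Knuth relation either survives or first loses `z`; the other
  -- two letters stand in the same order on both sides.
  refine exists_hom _ (by simp) (by simp) ?_ ?_
  · intro x y z hxy hyz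
    by_cases hz : z ≤ t
    · have : y ≤ t := hyz.trans hz
      have : x ≤ t := by omega
      simpa [*] using pl_right hxy hyz
    · by_cases hy : y ≤ t
      · have : x ≤ t := by omega
        simp [*]
      · by_cases hx : x ≤ t <;> simp [*]
  · intro x y z hxy hyz
    by_cases hz : z ≤ t
    · have : y ≤ t := by omega
      have : x ≤ t := by omega
      simpa [*] using pl_left hxy hyz
    · by_cases hy : y ≤ t
      · have : x ≤ t := by omega
        simp [*]
      · by_cases hx : x ≤ t <;> simp [*]

/-- Restriction of plactic classes to the letters larger than `t`. -/
theorem exists_large_hom (t : ℤ) :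
    ∃ g : Plactic →* Plactic, ∀ w, g (pl w) = pl (w.filter (t < ·)) := by
  -- Now `x` is the first letter to disappear, and `y`, `z` stand in the same order on both sides.
  refine exists_hom _ (by simp) (by simp) ?_ ?_
  · intro x y z hxy hyz
    by_cases hx : t < x
    · have : t < y := by omega
      have : t < z := by omega
      simpa [*] using pl_right hxy hyz
    · by_cases hy : t < y
      · have : t < z := by omega
        simp [*]
      · by_cases hz : t < z <;> simp [*]
  · intro x y z hxy hyz
    by_cases hx : t < x
    · have : t < y := by omega
      have : t < z := by omega
      simpa [*] using pl_left hxy hyz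
    · by_cases hy : t < y
      · have : t < z := by omega
        simp [*]
      · by_cases hz : t < z <;> simp [*]

/-! ### Row insertion into a single row -/

/-- Weakly increasing words. -/
def IsRow (s : List ℤ) : Prop := s.Pairwise (· ≤ ·)

theorem isRow_nil : IsRow [] := List.Pairwise.nil

theorem isRow_cons {a : ℤ} {s : List ℤ} : IsRow (a :: s) ↔ (∀ b ∈ s, a ≤ b) ∧ IsRow s :=
  List.pairwise_cons

theorem isRow_append {s t : List ℤ} :
    IsRow (s ++ t) ↔ IsRow s ∧ IsRow t ∧ ∀ a ∈ s, ∀ b ∈ t, a ≤ b :=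
  List.pairwise_append

/-- Successive insertion of the letters of `u` into the row `r`: the resulting row, and the word of
letters that are bumped out. -/
def rowRun : List ℤ → List ℤ → List ℤ × List ℤ
  | r, [] => (r, [])
  | r, x :: u => ((rowRun (bumpRow x r).1 u).1,
      (bumpRow x r).2.toList ++ (rowRun (bumpRow x r).1 u).2)

theorem rowRun_append (r u v : List ℤ) :
    rowRun r (u ++ v) = ((rowRun (rowRun r u).1 v).1,
      (rowRun r u).2 ++ (rowRun (rowRun r u).1 v).2) := by
  induction u generalizing r with
  | nil => simp [rowRun]
  | cons x u ih => simp [rowRun, ih, List.append_assoc]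

theorem rowInsert_cons (s : List ℤ) (T : Filling) (x : ℤ) :
    rowInsert (s :: T) x = (bumpRow x s).1 :: (bumpRow x s).2.toList.foldl rowInsert T := by
  rw [rowInsert]
  rcases h : bumpRow x s with ⟨s', _ | y⟩ <;> simp

/-- Whatever the first row bumps out is inserted, in the same order, into the rows below. Questions
about insertion thereby reduce to a single row. -/
theorem foldl_rowInsert_cons (s : List ℤ) (T : Filling) (u : List ℤ) :
    u.foldl rowInsert (s :: T) = (rowRun s u).1 :: (rowRun s u).2.foldl rowInsert T := by
  induction u generalizing s T with
  | nil => simp [rowRun]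
  | cons x u ih => simp [rowRun, rowInsert_cons, ih, List.foldl_append]

theorem mem_bumpRow {x a : ℤ} {s : List ℤ} (h : a ∈ (bumpRow x s).1) : a = x ∨ a ∈ s := by
  induction s with
  | nil => simpa [bumpRow] using h
  | cons y s ih =>
    rw [bumpRow] at h
    split_ifs at h with hxy
    · simp at h ⊢; tauto
    · simp at h ⊢; tauto

theorem bumpRow_out_mem {x a : ℤ} {s : List ℤ} (h : (bumpRow x s).2 = some a) :
    a ∈ s ∧ x < a := by
  induction s with
  | nil => simp [bumpRow] at h
  | cons y s ih =>
    rw [bumpRow] at h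
    split_ifs at h with hxy
    · simp at h; subst h; simp [hxy]
    · simp at h ⊢; tauto

theorem bumpRow_isRow {x : ℤ} {s : List ℤ} (h : IsRow s) : IsRow (bumpRow x s).1 := by
  induction s with
  | nil => simp [bumpRow, isRow_cons, isRow_nil]
  | cons y s ih =>
    rw [isRow_cons] at h
    rw [bumpRow]
    split_ifs with hxy
    · rw [isRow_cons]
      exact ⟨fun a ha => hxy.le.trans (h.1 a ha), h.2⟩
    · rw [isRow_cons]
      refine ⟨fun a ha => ?_, ih h.2⟩
      rcases mem_bumpRow ha with rfl | ha
      · omega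
      · exact h.1 a ha

theorem rowRun_isRow {u s : List ℤ} (h : IsRow s) : IsRow (rowRun s u).1 := by
  induction u generalizing s with
  | nil => simpa [rowRun]
  | cons x u ih => exact ih (bumpRow_isRow h)

theorem mem_rowRun_row {a : ℤ} {u s : List ℤ} (h : a ∈ (rowRun s u).1) : a ∈ s ∨ a ∈ u := by
  induction u generalizing s with
  | nil => simp [rowRun] at h; exact Or.inl h
  | cons x u ih =>
    rcases ih h with h | h
    · rcases mem_bumpRow h with rfl | h <;> simp [*]
    · simp [h]

/-- The letter `x` travels left through the row by the relation `y z x = y x z`; it stops behind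
`m`, the last position with a letter to its left that can serve as `y`. -/
theorem pl_cons_move_left {m x : ℤ} {s : List ℤ} (h : IsRow (m :: s)) (hx : x < m) :
    pl (m :: s ++ [x]) = pl (m :: x :: s) := by
  induction s generalizing m with
  | nil => rfl
  | cons t s ih =>
    rw [isRow_cons] at h
    have hmt : m ≤ t := h.1 t (by simp)
    calc pl (m :: (t :: s) ++ [x]) = pl [m] * pl (t :: s ++ [x]) := rfl
      _ = pl [m] * pl (t :: x :: s) := by rw [ih h.2 (by omega)]
      _ = pl [m, t, x] * pl s := rfl
      _ = pl [m, x, t] * pl s := by rw [pl_right hx hmt]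
      _ = _ := rfl

/-- The letter `m` travels left by the relation `x z y = z x y`; the witness to its right is the
next letter of `s`, or `x` at the start. -/
theorem pl_move_front {m x : ℤ} {s : List ℤ} (h : IsRow s) (hs : ∀ a ∈ s, a ≤ x) (hx : x < m) :
    pl (s ++ [m, x]) = pl (m :: s ++ [x]) := by
  induction s with
  | nil => rfl
  | cons a s ih =>
    rw [isRow_cons] at h
    have h1 := ih h.2 (fun b hb => hs b (by simp [hb]))
    have e : pl (a :: s ++ [m, x]) = pl (a :: m :: s ++ [x]) := by
      rw [List.cons_append, pl_cons, h1]; rfl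
    rw [e]
    have hax : a ≤ x := hs a (by simp)
    rcases s with _ | ⟨c, s⟩
    · exact pl_left hax hx
    · have hac : a ≤ c := h.1 c (by simp)
      have hc : c ≤ x := hs c (by simp)
      calc pl (a :: m :: (c :: s) ++ [x]) = pl [a, m, c] * pl (s ++ [x]) := rfl
        _ = pl [m, a, c] * pl (s ++ [x]) := by rw [pl_left hac (by omega)]
        _ = _ := rfl

theorem bumpRow_split {x : ℤ} {s : List ℤ} (h : IsRow s) :
    (bumpRow x s = (s ++ [x], none) ∧ ∀ a ∈ s, a ≤ x) ∨
    ∃ s1 m s2, s = s1 ++ m :: s2 ∧ bumpRow x s = (s1 ++ x :: s2, some m) ∧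
      (∀ a ∈ s1, a ≤ x) ∧ x < m := by
  induction s with
  | nil => left; simp [bumpRow]
  | cons y s ih =>
    rw [isRow_cons] at h
    by_cases hxy : x < y
    · right
      exact ⟨[], y, s, rfl, by simp [bumpRow, hxy], by simp, hxy⟩
    · rcases ih h.2 with ⟨e, hs⟩ | ⟨s1, m, s2, e1, e2, e3, e4⟩
      · left
        refine ⟨by simp [bumpRow, hxy, e], ?_⟩
        simp only [List.mem_cons, forall_eq_or_imp]
        exact ⟨by omega, hs⟩
      · right
        refine ⟨y :: s1, m, s2, by simp [e1], by simp [bumpRow, hxy, e2], ?_, e4⟩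
        simp only [List.mem_cons, forall_eq_or_imp]
        exact ⟨by omega, e3⟩

/-- Bumping is a chain of Knuth moves: `x` moves left up to the bumped letter, which then moves to
the front. -/
theorem pl_bumpRow {x : ℤ} {s : List ℤ} (h : IsRow s) :
    pl s * pl [x] = pl (bumpRow x s).2.toList * pl (bumpRow x s).1 := by
  rcases bumpRow_split (x := x) h with ⟨e, _⟩ | ⟨s1, m, s2, rfl, e2, e3, e4⟩
  · simp [e]
  · rw [e2]
    rw [isRow_append] at h
    calc
      pl (s1 ++ m :: s2) * pl [x] = pl s1 * pl (m :: s2 ++ [x]) := by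
        rw [pl_append, pl_append, mul_assoc]
      _ = pl (s1 ++ [m, x]) * pl s2 := by
        rw [pl_cons_move_left h.2.1 e4, pl_append, mul_assoc]; rfl
      _ = pl (m :: s1 ++ [x]) * pl s2 := by rw [pl_move_front h.1 e3 e4]
      _ = pl [m] * pl (s1 ++ x :: s2) := by
        rw [pl_append, pl_cons m s1, pl_append s1, pl_cons x s2]; simp only [mul_assoc]

theorem pl_rowRun {s u : List ℤ} (h : IsRow s) :
    pl s * pl u = pl (rowRun s u).2 * pl (rowRun s u).1 := by
  induction u generalizing s with
  | nil => simp [rowRun]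
  | cons x u ih =>
    rw [pl_cons, ← mul_assoc, pl_bumpRow h, mul_assoc, ih (bumpRow_isRow h)]
    simp [rowRun, mul_assoc]

/-! ### Knuth relations and row insertion -/

/-- Row insertion into one row of Knuth related words gives the same row and Knuth related
output. -/
def SameOut (u v : List ℤ) : Prop :=
  u = v ∨ (∃ x y z : ℤ, x < y ∧ y ≤ z ∧ u = [y, z, x] ∧ v = [y, x, z]) ∨
    (∃ x y z : ℤ, x ≤ y ∧ y < z ∧ u = [x, z, y] ∧ v = [z, x, y])

theorem rowRun_cons_of_le {h x : ℤ} {r u : List ℤ} (hx : h ≤ x) :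
    rowRun (h :: r) (x :: u) = ((rowRun (h :: (bumpRow x r).1) u).1,
      (bumpRow x r).2.toList ++ (rowRun (h :: (bumpRow x r).1) u).2) := by
  simp [rowRun, bumpRow, not_lt.2 hx]

theorem rowRun_cons_of_lt {h x : ℤ} {r u : List ℤ} (hx : x < h) :
    rowRun (h :: r) (x :: u) = ((rowRun (x :: r) u).1, h :: (rowRun (x :: r) u).2) := by
  simp [rowRun, bumpRow, hx]

theorem rowRun_cons_of_forall_le {h : ℤ} {r u : List ℤ} (hu : ∀ x ∈ u, h ≤ x) :
    rowRun (h :: r) u = (h :: (rowRun r u).1, (rowRun r u).2) := by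
  induction u generalizing r with
  | nil => rfl
  | cons x u ih =>
    rw [rowRun_cons_of_le (hu x (by simp)), ih (fun y hy => hu y (by simp [hy]))]
    rfl

/-- Induction on the row. A head that is at most `x` is never touched. If `x < h ≤ y`, only `x`
bumps the head, so the bumped `h` is the smallest output. If `y < h`, then `y` bumps the head and
`x` bumps `y`. In both cases the outputs agree or form a relation of the same type. -/
theorem rowRun_knuth_right {x y z : ℤ} (hxy : x < y) (hyz : y ≤ z) {r : List ℤ} (hr : IsRow r) :
    (rowRun r [y, z, x]).1 = (rowRun r [y, x, z]).1 ∧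
      SameOut (rowRun r [y, z, x]).2 (rowRun r [y, x, z]).2 := by
  have hyx : ¬ y < x := by omega
  have hzy : ¬ z < y := by omega
  have hzx : ¬ z < x := by omega
  induction r with
  | nil => simp [rowRun, bumpRow, *, SameOut]
  | cons h r ih =>
    rw [isRow_cons] at hr
    by_cases h1 : h ≤ x
    · rw [rowRun_cons_of_forall_le (by simp; omega), rowRun_cons_of_forall_le (by simp; omega)]
      exact ⟨by simp [(ih hr.2).1], (ih hr.2).2⟩
    · push Not at h1
      by_cases h2 : h ≤ y
      · have hzh : h ≤ z := by omega
        -- If `y` goes to the end of `r`, so does `z`, because `y ≤ z`. So `z` cannot be the only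
        -- one of the two that bumps a letter.
        have key : (bumpRow y r).2 = none → (bumpRow z (bumpRow y r).1).2 = none := by
          rcases bumpRow_split (x := y) hr.2 with ⟨e, hs⟩ | ⟨s1, m, s2, -, e2, -, -⟩
          · intro _
            rw [e]
            rcases hh : (bumpRow z (r ++ [y])).2 with _ | a
            · rfl
            · obtain ⟨ha, hza⟩ := bumpRow_out_mem hh
              simp at ha
              rcases ha with ha | rfl
              · have := hs a ha; omega
              · omega
          · simp [e2]
        rcases hy : bumpRow y r with ⟨r1, _ | o1⟩
        · have k := key (by rw [hy])
          rw [hy] at k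
          rcases hz : bumpRow z r1 with ⟨r2, o2⟩
          simp only [hz] at k
          subst k
          simp [rowRun, bumpRow, not_lt.2 h2, not_lt.2 hzh, h1, hy, hz, hzx, SameOut]
        · rcases hz : bumpRow z r1 with ⟨r2, _ | o2⟩
          · simp [rowRun, bumpRow, not_lt.2 h2, not_lt.2 hzh, h1, hy, hz, hzx, SameOut]
          · simp [rowRun, bumpRow, not_lt.2 h2, not_lt.2 hzh, h1, hy, hz, hzx]
            refine Or.inr (Or.inl ⟨h, o1, o2, ?_, ?_, rfl, rfl⟩)
            · have := (bumpRow_out_mem (x := y) (s := r) (by rw [hy])).2; omega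
            · obtain ⟨hm, hlt⟩ := bumpRow_out_mem (x := z) (s := r1) (by rw [hz])
              rcases bumpRow_split (x := y) hr.2 with ⟨e, hs⟩ | ⟨s1, m, s2, rfl, e2, e3, e4⟩
              · rw [hy] at e; simp at e
              · rw [hy] at e2
                simp only [Prod.mk.injEq, Option.some.injEq] at e2
                obtain ⟨rfl, rfl⟩ := e2
                have := hr.2
                rw [isRow_append, isRow_cons] at this
                simp at hm
                rcases hm with hm | rfl | hm
                · have := e3 _ hm; omega
                · omega
                · exact this.2.1.1 _ hm
      · push Not at h2
        rcases hz : bumpRow z r with ⟨r1, _ | o1⟩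
        · simp [rowRun, bumpRow, h2, hzy, hxy, hzx, hz, SameOut]
        · simp [rowRun, bumpRow, h2, hzy, hxy, hzx, hz]
          refine Or.inr (Or.inl ⟨y, h, o1, h2, ?_, rfl, rfl⟩)
          exact hr.1 _ (bumpRow_out_mem (x := z) (s := r) (by rw [hz])).1

theorem bumpRow_mem {x : ℤ} {s : List ℤ} : x ∈ (bumpRow x s).1 := by
  induction s with
  | nil => simp [bumpRow]
  | cons y s ih =>
    rw [bumpRow]
    split_ifs <;> simp [ih]

/-- A letter smaller than one just inserted always finds something to bump, at the latest that
letter itself. -/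
theorem bumpRow_after {y z : ℤ} (hyz : y < z) {r : List ℤ} (hr : IsRow r) :
    ∃ r2 a, bumpRow y (bumpRow z r).1 = (r2, some a) ∧ a ≤ z := by
  have hmem := bumpRow_mem (x := z) (s := r)
  have hrow := bumpRow_isRow (x := z) hr
  rcases bumpRow_split (x := y) hrow with ⟨_, hs⟩ | ⟨s1, m, s2, e1, e2, e3, e4⟩
  · have := hs _ hmem; omega
  · refine ⟨_, m, e2, ?_⟩
    rw [e1] at hmem hrow
    rw [isRow_append, isRow_cons] at hrow
    simp at hmem
    rcases hmem with hm | rfl | hm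
    · have := e3 _ hm; omega
    · omega
    · exact hrow.2.1.1 _ hm

/-- Induction on the row as for the other relation. If `z < h`, the outputs are related by the
relation of the other type, which is why `SameOut` contains both. -/
theorem rowRun_knuth_left {x y z : ℤ} (hxy : x ≤ y) (hyz : y < z) {r : List ℤ} (hr : IsRow r) :
    (rowRun r [x, z, y]).1 = (rowRun r [z, x, y]).1 ∧
      SameOut (rowRun r [x, z, y]).2 (rowRun r [z, x, y]).2 := by
  have hzx : ¬ z < x := by omega
  have hyx : ¬ y < x := by omega
  have hxz : x < z := by omega
  induction r with
  | nil => simp [rowRun, bumpRow, *, SameOut]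
  | cons h r ih =>
    rw [isRow_cons] at hr
    by_cases h1 : h ≤ x
    · rw [rowRun_cons_of_forall_le (by simp; omega), rowRun_cons_of_forall_le (by simp; omega)]
      exact ⟨by simp [(ih hr.2).1], (ih hr.2).2⟩
    · push Not at h1
      by_cases h2 : h ≤ z
      · obtain ⟨r2, a, e, haz⟩ := bumpRow_after hyz hr.2
        rcases hz : bumpRow z r with ⟨r1, _ | o1⟩
        · rw [hz] at e
          simp [rowRun, bumpRow, not_lt.2 h2, h1, hzx, hyx, hz, e, SameOut]
        · rw [hz] at e
          simp [rowRun, bumpRow, not_lt.2 h2, h1, hzx, hyx, hz, e]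
          refine Or.inr (Or.inr ⟨h, a, o1, ?_, ?_, rfl, rfl⟩)
          · have := (bumpRow_out_mem (x := y) (s := r1) (by rw [e])).1
            rcases mem_bumpRow (x := z) (s := r) (a := a) (by rw [hz]; exact this) with rfl | hm
            · exact h2
            · exact hr.1 _ hm
          · have := (bumpRow_out_mem (x := z) (s := r) (by rw [hz])).2; omega
      · push Not at h2
        rcases r with _ | ⟨g, r⟩
        · simp [rowRun, bumpRow, h1, h2, hxz, hzx, hyx, hyz, SameOut]
        · have hg : h ≤ g := hr.1 g (by simp)
          have h3 : z < g := by omega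
          have h4 : y < g := by omega
          simp [rowRun, bumpRow, h1, h2, h3, h4, hxz, hzx, hyx, hyz]
          exact Or.inr (Or.inl ⟨z, h, g, h2, hg, rfl, rfl⟩)

/-- Row insertion of Knuth related words gives the same filling. -/
theorem foldl_rowInsert_knuth {T : Filling} (hT : ∀ s ∈ T, IsRow s) {u v : List ℤ}
    (h : SameOut u v) : u.foldl rowInsert T = v.foldl rowInsert T := by
  induction T generalizing u v with
  | nil =>
    rcases h with rfl | ⟨x, y, z, hxy, hyz, rfl, rfl⟩ | ⟨x, y, z, hxy, hyz, rfl, rfl⟩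
    · rfl
    · have : ¬ z < y := by omega
      have : ¬ z < x := by omega
      simp [rowInsert, bumpRow, *]
    · have : ¬ z < x := by omega
      have : ¬ y < x := by omega
      have : x < z := by omega
      simp [rowInsert, bumpRow, *]
  | cons s T ih =>
    have hs := hT s (by simp)
    have hT' : ∀ s ∈ T, IsRow s := fun a ha => hT a (by simp [ha])
    rcases h with rfl | ⟨x, y, z, hxy, hyz, rfl, rfl⟩ | ⟨x, y, z, hxy, hyz, rfl, rfl⟩
    · rfl
    · rw [foldl_rowInsert_cons, foldl_rowInsert_cons, (rowRun_knuth_right hxy hyz hs).1,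
        ih hT' (rowRun_knuth_right hxy hyz hs).2]
    · rw [foldl_rowInsert_cons, foldl_rowInsert_cons, (rowRun_knuth_left hxy hyz hs).1,
        ih hT' (rowRun_knuth_left hxy hyz hs).2]

theorem rowInsert_rows {T : Filling} (hT : ∀ s ∈ T, IsRow s) (x : ℤ) :
    ∀ s ∈ rowInsert T x, IsRow s := by
  induction T generalizing x with
  | nil => simp [rowInsert, isRow_cons, isRow_nil]
  | cons s T ih =>
    rw [rowInsert_cons]
    have hT' : ∀ s ∈ T, IsRow s := fun a ha => hT a (by simp [ha])
    rcases h : bumpRow x s with ⟨s', _ | y⟩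
    all_goals
      have h' := bumpRow_isRow (x := x) (hT s (by simp))
      rw [h] at h'
    · simp; exact ⟨h', hT'⟩
    · simp; exact ⟨h', ih hT' y⟩

theorem foldl_rowInsert_rows {T : Filling} (hT : ∀ s ∈ T, IsRow s) (u : List ℤ) :
    ∀ s ∈ u.foldl rowInsert T, IsRow s := by
  induction u generalizing T with
  | nil => simpa
  | cons x u ih => exact ih (rowInsert_rows hT x)

theorem foldl_rowInsert_congr {T : Filling} (hT : ∀ s ∈ T, IsRow s) {u v : List ℤ}
    (h : pl u = pl v) : u.foldl rowInsert T = v.foldl rowInsert T := by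
  refine rel_of_pl_eq (fun u v => ∀ T : Filling, (∀ s ∈ T, IsRow s) →
    u.foldl rowInsert T = v.foldl rowInsert T) ⟨fun _ _ _ => rfl, fun h T hT => (h T hT).symm,
      fun h h' T hT => (h T hT).trans (h' T hT)⟩ ?_ ?_ ?_ h T hT
  · intro u u' v v' h h' T hT
    rw [List.foldl_append, List.foldl_append, h T hT]
    exact h' _ (foldl_rowInsert_rows hT u')
  · intro x y z hxy hyz T hT
    exact foldl_rowInsert_knuth hT (Or.inr (Or.inl ⟨x, y, z, hxy, hyz, rfl, rfl⟩))
  · intro x y z hxy hyz T hT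
    exact foldl_rowInsert_knuth hT (Or.inr (Or.inr ⟨x, y, z, hxy, hyz, rfl, rfl⟩))

/-! ### Tableaux and the plactic monoid -/

/-- The row `t` can be put beneath the row `s` in a tableau. -/
def Below : List ℤ → List ℤ → Prop
  | _, [] => True
  | [], _ :: _ => False
  | a :: s, b :: t => a < b ∧ Below s t

@[simp] theorem below_nil (s : List ℤ) : Below s [] := by cases s <;> trivial

@[simp] theorem below_cons_cons {a b : ℤ} {s t : List ℤ} :
    Below (a :: s) (b :: t) ↔ a < b ∧ Below s t := Iff.rfl

@[simp] theorem not_below_nil_cons {b : ℤ} {t : List ℤ} : ¬ Below [] (b :: t) := id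

theorem below_nil_left {t : List ℤ} : Below [] t ↔ t = [] := by
  cases t <;> simp

theorem forall₂_take_iff_below {s t : List ℤ} :
    List.Forall₂ (· < ·) (s.take t.length) t ↔ Below s t := by
  induction t generalizing s with
  | nil => simp
  | cons b t ih => cases s <;> simp [ih]

theorem Below.append_left {s t : List ℤ} (h : Below s t) (u : List ℤ) : Below (s ++ u) t := by
  induction t generalizing s with
  | nil => simp
  | cons b t ih =>
    cases s with
    | nil => simp at h
    | cons a s => exact ⟨h.1, ih h.2⟩

theorem Below.cons_left {a : ℤ} {s t : List ℤ} (hs : IsRow (a :: s)) (h : Below s t) :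
    Below (a :: s) t := by
  induction t generalizing s a with
  | nil => simp
  | cons b t ih =>
    cases s with
    | nil => simp at h
    | cons c s =>
      rw [isRow_cons] at hs
      exact ⟨lt_of_le_of_lt (hs.1 c (by simp)) h.1, ih hs.2 h.2⟩

theorem Below.length_le {s t : List ℤ} (h : Below s t) : t.length ≤ s.length := by
  induction t generalizing s with
  | nil => simp
  | cons b t ih =>
    cases s with
    | nil => simp at h
    | cons a s => simpa using ih h.2

theorem isTableau_nil : IsTableau [] := by simp [IsTableau]

theorem isTableau_cons {s : List ℤ} {T : Filling} : IsTableau (s :: T) ↔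
    s ≠ [] ∧ IsRow s ∧ Below s (T.headD []) ∧ IsTableau T := by
  cases T with
  | nil => simp [IsTableau, IsRow]
  | cons t T =>
    simp only [IsTableau, List.mem_cons, forall_eq_or_imp, List.isChain_cons_cons,
      forall₂_take_iff_below, List.headD_cons, IsRow]
    tauto

theorem IsTableau.isRow {T : Filling} (hT : IsTableau T) : ∀ s ∈ T, IsRow s :=
  fun s hs => (hT.1 s hs).2

theorem IsTableau.ne_nil {T : Filling} (hT : IsTableau T) : ∀ s ∈ T, s ≠ [] :=
  fun s hs => (hT.1 s hs).1

theorem below_bumpRow_none {x : ℤ} {s t : List ℤ} (hs : IsRow s) (h : Below s t)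
    (hx : (bumpRow x s).2 = none) : Below (bumpRow x s).1 t := by
  rcases bumpRow_split (x := x) hs with ⟨e, _⟩ | ⟨s1, m, s2, _, e, _, _⟩
  · rw [e]; exact h.append_left _
  · simp [e] at hx

/-- The bumped letter moves weakly to the left: the entry of `t` beneath its old place exceeds it,
so it enters `t` there or earlier. The second conclusion is what the induction needs once `y` has
been placed. -/
theorem below_bumpRow {x y : ℤ} {s t : List ℤ} (hs : IsRow s) (h : Below s t)
    (hx : (bumpRow x s).2 = some y) : Below (bumpRow x s).1 (bumpRow y t).1 ∧
      Below (bumpRow x s).1 t := by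
  induction s generalizing t with
  | nil => simp [bumpRow] at hx
  | cons a s ih =>
    rw [isRow_cons] at hs
    rw [bumpRow] at hx ⊢
    split_ifs at hx ⊢ with hxa
    · simp at hx
      subst hx
      cases t with
      | nil => simp [bumpRow, hxa]
      | cons b t =>
        obtain ⟨h1, h2⟩ := h
        simp [bumpRow, h1, hxa, h2, hxa.trans h1]
    · simp only at hx ⊢
      have hxy := (bumpRow_out_mem hx).2
      cases t with
      | nil => simp [bumpRow]; omega
      | cons b t =>
        obtain ⟨h1, h2⟩ := h
        obtain ⟨i1, i2⟩ := ih hs.2 h2 hx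
        rw [bumpRow]
        split_ifs with hyb
        · exact ⟨⟨by omega, i2⟩, h1, i2⟩
        · exact ⟨⟨h1, i1⟩, h1, i2⟩

theorem headD_rowInsert (T : Filling) (x : ℤ) :
    (rowInsert T x).headD [] = (bumpRow x (T.headD [])).1 := by
  cases T with
  | nil => rfl
  | cons s T => rw [rowInsert_cons]; rfl

theorem bumpRow_ne_nil {x : ℤ} {s : List ℤ} : (bumpRow x s).1 ≠ [] :=
  List.ne_nil_of_mem bumpRow_mem

theorem IsTableau.rowInsert {T : Filling} (hT : IsTableau T) (x : ℤ) :
    IsTableau (rowInsert T x) := by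
  induction T generalizing x with
  | nil => simp [QuiverFactor.rowInsert, isTableau_cons, isRow_cons, isRow_nil, isTableau_nil]
  | cons s T ih =>
    rw [isTableau_cons] at hT
    obtain ⟨-, hs, hb, hT⟩ := hT
    rw [rowInsert_cons, isTableau_cons]
    refine ⟨bumpRow_ne_nil, bumpRow_isRow hs, ?_⟩
    rcases h : (bumpRow x s).2 with _ | y
    · exact ⟨below_bumpRow_none hs hb h, hT⟩
    · simp only [Option.toList, List.foldl_cons, List.foldl_nil]
      refine ⟨?_, ih hT y⟩
      rw [headD_rowInsert]
      exact (below_bumpRow hs hb h).1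

theorem IsTableau.foldl {T : Filling} (hT : IsTableau T) (u : List ℤ) :
    IsTableau (u.foldl QuiverFactor.rowInsert T) := by
  induction u generalizing T with
  | nil => exact hT
  | cons x u ih => exact ih (hT.rowInsert x)

/-- The plactic class of a filling. -/
def cl (T : Filling) : Plactic := pl T.reverse.flatten

@[simp] theorem cl_nil : cl [] = 1 := rfl

@[simp] theorem cl_cons (s : List ℤ) (T : Filling) : cl (s :: T) = cl T * pl s := by
  simp [cl]

theorem cl_rowInsert {T : Filling} (hT : ∀ s ∈ T, IsRow s) (x : ℤ) :
    cl (rowInsert T x) = cl T * pl [x] := by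
  induction T generalizing x with
  | nil => simp [rowInsert]
  | cons s T ih =>
    have hs := hT s (by simp)
    have hT' : ∀ s ∈ T, IsRow s := fun a ha => hT a (by simp [ha])
    rw [rowInsert_cons, cl_cons, cl_cons, mul_assoc, pl_bumpRow hs, ← mul_assoc]
    congr 1
    rcases (bumpRow x s).2 with _ | y
    · simp
    · simp [ih hT']

theorem cl_foldl {T : Filling} (hT : ∀ s ∈ T, IsRow s) (u : List ℤ) :
    cl (u.foldl rowInsert T) = cl T * pl u := by
  induction u generalizing T with
  | nil => simp
  | cons x u ih =>
    rw [List.foldl_cons, ih (rowInsert_rows hT x), cl_rowInsert hT, mul_assoc, ← pl_cons]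

theorem rowRun_nil_left {s : List ℤ} (hs : IsRow s) : rowRun [] s = (s, []) := by
  cases s with
  | nil => rfl
  | cons a s =>
    have h1 : ∀ s : List ℤ, IsRow s → rowRun [] s = (s, []) := by
      intro s
      induction s with
      | nil => intro _; rfl
      | cons a s ih =>
        intro hs
        rw [isRow_cons] at hs
        have : rowRun [] (a :: s) = rowRun [a] s := by simp [rowRun, bumpRow]
        rw [this, rowRun_cons_of_forall_le hs.1, ih hs.2]
    exact h1 _ hs

/-- Each letter of `s` bumps the letter of `t` in its own column, so the whole of `t` is pushed out.
-/
theorem rowRun_of_below {s t : List ℤ} (hs : IsRow s) (h : Below s t) : rowRun t s = (s, t) := by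
  induction t generalizing s with
  | nil => exact rowRun_nil_left hs
  | cons b t ih =>
    cases s with
    | nil => simp at h
    | cons a s =>
      rw [isRow_cons] at hs
      rw [rowRun_cons_of_lt h.1, rowRun_cons_of_forall_le hs.1, ih hs.2 h.2]

theorem foldl_row {s : List ℤ} {T : Filling} (h : IsTableau (s :: T)) :
    s.foldl rowInsert T = s :: T := by
  induction T generalizing s with
  | nil =>
    rw [isTableau_cons] at h
    obtain ⟨hne, hs, -⟩ := h
    cases s with
    | nil => exact absurd rfl hne
    | cons a s =>
      rw [List.foldl_cons]
      show s.foldl rowInsert [[a]] = _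
      rw [isRow_cons] at hs
      rw [foldl_rowInsert_cons, rowRun_cons_of_forall_le hs.1, rowRun_nil_left hs.2]
      rfl
  | cons t T ih =>
    rw [isTableau_cons] at h
    rw [foldl_rowInsert_cons, rowRun_of_below (t := t) h.2.1 h.2.2.1]
    simp only
    rw [ih h.2.2.2]

/-- The reading word begins with the bottom row, and every further row pushes the tableau built so
far down by one row. -/
theorem foldl_word {T : Filling} (h : IsTableau T) : T.reverse.flatten.foldl rowInsert [] = T := by
  induction T with
  | nil => rfl
  | cons s T ih =>
    rw [List.reverse_cons, List.flatten_append, List.foldl_append, ih (isTableau_cons.1 h).2.2.2]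
    simpa using foldl_row h

theorem foldl_eq_of_cl_eq {T : Filling} (h : IsTableau T) {w : List ℤ} (hw : pl w = cl T) :
    w.foldl rowInsert [] = T := by
  rw [foldl_rowInsert_congr (by simp) hw, foldl_word h]

/-- Insertion is constant on plactic classes and recovers a tableau from its reading word. -/
theorem cl_injOn {T U : Filling} (hT : IsTableau T) (hU : IsTableau U) (h : cl T = cl U) :
    T = U := by
  rw [← foldl_word hT, foldl_eq_of_cl_eq hU h]

/-- The tableau in a plactic class. -/
noncomputable def tab (V : Plactic) : Filling := (pl_surjective V).choose.foldl rowInsert []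

theorem isTableau_tab (V : Plactic) : IsTableau (tab V) := isTableau_nil.foldl _

@[simp] theorem cl_tab (V : Plactic) : cl (tab V) = V := by
  rw [tab, cl_foldl (by simp), cl_nil, one_mul, (pl_surjective V).choose_spec]

theorem tab_cl {T : Filling} (hT : IsTableau T) : tab (cl T) = T :=
  cl_injOn (isTableau_tab _) hT (cl_tab _)

theorem tab_pl (w : List ℤ) : tab (pl w) = w.foldl rowInsert [] :=
  (foldl_eq_of_cl_eq (isTableau_tab _) (cl_tab _).symm).symm

theorem IsTableau.tabMul {T : Filling} (hT : IsTableau T) (U : Filling) :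
    IsTableau (tabMul T U) := hT.foldl _

theorem cl_tabMul {T : Filling} (hT : IsTableau T) (U : Filling) :
    cl (tabMul T U) = cl T * cl U := cl_foldl hT.isRow _

theorem isLetter_cl {x : ℤ} {T : Filling} : IsLetter x (cl T) ↔ x ∈ T.flatten := by
  simp [cl]

theorem length_rowInsert_ge (T : Filling) (x : ℤ) : T.length ≤ (rowInsert T x).length := by
  induction T generalizing x with
  | nil => simp
  | cons s T ih =>
    rw [rowInsert_cons]
    rcases (bumpRow x s).2 with _ | y
    · simp
    · simpa using ih y

theorem length_foldl_ge (T : Filling) (u : List ℤ) : T.length ≤ (u.foldl rowInsert T).length := by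
  induction u generalizing T with
  | nil => simp
  | cons x u ih => exact (length_rowInsert_ge T x).trans (ih _)

/-- Multiplication from the right is insertion, which never removes a row. So left factors have at
most as many rows as the product. -/
theorem length_tab_le_mul (U V : Plactic) : (tab U).length ≤ (tab (U * V)).length := by
  obtain ⟨v, rfl⟩ := pl_surjective V
  have : tab (U * pl v) = v.foldl rowInsert (tab U) := by
    refine cl_injOn (isTableau_tab _) ((isTableau_tab _).foldl _) ?_
    rw [cl_tab, cl_foldl (isTableau_tab _).isRow, cl_tab]
  rw [this]
  exact length_foldl_ge _ _

/-! ### Weakly increasing subwords -/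

theorem headD_foldl (T : Filling) (u : List ℤ) :
    (u.foldl rowInsert T).headD [] = (rowRun (T.headD []) u).1 := by
  induction u generalizing T with
  | nil => rfl
  | cons x u ih => rw [List.foldl_cons, ih, headD_rowInsert]; rfl

/-- Schensted's theorem in the form that supports an induction on the word: the entry of the first
row in position `i` is the smallest possible last letter of a weakly increasing subword with `i + 1`
letters. -/
theorem schensted (u : List ℤ) :
    (∀ i v, (rowRun [] u).1[i]? = some v →
      ∃ s, (s ++ [v]).Sublist u ∧ IsRow (s ++ [v]) ∧ s.length = i) ∧
    (∀ s v, (s ++ [v]).Sublist u → IsRow (s ++ [v]) →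
      ∃ r, (rowRun [] u).1[s.length]? = some r ∧ r ≤ v) := by
  induction u using List.reverseRecOn with
  | nil => simp [rowRun]
  | append_singleton u x ih =>
    obtain ⟨iha, ihb⟩ := ih
    have hrow : IsRow (rowRun [] u).1 := rowRun_isRow isRow_nil
    have e : (rowRun [] (u ++ [x])).1 = (bumpRow x (rowRun [] u).1).1 := by
      rw [rowRun_append]; rfl
    rw [e]
    set R := (rowRun [] u).1 with hR
    -- The new letter `x` is placed after the entries `s1` that are at most `x`, and replaces the
    -- head of `s2` if there is one.
    obtain ⟨s1, s2, hR', hs1, hs2, s2', hs2'⟩ : ∃ s1 s2, R = s1 ++ s2 ∧ (∀ a ∈ s1, a ≤ x) ∧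
        (∀ a ∈ s2, x < a) ∧ ∃ s2', (bumpRow x R).1 = s1 ++ x :: s2' ∧ s2' = s2.tail := by
      rcases bumpRow_split (x := x) hrow with ⟨e, hs⟩ | ⟨s1, m, s2, e1, e2, e3, e4⟩
      · exact ⟨R, [], by simp, hs, by simp, [], by rw [e], rfl⟩
      · refine ⟨s1, m :: s2, e1, e3, ?_, s2, by rw [e2], rfl⟩
        rw [e1, isRow_append, isRow_cons] at hrow
        simp only [List.mem_cons, forall_eq_or_imp]
        exact ⟨e4, fun a ha => e4.trans_le (hrow.2.1.1 a ha)⟩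
    obtain ⟨hb, hs2t⟩ := hs2'
    rw [hb]
    have hnew : ∀ i, i ≠ s1.length → ∀ v, (s1 ++ x :: s2')[i]? = some v → R[i]? = some v := by
      intro i hi v hv
      rw [hR']
      rcases lt_or_gt_of_ne hi with h | h
      · rw [List.getElem?_append_left h] at hv ⊢; exact hv
      · rw [List.getElem?_append_right h.le] at hv ⊢
        obtain ⟨j, hj⟩ : ∃ j, i - s1.length = j + 1 := ⟨i - s1.length - 1, by omega⟩
        rw [hj] at hv ⊢
        rw [List.getElem?_cons_succ, hs2t, List.getElem?_tail] at hv
        exact hv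
    constructor
    · intro i v hv
      by_cases hi : i = s1.length
      · subst hi
        simp at hv
        subst hv
        rcases List.eq_nil_or_concat' s1 with rfl | ⟨s1', a, rfl⟩
        · exact ⟨[], by simp, by simp [isRow_cons, isRow_nil], rfl⟩
        · obtain ⟨s, h1, h2, h3⟩ := iha s1'.length a (by rw [hR']; simp)
          refine ⟨s ++ [a], h1.append (List.Sublist.refl _), ?_, by simp [h3]⟩
          rw [isRow_append]
          refine ⟨h2, by simp [isRow_cons, isRow_nil], ?_⟩
          have ha : a ≤ x := hs1 a (by simp)
          rw [isRow_append] at h2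
          intro c hc d hd
          simp at hc hd
          subst hd
          rcases hc with hc | rfl
          · exact (h2.2.2 c hc a (by simp)).trans ha
          · exact ha
      · obtain ⟨s, h1, h2, h3⟩ := iha i v (hnew i hi v hv)
        exact ⟨s, h1.trans (List.sublist_append_left _ _), h2, h3⟩
    · have hle : ∀ i, i ≤ s1.length → ∃ r, (s1 ++ x :: s2')[i]? = some r ∧ r ≤ x := by
        intro i hi
        rcases hi.lt_or_eq with h | rfl
        · rw [List.getElem?_append_left h]
          exact ⟨s1[i], by simp [h], hs1 _ (List.getElem_mem h)⟩
        · exact ⟨x, by simp, le_rfl⟩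
      intro s v hs hsr
      obtain ⟨t1, t2, ht, ht1, ht2⟩ := List.sublist_append_iff.1 hs
      rcases List.sublist_singleton.1 ht2 with rfl | rfl
      · simp at ht
        obtain ⟨r, hr1, hr2⟩ := ihb s v (ht ▸ ht1) hsr
        rcases le_or_gt s.length s1.length with h | h
        · obtain ⟨r', h1, h2⟩ := hle _ h
          rcases h.lt_or_eq with h | h
          · rw [List.getElem?_append_left h]
            rw [hR', List.getElem?_append_left h] at hr1
            exact ⟨r, hr1, hr2⟩
          · refine ⟨r', h1, ?_⟩
            rw [hR', List.getElem?_append_right h.ge] at hr1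
            have := hs2 r (List.mem_of_getElem? hr1)
            omega
        · refine ⟨r, ?_, hr2⟩
          rw [hR', List.getElem?_append_right h.le] at hr1
          rw [List.getElem?_append_right h.le]
          obtain ⟨j, hj⟩ : ∃ j, s.length - s1.length = j + 1 := ⟨s.length - s1.length - 1, by omega⟩
          rw [hj] at hr1 ⊢
          rw [List.getElem?_cons_succ, hs2t, List.getElem?_tail]
          exact hr1
      · obtain ⟨rfl, hv⟩ := List.append_inj' ht rfl
        simp at hv
        subst hv
        refine hle _ ?_
        rcases List.eq_nil_or_concat' s with rfl | ⟨s', a, rfl⟩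
        · simp
        · rw [isRow_append] at hsr
          obtain ⟨r, hr1, hr2⟩ := ihb s' a ht1 hsr.1
          have hav : a ≤ v := hsr.2.2 a (by simp) v (by simp)
          by_contra hlt
          have h' : s1.length ≤ s'.length := by simp at hlt; omega
          rw [hR', List.getElem?_append_right h'] at hr1
          have := hs2 r (List.mem_of_getElem? hr1)
          omega

/-- All weakly increasing subwords of words in the class `V` have length at most `c`. -/
def WidthLE (V : Plactic) (c : ℕ) : Prop :=
  ∀ w, pl w = V → ∀ s : List ℤ, s.Sublist w → IsRow s → s.length ≤ c

/-- By `schensted`, the longest weakly increasing subword is as long as the first row of the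
tableau, and this depends only on the class. -/
theorem widthLE_iff {w : List ℤ} {c : ℕ} :
    WidthLE (pl w) c ↔ ((tab (pl w)).headD []).length ≤ c := by
  have key : ∀ w, ((tab (pl w)).headD []) = (rowRun [] w).1 := fun w => by
    rw [tab_pl, headD_foldl]; rfl
  constructor
  · intro h
    rw [key]
    rcases List.eq_nil_or_concat' (rowRun [] w).1 with h0 | ⟨s, v, h1⟩
    · simp [h0]
    · obtain ⟨s', h2, h3, h4⟩ := (schensted w).1 s.length v (by rw [h1]; simp)
      have := h w rfl _ h2 h3
      rw [h1]
      simp at this ⊢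
      omega
  · intro h w' hw' s hs hsr
    rw [← hw', key] at h
    rcases List.eq_nil_or_concat' s with rfl | ⟨s, v, rfl⟩
    · simp
    · obtain ⟨r, h1, -⟩ := (schensted w').2 s v hs hsr
      have := (List.getElem?_eq_some_iff.1 h1).1
      simp
      omega

/-- A single word of the class suffices, although `WidthLE` speaks of all of them. Widths of
products can thus be bounded on a convenient word. -/
theorem widthLE_of_forall {w : List ℤ} {c : ℕ}
    (h : ∀ s : List ℤ, s.Sublist w → IsRow s → s.length ≤ c) : WidthLE (pl w) c := by
  rw [widthLE_iff, tab_pl, headD_foldl]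
  rcases List.eq_nil_or_concat' (rowRun [] w).1 with h0 | ⟨s, v, h1⟩
  · simp [h0]
  · obtain ⟨s', h2, h3, h4⟩ := (schensted w).1 s.length v (by rw [h1]; simp)
    have := h _ h2 h3
    simp [h1] at this ⊢
    omega

theorem WidthLE.mul_right {U V : Plactic} {c : ℕ} (h : WidthLE (U * V) c) : WidthLE V c := by
  intro v hv s hs hsr
  obtain ⟨u, rfl⟩ := pl_surjective U
  exact h (u ++ v) (by rw [pl_append, hv]) s (hs.trans (List.sublist_append_right _ _)) hsr

theorem widthLE_cl {T : Filling} (hT : IsTableau T) {c : ℕ} :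
    WidthLE (cl T) c ↔ (T.headD []).length ≤ c := by
  rw [cl, widthLE_iff]
  rw [show tab (pl T.reverse.flatten) = T from tab_cl hT]

/-! ### Arrays of rows -/

/-- The product `z_{N-1} ⋯ z_1 z_0` of the first `N` rows of an array. -/
def rowsProd : ℕ → (ℕ → List ℤ) → Plactic
  | 0, _ => 1
  | N + 1, z => rowsProd N (fun k => z (k + 1)) * pl (z 0)

theorem rowsProd_congr {N : ℕ} {z z' : ℕ → List ℤ} (h : ∀ k < N, z k = z' k) :
    rowsProd N z = rowsProd N z' := by
  induction N generalizing z z' with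
  | zero => rfl
  | succ N ih => rw [rowsProd, rowsProd, ih fun k hk => h (k + 1) (by omega), h 0 (by omega)]

theorem rowsProd_add (a K : ℕ) (z : ℕ → List ℤ) :
    rowsProd (a + K) z = rowsProd K (fun k => z (a + k)) * rowsProd a z := by
  induction a generalizing z with
  | zero => simp [rowsProd]
  | succ a ih =>
    rw [show a + 1 + K = (a + K) + 1 by omega, rowsProd, ih, rowsProd, mul_assoc]
    simp only [add_assoc, add_comm 1]

theorem rowsProd_succ_top (N : ℕ) (z : ℕ → List ℤ) :
    rowsProd (N + 1) z = pl (z N) * rowsProd N z := by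
  rw [rowsProd_add]; simp [rowsProd]

theorem rowsProd_two_rows {N k : ℕ} (hk : k + 1 < N) {z z' : ℕ → List ℤ}
    (hz : ∀ i, i ≠ k → i ≠ k + 1 → z' i = z i)
    (h : pl (z' (k + 1)) * pl (z' k) = pl (z (k + 1)) * pl (z k)) :
    rowsProd N z' = rowsProd N z := by
  obtain ⟨m, rfl⟩ : ∃ m, N = k + (2 + m) := ⟨N - k - 2, by omega⟩
  rw [rowsProd_add, rowsProd_add k, rowsProd_add 2, rowsProd_add 2]
  rw [rowsProd_congr (N := k) (z := z') (z' := z) fun i hi => hz i (by omega) (by omega)]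
  rw [rowsProd_congr (N := m) (z := fun i => z' (k + (2 + i))) (z' := fun i => z (k + (2 + i)))
    fun i hi => hz _ (by omega) (by omega)]
  congr 2

/-- The rows of a filling, as an array. -/
def rowsOf (T : Filling) (k : ℕ) : List ℤ := T.getD k []

@[simp] theorem rowsOf_cons_zero (s : List ℤ) (T : Filling) : rowsOf (s :: T) 0 = s := rfl

@[simp] theorem rowsOf_cons_succ (s : List ℤ) (T : Filling) (k : ℕ) :
    rowsOf (s :: T) (k + 1) = rowsOf T k := rfl

theorem rowsOf_zero (T : Filling) : rowsOf T 0 = T.headD [] := by cases T <;> rfl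

theorem rowsOf_of_length_le {T : Filling} {k : ℕ} (h : T.length ≤ k) : rowsOf T k = [] := by
  rw [rowsOf, List.getD_eq_default _ _ h]

theorem rowsProd_nil (N : ℕ) : rowsProd N (fun _ => []) = 1 := by
  induction N with
  | zero => rfl
  | succ N ih => rw [rowsProd, ih]; rfl

theorem rowsProd_rowsOf {T : Filling} {N : ℕ} (h : T.length ≤ N) : rowsProd N (rowsOf T) = cl T := by
  induction T generalizing N with
  | nil => exact rowsProd_nil N
  | cons s T ih =>
    obtain ⟨N, rfl⟩ : ∃ m, N = m + 1 := ⟨N - 1, by simp at h; omega⟩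
    rw [rowsProd, cl_cons]
    simp only [rowsOf_cons_succ, rowsOf_cons_zero]
    rw [show (fun k => rowsOf T k) = rowsOf T from rfl, ih (by simpa using h)]

/-- Arrays of rows that form a tableau. -/
def IsTabFun (z : ℕ → List ℤ) : Prop := (∀ k, IsRow (z k)) ∧ ∀ k, Below (z k) (z (k + 1))

theorem IsTableau.isTabFun {T : Filling} (hT : IsTableau T) : IsTabFun (rowsOf T) := by
  induction T with
  | nil => exact ⟨fun _ => isRow_nil, fun _ => trivial⟩
  | cons s T ih =>
    rw [isTableau_cons] at hT
    have := ih hT.2.2.2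
    constructor
    · rintro (_ | k)
      · exact hT.2.1
      · exact this.1 k
    · rintro (_ | k)
      · rw [rowsOf_cons_zero, rowsOf_cons_succ, rowsOf_zero]; exact hT.2.2.1
      · exact this.2 k

theorem IsTabFun.eq_nil {z : ℕ → List ℤ} (hz : IsTabFun z) {k : ℕ} (h : z k = []) :
    z (k + 1) = [] := by
  have := hz.2 k
  rwa [h, below_nil_left] at this

theorem exists_tableau {z : ℕ → List ℤ} (hz : IsTabFun z) {N : ℕ} (hN : ∀ k, N ≤ k → z k = []) :
    ∃ T, IsTableau T ∧ T.length ≤ N ∧ rowsOf T = z := by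
  induction N generalizing z with
  | zero => exact ⟨[], isTableau_nil, le_rfl, funext fun k => (hN k (by omega)).symm⟩
  | succ N ih =>
    by_cases h0 : z 0 = []
    · refine ⟨[], isTableau_nil, by simp, funext fun k => ?_⟩
      induction k with
      | zero => exact h0.symm
      | succ k ihk => exact (hz.eq_nil ihk.symm).symm
    · obtain ⟨T, h1, h2, h3⟩ := ih (z := fun k => z (k + 1)) ⟨fun k => hz.1 _, fun k => hz.2 _⟩
        (fun k hk => hN _ (by omega))
      refine ⟨z 0 :: T, ?_, by simpa using h2, ?_⟩
      · rw [isTableau_cons, ← rowsOf_zero, h3]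
        exact ⟨h0, hz.1 0, hz.2 0, h1⟩
      · funext k
        cases k with
        | zero => rfl
        | succ k => exact congrFun h3 k

theorem isTabFun_unique {z z' : ℕ → List ℤ} (hz : IsTabFun z) (hz' : IsTabFun z') {N : ℕ}
    (hN : ∀ k, N ≤ k → z k = []) (hN' : ∀ k, N ≤ k → z' k = [])
    (h : rowsProd N z = rowsProd N z') : z = z' := by
  obtain ⟨T, h1, h2, rfl⟩ := exists_tableau hz hN
  obtain ⟨U, h4, h5, rfl⟩ := exists_tableau hz' hN'
  rw [rowsProd_rowsOf h2, rowsProd_rowsOf h5] at h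
  rw [cl_injOn h1 h4 h]

/-! ### Products of two rows -/

theorem rowRun_cons_row_lt {h x : ℤ} {t s : List ℤ} (hs : IsRow (x :: s)) (hx : x < h) :
    rowRun (h :: t) (x :: s) = (x :: (rowRun t s).1, h :: (rowRun t s).2) := by
  rw [rowRun_cons_of_lt hx, rowRun_cons_of_forall_le (isRow_cons.1 hs).1]

theorem rowRun_cons_row_le {h x : ℤ} {t s : List ℤ} (hs : IsRow (x :: s)) (hx : h ≤ x) :
    rowRun (h :: t) (x :: s) = (h :: (rowRun t (x :: s)).1, (rowRun t (x :: s)).2) := by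
  refine rowRun_cons_of_forall_le ?_
  simp only [List.mem_cons, forall_eq_or_imp]
  exact ⟨hx, fun a ha => hx.trans ((isRow_cons.1 hs).1 a ha)⟩

theorem rowRun_length (y x : List ℤ) :
    (rowRun y x).1.length + (rowRun y x).2.length = y.length + x.length := by
  induction x generalizing y with
  | nil => simp [rowRun]
  | cons a x ih =>
    have h1 : ∀ y : List ℤ, (bumpRow a y).1.length + (bumpRow a y).2.toList.length
        = y.length + 1 := by
      intro y
      induction y with
      | nil => simp [bumpRow]
      | cons b y ih =>
        rw [bumpRow]
        split_ifs
        · simp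
        · simp only [List.length_cons]; omega
    have := ih (bumpRow a y).1
    have := h1 y
    simp only [rowRun, List.length_append, List.length_cons]
    omega

/-- Since `x` increases weakly, its letters bump further and further to the right. So the bumped
letters form a subword of `y`, and together with the new row a tableau with two rows. -/
theorem rowRun_pair {y x : List ℤ} (hy : IsRow y) (hx : IsRow x) :
    IsRow (rowRun y x).2 ∧ Below (rowRun y x).1 (rowRun y x).2 ∧
      (rowRun y x).2.Sublist y ∧ (rowRun y x).2.length ≤ x.length := by
  induction y generalizing x with
  | nil => rw [rowRun_nil_left hx]; simp [isRow_nil]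
  | cons h t ih =>
    cases x with
    | nil => simp [rowRun, isRow_nil]
    | cons a x =>
      rw [isRow_cons] at hy
      by_cases hah : a < h
      · rw [rowRun_cons_row_lt hx hah]
        obtain ⟨h1, h2, h3, h4⟩ := ih hy.2 (isRow_cons.1 hx).2
        refine ⟨?_, ⟨hah, h2⟩, h3.cons_cons h, by simpa using h4⟩
        rw [isRow_cons]
        exact ⟨fun b hb => hy.1 b (h3.subset hb), h1⟩
      · push Not at hah
        rw [rowRun_cons_row_le hx hah]
        obtain ⟨h1, h2, h3, h4⟩ := ih hy.2 hx
        refine ⟨h1, ?_, h3.cons h, h4⟩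
        refine Below.cons_left ?_ h2
        rw [isRow_cons]
        refine ⟨fun b hb => ?_, rowRun_isRow hy.2⟩
        rcases mem_rowRun_row hb with hb | hb
        · exact hy.1 b hb
        · simp at hb
          rcases hb with rfl | hb
          · exact hah
          · exact hah.trans ((isRow_cons.1 hx).1 b hb)

/-- Each letter of `x` finds a strictly larger partner inside `y`, so the bumping never reaches
`yp`. -/
theorem rowRun_append_left {y x s yp : List ℤ} (hx : IsRow x) (hs : s.Sublist y)
    (hxs : List.Forall₂ (· < ·) x s) :
    rowRun (y ++ yp) x = ((rowRun y x).1 ++ yp, (rowRun y x).2) := by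
  induction y generalizing x s with
  | nil =>
    rw [List.sublist_nil] at hs
    subst hs
    rw [List.forall₂_nil_right_iff] at hxs
    subst hxs
    rfl
  | cons h t ih =>
    cases hxs with
    | nil => rfl
    | @cons a b x s hab hxs =>
      rw [List.cons_append]
      by_cases hah : a < h
      · rw [rowRun_cons_row_lt hx hah, rowRun_cons_row_lt hx hah,
          ih (isRow_cons.1 hx).2 (by simpa using hs.tail) hxs]
        rfl
      · push Not at hah
        rw [rowRun_cons_row_le hx hah, rowRun_cons_row_le hx hah, ih hx ?_ (hxs.cons hab)]
        · rfl
        · cases hs with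
          | cons _ h => exact h
          | cons_cons _ h => omega

/-- A row that is matched strictly into `y` commutes with a continuation of `y`. -/
theorem pl_comm_of_forall₂ {y x s yp : List ℤ} (hy : IsRow (y ++ yp)) (hx : IsRow x)
    (hs : s.Sublist y) (hxs : List.Forall₂ (· < ·) x s) :
    pl y * pl yp * pl x = pl y * pl x * pl yp := by
  rw [← pl_append, pl_rowRun hy, rowRun_append_left hx hs hxs,
    pl_rowRun (u := x) (isRow_append.1 hy).1, pl_append, mul_assoc]

/-- Once a letter of `x` bumps nothing it ends the row, and so do all later letters; nothing in the
row then exceeds the last letter of `x`. -/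
theorem rowRun_le_of_lt {y x : List ℤ} (hy : IsRow y) (hx : IsRow x)
    (h : (rowRun y x).2.length < x.length) : ∀ a ∈ (rowRun y x).1, ∃ e ∈ x, a ≤ e := by
  induction x using List.reverseRecOn with
  | nil => simp at h
  | append_singleton x l ih =>
    have hx' := isRow_append.1 hx
    have hrow : IsRow (rowRun y x).1 := rowRun_isRow hy
    rw [rowRun_append] at h ⊢
    have hout : (bumpRow l (rowRun y x).1).2 = none := by
      by_cases hlt : (rowRun y x).2.length < x.length
      · rcases ho : (bumpRow l (rowRun y x).1).2 with _ | a
        · rfl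
        · obtain ⟨h1, h2⟩ := bumpRow_out_mem ho
          obtain ⟨e, he, hae⟩ := ih hx'.1 hlt a h1
          have := hx'.2.2 e he l (by simp)
          omega
      · rcases ho : (bumpRow l (rowRun y x).1).2 with _ | a
        · rfl
        · simp [rowRun, ho] at h
          omega
    rcases bumpRow_split (x := l) hrow with ⟨e, hs⟩ | ⟨s1, m, s2, _, e, _, _⟩
    · simp only [rowRun, e]
      intro a ha
      refine ⟨l, by simp, ?_⟩
      simp at ha
      rcases ha with ha | rfl
      · exact hs a ha
      · exact le_rfl
    · simp [e] at hout

/-- A pair of rows is determined by the lengths and the result of row insertion. -/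
theorem rowRun_injective {y x y' x' : List ℤ} (hy : IsRow y) (hx : IsRow x) (hy' : IsRow y')
    (hx' : IsRow x') (hlen : x.length = x'.length) (h : rowRun y x = rowRun y' x') :
    y = y' ∧ x = x' := by
  induction x using List.reverseRecOn generalizing x' with
  | nil =>
    have : x' = [] := List.eq_nil_of_length_eq_zero hlen.symm
    subst this
    simpa [rowRun] using h
  | append_singleton x l ih =>
    rcases List.eq_nil_or_concat' x' with rfl | ⟨x', l', rfl⟩
    · simp at hlen
    have hlen' : x.length = x'.length := by simpa using hlen
    have hxx := isRow_append.1 hx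
    have hxx' := isRow_append.1 hx'
    have hrow : IsRow (rowRun y x).1 := rowRun_isRow hy
    have hrow' : IsRow (rowRun y' x').1 := rowRun_isRow hy'
    -- If the last letter `l` bumped nothing, it is the last letter of the new row and can be
    -- removed.
    have key : ∀ {y x : List ℤ} {l : ℤ}, IsRow y → IsRow (x ++ [l]) →
        (rowRun y (x ++ [l])).2.length < (x ++ [l]).length →
        rowRun y (x ++ [l]) = ((rowRun y x).1 ++ [l], (rowRun y x).2) := by
      intro y x l hy hx hlt
      have hx' := isRow_append.1 hx
      rw [rowRun_append] at hlt ⊢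
      have hout : (bumpRow l (rowRun y x).1).2 = none := by
        rcases ho : (bumpRow l (rowRun y x).1).2 with _ | a
        · rfl
        · simp [rowRun, ho] at hlt
          obtain ⟨h1, h2⟩ := bumpRow_out_mem ho
          obtain ⟨e, he, hae⟩ := rowRun_le_of_lt hy hx'.1 hlt a h1
          have := hx'.2.2 e he l (by simp)
          omega
      rcases bumpRow_split (x := l) (rowRun_isRow (u := x) hy) with
        ⟨e, hs⟩ | ⟨s1, m, s2, _, e, _, _⟩
      · simp [rowRun, e]
      · simp [e] at hout
    by_cases hlt : (rowRun y (x ++ [l])).2.length < (x ++ [l]).length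
    · have e1 := key hy hx hlt
      have e2 := key hy' hx' (by rw [← h, ← hlen]; exact hlt)
      rw [e1, e2] at h
      simp only [Prod.mk.injEq] at h
      obtain ⟨h1, h2⟩ := List.append_inj' h.1 rfl
      obtain ⟨rfl, rfl⟩ := ih hxx.1 hxx'.1 hlen' (Prod.ext h1 h.2)
      exact ⟨rfl, by rw [h2]⟩
    -- If `l` bumped something, that is the last output `m`. The letters of the new row that are
    -- smaller than `m` end exactly with `l`, which recovers the place of `l`.
    · have key2 : ∀ {y x : List ℤ} {l : ℤ}, IsRow y → IsRow (x ++ [l]) →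
        ¬ (rowRun y (x ++ [l])).2.length < (x ++ [l]).length →
        ∃ s1 m s2, (rowRun y x).1 = s1 ++ m :: s2 ∧ (rowRun y (x ++ [l])).1 = s1 ++ l :: s2 ∧
          (rowRun y (x ++ [l])).2 = (rowRun y x).2 ++ [m] ∧
          (s1 ++ l :: s2).filter (· < m) = s1 ++ [l] ∧
          (s1 ++ l :: s2).filter (fun a => ¬ a < m) = s2 := by
        intro y x l hy hx hlt
        have hlen := (rowRun_pair hy (isRow_append.1 hx).1).2.2.2
        have hr := rowRun_isRow (u := x) hy
        rw [rowRun_append] at hlt ⊢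
        rcases bumpRow_split (x := l) hr with
          ⟨e, hs⟩ | ⟨s1, m, s2, e1, e2, e3, e4⟩
        · simp [rowRun, e] at hlt
          omega
        · refine ⟨s1, m, s2, e1, by simp [rowRun, e2], by simp [rowRun, e2], ?_, ?_⟩
          all_goals
            rw [e1, isRow_append, isRow_cons] at hr
            have f1 : ∀ a ∈ s1, a < m := fun a ha => lt_of_le_of_lt (e3 a ha) e4
            have f2 : ∀ a ∈ s2, ¬ a < m := fun a ha => not_lt.2 (hr.2.1.1 a ha)
          · rw [List.filter_append, List.filter_cons_of_pos (by simpa using e4),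
              List.filter_eq_self.2 (by simpa using f1), List.filter_eq_nil_iff.2 (by simpa using f2)]
          · rw [List.filter_append, List.filter_cons_of_neg (by simpa using e4),
              List.filter_eq_nil_iff.2 (by simpa using f1), List.filter_eq_self.2 (by simpa using f2)]
            rfl
      obtain ⟨s1, m, s2, a1, a2, a3, a4, a5⟩ := key2 hy hx hlt
      obtain ⟨t1, m', t2, b1, b2, b3, b4, b5⟩ := key2 hy' hx' (by rw [← h, ← hlen]; exact hlt)
      rw [← h, a3] at b3
      obtain ⟨h1, h2⟩ := List.append_inj' b3 rfl
      simp at h2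
      subst h2
      rw [← h, a2] at b2
      rw [← b2, a4] at b4
      rw [← b2, a5] at b5
      obtain ⟨h3, h4⟩ := List.append_inj' b4 rfl
      subst h3 b5
      obtain ⟨rfl, rfl⟩ := ih hxx.1 hxx'.1 hlen' (Prod.ext (a1.trans b1.symm) h1)
      exact ⟨rfl, by rw [h4]⟩

theorem bumpRow_append_cons {x m : ℤ} {s1 s2 : List ℤ} (h1 : ∀ a ∈ s1, a ≤ x) (h2 : x < m) :
    bumpRow x (s1 ++ m :: s2) = (s1 ++ x :: s2, some m) := by
  induction s1 with
  | nil => simp [bumpRow, h2]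
  | cons a s1 ih =>
    have := h1 a (by simp)
    rw [List.cons_append, bumpRow, if_neg (by omega), ih fun b hb => h1 b (by simp [hb])]
    rfl

theorem Below.of_append_right {s t u : List ℤ} (h : Below s (t ++ u)) : Below s t := by
  induction t generalizing s with
  | nil => simp
  | cons b t ih =>
    cases s with
    | nil => simp at h
    | cons a s => exact ⟨h.1, ih h.2⟩

theorem Below.of_append_left {s t u : List ℤ} (h : Below (s ++ u) t) (hl : t.length ≤ s.length) :
    Below s t := by
  induction t generalizing s with
  | nil => simp
  | cons b t ih =>
    cases s with
    | nil => simp at hl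
    | cons a s => exact ⟨h.1, ih h.2 (by simpa using hl)⟩

/-- Reverse bumping: the letters of the lower row, taken from the right, are pushed back into the
upper row, and the letters they drive out form `x`. The last clause, that a letter of `x` comes from
`d` and is smaller than some letter of `c`, keeps `x` a row in the induction. -/
theorem Below.exists_pair {c d : List ℤ} (hc : IsRow c) (hd : IsRow d) (h : Below d c) :
    ∃ y x, IsRow y ∧ IsRow x ∧ y.length = d.length ∧ x.length = c.length ∧
      pl y * pl x = pl c * pl d ∧ ∀ a ∈ x, a ∈ d ∧ ∃ g ∈ c, a < g := by
  induction c using List.reverseRecOn generalizing d with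
  | nil => exact ⟨d, [], hd, isRow_nil, rfl, rfl, by simp, by simp⟩
  | append_singleton c g ih =>
    have hc' := isRow_append.1 hc
    -- The letter `g` drives out the last entry `l < g`. This entry lies in column `c.length` or
    -- further right, so the entries above `c` stay in place.
    have hsplit : ∀ (c d : List ℤ), IsRow d → Below d (c ++ [g]) →
        ∃ p l e, d = p ++ l :: e ∧ c.length ≤ p.length ∧ l < g ∧ ∀ a ∈ e, g ≤ a := by
      intro c
      induction c with
      | nil =>
        intro d hd h
        induction d with
        | nil => simp at h
        | cons a d ihd =>
          rw [isRow_cons] at hd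
          by_cases hb : Below d ([] ++ [g])
          · obtain ⟨p, l, e, rfl, -, h2, h3⟩ := ihd hd.2 hb
            exact ⟨a :: p, l, e, rfl, by simp, h2, h3⟩
          · refine ⟨[], a, d, rfl, by simp, h.1, ?_⟩
            cases d with
            | nil => simp
            | cons b d =>
              simp at hb
              have hd2 := isRow_cons.1 hd.2
              simp only [List.mem_cons, forall_eq_or_imp]
              exact ⟨hb, fun a ha => hb.trans (hd2.1 a ha)⟩
      | cons b c ihc =>
        intro d hd h
        cases d with
        | nil => simp at h
        | cons a d =>
          obtain ⟨p, l, e, rfl, h1, h2, h3⟩ := ihc d (isRow_cons.1 hd).2 h.2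
          exact ⟨a :: p, l, e, rfl, by simpa using h1, h2, h3⟩
    obtain ⟨p, l, e, rfl, h1, h2, h3⟩ := hsplit c d hd h
    have hd' := isRow_append.1 hd
    have hle := isRow_cons.1 hd'.2.1
    have hpl : ∀ a ∈ p, a ≤ l := fun a ha => hd'.2.2 a ha l (by simp)
    have hnew : IsRow (p ++ g :: e) := by
      rw [isRow_append, isRow_cons]
      refine ⟨hd'.1, ⟨h3, hle.2⟩, ?_⟩
      intro a ha b hb
      simp at hb
      rcases hb with rfl | hb
      · exact (hpl a ha).trans h2.le
      · exact hd'.2.2 a ha b (by simp [hb])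
    obtain ⟨y, x, k1, k2, k3, k4, k5, k6⟩ := ih (d := p ++ g :: e) hc'.1 hnew
      ((h.of_append_right.of_append_left h1).append_left _)
    have hxl : ∀ a ∈ x, a ∈ p := by
      intro a ha
      obtain ⟨m1, g', m2, m3⟩ := k6 a ha
      have : g' ≤ g := hc'.2.2 g' m2 g (by simp)
      simp at m1
      rcases m1 with m1 | rfl | m1
      · exact m1
      · omega
      · have := h3 a m1; omega
    refine ⟨y, x ++ [l], k1, ?_, by simpa using k3, by simp [k4], ?_, ?_⟩
    · rw [isRow_append, isRow_cons]
      refine ⟨k2, ⟨by simp, isRow_nil⟩, ?_⟩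
      intro a ha b hb
      simp at hb
      subst hb
      exact hpl a (hxl a ha)
    · rw [pl_append, ← mul_assoc, k5, mul_assoc, pl_bumpRow hnew, bumpRow_append_cons hpl h2,
        pl_append c, mul_assoc]
      rfl
    · intro a ha
      simp at ha
      rcases ha with ha | rfl
      · obtain ⟨m1, g', m2, m3⟩ := k6 a ha
        exact ⟨by simp [hxl a ha], g', by simp [m2], m3⟩
      · exact ⟨by simp, g, by simp, h2⟩

/-- The product of two rows can be written as a product of two rows with exchanged lengths. -/
theorem exists_swap {y x : List ℤ} (hy : IsRow y) (hx : IsRow x) :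
    ∃ p : List ℤ × List ℤ, IsRow p.1 ∧ IsRow p.2 ∧ p.1.length = x.length ∧
      p.2.length = y.length ∧ pl p.1 * pl p.2 = pl y * pl x := by
  obtain ⟨h1, h2, h3, h4⟩ := rowRun_pair hy hx
  have hlen := rowRun_length y x
  have hl := h3.length_le
  have hd : IsRow (rowRun y x).1 := rowRun_isRow hy
  set d := (rowRun y x).1
  set c := (rowRun y x).2
  have hdd := hd
  rw [← List.take_append_drop x.length d, isRow_append] at hdd
  have hb : Below (d.take x.length) c := by
    rw [← List.take_append_drop x.length d] at h2
    exact h2.of_append_left (by simp; omega)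
  -- Only the first `x.length` letters of the new row take part in reverse bumping. The remaining
  -- ones are appended to the second row, which then has `c.length + d.length - x.length = y.length`
  -- letters.
  obtain ⟨y', x', k1, k2, k3, k4, k5, k6⟩ := hb.exists_pair h1 hdd.1
  refine ⟨(y', x' ++ d.drop x.length), k1, ?_, ?_, ?_, ?_⟩
  · rw [isRow_append]
    exact ⟨k2, hdd.2.1, fun a ha => hdd.2.2 a (k6 a ha).1⟩
  · rw [k3]; simp; omega
  · simp [k4]; omega
  · rw [pl_rowRun hy, pl_append, ← mul_assoc, k5, mul_assoc, ← pl_append, List.take_append_drop]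

/-- Row insertion gives for both pairs the two rows of the same tableau, and insertion of a row of
known length is reversible. This makes `swapPair` an involution. -/
theorem pair_unique {y x y' x' : List ℤ} (hy : IsRow y) (hx : IsRow x) (hy' : IsRow y')
    (hx' : IsRow x') (hlen : x.length = x'.length) (h : pl y * pl x = pl y' * pl x') :
    y = y' ∧ x = x' := by
  refine rowRun_injective hy hx hy' hx' hlen ?_
  have key : ∀ {y x : List ℤ}, IsRow y → IsRow x →
      IsTabFun (rowsOf [(rowRun y x).1, (rowRun y x).2]) ∧
      rowsProd 2 (rowsOf [(rowRun y x).1, (rowRun y x).2]) = pl y * pl x := by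
    intro y x hy hx
    obtain ⟨h1, h2, -, -⟩ := rowRun_pair hy hx
    refine ⟨⟨?_, ?_⟩, ?_⟩
    · rintro (_ | _ | k)
      · exact rowRun_isRow hy
      · exact h1
      · exact isRow_nil
    · rintro (_ | _ | k)
      · exact h2
      · exact below_nil _
      · exact below_nil _
    · simp [rowsProd, pl_rowRun hy]
  have hk : ∀ (u v : List ℤ) k, 2 ≤ k → rowsOf [u, v] k = [] := fun u v k hk =>
    rowsOf_of_length_le (by simpa using hk)
  have := isTabFun_unique (key hy hx).1 (key hy' hx').1 (hk _ _) (hk _ _)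
    (by rw [(key hy hx).2, (key hy' hx').2, h])
  exact Prod.ext (congrFun this 0) (congrFun this 1)

open scoped Classical in
/-- The involution on pairs of rows that exchanges the lengths and preserves the product. -/
noncomputable def swapPair (y x : List ℤ) : List ℤ × List ℤ :=
  if h : IsRow y ∧ IsRow x then (exists_swap h.1 h.2).choose else (x, y)

theorem swapPair_spec {y x : List ℤ} (hy : IsRow y) (hx : IsRow x) :
    IsRow (swapPair y x).1 ∧ IsRow (swapPair y x).2 ∧ (swapPair y x).1.length = x.length ∧
      (swapPair y x).2.length = y.length ∧
      pl (swapPair y x).1 * pl (swapPair y x).2 = pl y * pl x := by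
  rw [swapPair, dif_pos ⟨hy, hx⟩]
  exact (exists_swap hy hx).choose_spec

theorem swapPair_swapPair {y x : List ℤ} (hy : IsRow y) (hx : IsRow x) :
    swapPair (swapPair y x).1 (swapPair y x).2 = (y, x) := by
  obtain ⟨h1, h2, h3, h4, h5⟩ := swapPair_spec hy hx
  obtain ⟨k1, k2, k3, k4, k5⟩ := swapPair_spec h1 h2
  have := pair_unique k1 k2 hy hx (by rw [k4, h3]) (by rw [k5, h5])
  exact Prod.ext this.1 this.2

theorem mem_swapPair {y x : List ℤ} (hy : IsRow y) (hx : IsRow x) {a : ℤ}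
    (ha : a ∈ (swapPair y x).1 ∨ a ∈ (swapPair y x).2) : a ∈ y ∨ a ∈ x := by
  have h := (swapPair_spec hy hx).2.2.2.2
  rw [← pl_append, ← pl_append] at h
  have := (mem_iff_of_pl_eq h a).1 (by simpa using ha)
  simpa using this

/-! ### Tableaux around a rectangle -/

/-- The first `a` rows of `t` form a tableau of rectangular shape with `b` columns. -/
structure IsRect (a b : ℕ) (t : ℕ → List ℤ) : Prop where
  isRow : ∀ k < a, IsRow (t k)
  length : ∀ k < a, (t k).length = b
  below : ∀ k, k + 1 < a → Below (t k) (t (k + 1))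

theorem Below.forall₂ {s t : List ℤ} (h : Below s t) (hl : s.length = t.length) :
    List.Forall₂ (· < ·) s t := by
  have := forall₂_take_iff_below.2 h
  rwa [List.take_of_length_le hl.le] at this

theorem IsRect.mono {a b : ℕ} {t : ℕ → List ℤ} (h : IsRect (a + 1) b t) : IsRect a b t :=
  ⟨fun k hk => h.isRow k (by omega), fun k hk => h.length k (by omega),
    fun k hk => h.below k (by omega)⟩

theorem IsRect.tail {a b : ℕ} {t : ℕ → List ℤ} (h : IsRect (a + 1) b t) :
    IsRect a b (fun k => t (k + 1)) :=
  ⟨fun k hk => h.isRow _ (by omega), fun k hk => h.length _ (by omega),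
    fun k hk => h.below _ (by omega)⟩

/-- The row of a rectangle above `t a` is matched strictly into `t a`, so it commutes with a
continuation `p` of `t a`; `p` then sits behind the next row and the argument repeats. -/
theorem IsRect.move {a b : ℕ} {t : ℕ → List ℤ} (h : IsRect (a + 1) b t) {p : List ℤ}
    (hp : IsRow p) (htp : ∀ k < a + 1, ∀ x ∈ t k, ∀ y ∈ p, x ≤ y) :
    pl (t a) * pl p * rowsProd a t = pl (t a) * rowsProd a t * pl p := by
  induction a with
  | zero => simp [rowsProd]
  | succ a ih =>
    rw [rowsProd_succ_top]
    have hrow : IsRow (t (a + 1) ++ p) := by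
      rw [isRow_append]
      exact ⟨h.isRow _ (by omega), hp, htp _ (by omega)⟩
    have hc := pl_comm_of_forall₂ hrow (h.isRow a (by omega)) (List.Sublist.refl _)
      ((h.below a (by omega)).forall₂ (by rw [h.length a (by omega), h.length _ (by omega)]))
    have := ih h.mono fun k hk => htp k (by omega)
    calc pl (t (a + 1)) * pl p * (pl (t a) * rowsProd a t)
        = pl (t (a + 1)) * pl p * pl (t a) * rowsProd a t := by simp only [mul_assoc]
      _ = pl (t (a + 1)) * (pl (t a) * pl p * rowsProd a t) := by rw [hc]; simp only [mul_assoc]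
      _ = _ := by rw [this]; simp only [mul_assoc]

/-- Attaching rows to the right side of a rectangle is multiplication from the right. -/
theorem IsRect.rowsProd_append {a b : ℕ} {t p : ℕ → List ℤ} (h : IsRect a b t)
    (hp : ∀ k < a, IsRow (p k))
    (htp : ∀ k < a, ∀ l < a, ∀ x ∈ t k, ∀ y ∈ p l, x ≤ y) :
    rowsProd a (fun k => t k ++ p k) = rowsProd a t * rowsProd a p := by
  induction a with
  | zero => simp [rowsProd]
  | succ a ih =>
    rw [rowsProd_succ_top, rowsProd_succ_top, rowsProd_succ_top,
      ih h.mono (fun k hk => hp k (by omega)) fun k hk l hl => htp k (by omega) l (by omega),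
      pl_append, ← mul_assoc, h.move (hp a (by omega)) fun k hk => htp k hk a (by omega)]
    simp only [mul_assoc]

theorem rowRun_append_of_le {t y x : List ℤ} (h : ∀ a ∈ t, ∀ b ∈ x, a ≤ b) :
    rowRun (t ++ y) x = (t ++ (rowRun y x).1, (rowRun y x).2) := by
  induction t with
  | nil => rfl
  | cons a t ih =>
    rw [List.cons_append, rowRun_cons_of_forall_le (h a (by simp)),
      ih fun b hb => h b (by simp [hb])]
    rfl

/-- Insertion of `x` into the row `t ++ y` passes over the small letters of `t` and bumps out
exactly `y`. -/
theorem pl_row_below {t y x : List ℤ} (ht : IsRow t) (hy : IsRow y) (hx : IsRow x)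
    (h : Below x y) (hty : ∀ a ∈ t, ∀ b ∈ y, a ≤ b) (htx : ∀ a ∈ t, ∀ b ∈ x, a ≤ b) :
    pl t * pl y * pl x = pl y * pl t * pl x := by
  have hr : IsRow (t ++ y) := isRow_append.2 ⟨ht, hy, hty⟩
  rw [← pl_append, pl_rowRun hr, rowRun_append_of_le htx, rowRun_of_below hx h, pl_append,
    mul_assoc]

theorem IsRect.move_row {a b : ℕ} {t c : ℕ → List ℤ} (h : IsRect a b t)
    (hc : ∀ k < a + 1, IsRow (c k)) (hcb : ∀ k < a, Below (c k) (c (k + 1)))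
    (htc : ∀ k < a, ∀ l < a + 1, ∀ x ∈ t k, ∀ y ∈ c l, x ≤ y) :
    rowsProd a t * pl (c a) * rowsProd a c = pl (c a) * rowsProd a t * rowsProd a c := by
  -- Here the rows of `c` are attached to the right of those of `t`, one row too low on the left
  -- side. The step is `t_k c_{k+1} c_k = c_{k+1} t_k c_k`, by which the lower row slips past `t_k`
  -- thanks to the row above it.
  have key : ∀ (a : ℕ) (t c : ℕ → List ℤ), IsRect a b t → (∀ k < a + 1, IsRow (c k)) →
      (∀ k < a, Below (c k) (c (k + 1))) →
      (∀ k < a, ∀ l < a + 1, ∀ x ∈ t k, ∀ y ∈ c l, x ≤ y) →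
      rowsProd a (fun k => t k ++ c (k + 1)) * pl (c 0) =
        pl (c a) * rowsProd a (fun k => t k ++ c k) := by
    intro a
    induction a with
    | zero => intros; simp [rowsProd]
    | succ a ih =>
      intro t c h hc hcb htc
      have := ih (fun k => t (k + 1)) (fun k => c (k + 1)) h.tail (fun k hk => hc _ (by omega))
        (fun k hk => hcb _ (by omega)) fun k hk l hl => htc _ (by omega) _ (by omega)
      rw [rowsProd, rowsProd, ← mul_assoc, ← this, mul_assoc, pl_append, pl_append,
        pl_row_below (h.isRow 0 (by omega)) (hc 1 (by omega)) (hc 0 (by omega)) (hcb 0 (by omega))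
          (htc 0 (by omega) 1 (by omega)) (htc 0 (by omega) 0 (by omega))]
      simp only [mul_assoc]
  have := key a t c h hc hcb htc
  rw [h.rowsProd_append (fun k hk => hc _ (by omega)) fun k hk l hl => htc k hk _ (by omega),
    h.rowsProd_append (fun k hk => hc _ (by omega)) fun k hk l hl => htc k hk _ (by omega)] at this
  rw [mul_assoc (pl (c a)), ← this, mul_assoc, ← rowsProd_succ_top, rowsProd, mul_assoc]

/-- The rows of a tableau below the `a`-th row can be moved to the left of a rectangle with smaller
entries and `a` rows. -/
theorem IsRect.mul_rowsProd {a b : ℕ} {t c : ℕ → List ℤ} (h : IsRect a b t) (hc : IsTabFun c)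
    (htc : ∀ k < a, ∀ l, ∀ x ∈ t k, ∀ y ∈ c l, x ≤ y) (K : ℕ) :
    rowsProd a t * rowsProd (a + K) c =
      rowsProd K (fun k => c (a + k)) * rowsProd a t * rowsProd a c := by
  induction K with
  | zero => simp [rowsProd]
  | succ K ih =>
    have h1 := h.move_row (c := fun k => c (K + k)) (fun k _ => hc.1 _) (fun k _ => hc.2 _)
      fun k hk l _ => htc k hk _
    have e : rowsProd (a + K) c = rowsProd a (fun k => c (K + k)) * rowsProd K c := by
      rw [add_comm a K, rowsProd_add]
    have h2 : rowsProd a t * pl (c (a + K)) * rowsProd (a + K) c =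
        pl (c (a + K)) * rowsProd a t * rowsProd (a + K) c := by
      rw [e, ← mul_assoc, ← mul_assoc, add_comm a K, h1]
    rw [← add_assoc, rowsProd_succ_top, ← mul_assoc, h2, mul_assoc, ih, rowsProd_succ_top]
    simp only [mul_assoc]

/-! ### Cancellation of arrays that are not tableaux -/

theorem Below.getElem? {s t : List ℤ} (h : Below s t) {i : ℕ} {w : ℤ} (hw : t[i]? = some w) :
    ∃ u, s[i]? = some u ∧ u < w := by
  induction t generalizing s i with
  | nil => simp at hw
  | cons b t ih =>
    cases s with
    | nil => simp at h
    | cons a s =>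
      cases i with
      | zero => simp at hw; subst hw; exact ⟨a, rfl, h.1⟩
      | succ i => simpa using ih h.2 (by simpa using hw)

/-- The first position `m` where the row `y`, shifted by `d` columns to the left, cannot be put
beneath the row `x`, and the entry `w` of `y` at this position. -/
structure FirstBad (d : ℕ) (x y : List ℤ) (m : ℕ) (w : ℤ) : Prop where
  length : m ≤ x.length
  forall₂ : List.Forall₂ (· < ·) (x.take m) ((y.drop d).take m)
  get : y[d + m]? = some w
  le : ∀ u ∈ x.drop m, w ≤ u

theorem exists_firstBad {d : ℕ} {x y : List ℤ} (hx : IsRow x) (h : ¬ Below x (y.drop d)) :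
    ∃ m w, FirstBad d x y m w := by
  have key : ∀ (t x : List ℤ), IsRow x → ¬ Below x t → ∃ m w, m ≤ x.length ∧
      List.Forall₂ (· < ·) (x.take m) (t.take m) ∧ t[m]? = some w ∧ ∀ u ∈ x.drop m, w ≤ u := by
    intro t
    induction t with
    | nil => intro x _ h; simp at h
    | cons b t ih =>
      intro x hx h
      cases x with
      | nil => exact ⟨0, b, by simp⟩
      | cons a s =>
        rw [isRow_cons] at hx
        by_cases hab : a < b
        · obtain ⟨m, w, h1, h2, h3, h4⟩ := ih s hx.2 fun hs => h ⟨hab, hs⟩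
          exact ⟨m + 1, w, by simpa using h1, by simpa using ⟨hab, h2⟩, by simpa using h3,
            by simpa using h4⟩
        · push Not at hab
          refine ⟨0, b, by simp, by simp, by simp, ?_⟩
          simp only [List.drop_zero, List.mem_cons, forall_eq_or_imp]
          exact ⟨hab, fun u hu => hab.trans (hx.1 u hu)⟩
  obtain ⟨m, w, h1, h2, h3, h4⟩ := key _ _ hx h
  exact ⟨m, w, h1, h2, by rwa [List.getElem?_drop] at h3, h4⟩

theorem getElem_of_forall₂_take {x t : List ℤ} {m i : ℕ} (hi : i < m) (hm : m ≤ x.length)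
    (h : List.Forall₂ (· < ·) (x.take m) (t.take m)) {w : ℤ} (hw : t[i]? = some w) :
    ∃ u, x[i]? = some u ∧ u < w := by
  have hlen := h.length_eq
  have hi' : i < (x.take m).length := by simp; omega
  have hi'' : i < (t.take m).length := by omega
  have := (List.forall₂_iff_get.1 h).2 i hi' hi''
  simp at this
  have ht : i < t.length := by simp at hi''; omega
  rw [List.getElem?_eq_getElem ht] at hw
  simp at hw
  exact ⟨x[i], by rw [List.getElem?_eq_getElem], by rw [← hw]; exact this⟩

theorem FirstBad.lt_of_lt {d : ℕ} {x y : List ℤ} {m : ℕ} {w : ℤ} (h : FirstBad d x y m w)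
    {i : ℕ} (hi : i < m) {v : ℤ} (hv : y[d + i]? = some v) : ∃ u, x[i]? = some u ∧ u < v :=
  getElem_of_forall₂_take hi h.length h.forall₂ (by rw [List.getElem?_drop]; exact hv)

theorem FirstBad.viol {d : ℕ} {x y : List ℤ} {m : ℕ} {w : ℤ} (h : FirstBad d x y m w) :
    ∀ u, x[m]? = some u → w ≤ u := by
  intro u hu
  refine h.le u ?_
  have : (x.drop m)[0]? = some u := by rw [List.getElem?_drop]; simpa using hu
  exact List.mem_of_getElem? this

theorem FirstBad.unique {d : ℕ} {x y : List ℤ} {m m' : ℕ} {w w' : ℤ} (h : FirstBad d x y m w)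
    (h' : FirstBad d x y m' w') : m = m' ∧ w = w' := by
  rcases lt_trichotomy m m' with hlt | rfl | hlt
  · obtain ⟨u, h1, h2⟩ := h'.lt_of_lt hlt h.get
    have := h.viol u h1
    omega
  · exact ⟨rfl, by simpa [h.get] using h'.get⟩
  · obtain ⟨u, h1, h2⟩ := h.lt_of_lt hlt h'.get
    have := h'.viol u h1
    omega

theorem FirstBad.not_below {d : ℕ} {x y : List ℤ} {m : ℕ} {w : ℤ} (h : FirstBad d x y m w) :
    ¬ Below x (y.drop d) := by
  intro hb
  obtain ⟨u, h1, h2⟩ := hb.getElem? (i := m) (w := w) (by rw [List.getElem?_drop]; exact h.get)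
  have := h.viol u h1
  omega

theorem IsRow.getElem?_le {y : List ℤ} (hy : IsRow y) {i j : ℕ} (hij : i ≤ j) {v w : ℤ}
    (hv : y[i]? = some v) (hw : y[j]? = some w) : v ≤ w := by
  rw [List.getElem?_eq_some_iff] at hv hw
  obtain ⟨hi, rfl⟩ := hv
  obtain ⟨hj, rfl⟩ := hw
  rcases hij.eq_or_lt with rfl | hlt
  · exact le_rfl
  · exact List.pairwise_iff_getElem.1 hy i j hi hj hlt

theorem exists_firstBad_of_viol {d : ℕ} {x y : List ℤ} (hx : IsRow x) (hy : IsRow y) {i : ℕ}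
    {w : ℤ} (hw : y[d + i]? = some w) (h : ∀ u, x[i]? = some u → w ≤ u) :
    ∃ m w', FirstBad d x y m w' ∧ w' ≤ w := by
  have hnb : ¬ Below x (y.drop d) := by
    intro hb
    obtain ⟨u, h1, h2⟩ := hb.getElem? (i := i) (w := w) (by rw [List.getElem?_drop]; exact hw)
    have := h u h1
    omega
  obtain ⟨m, w', hm⟩ := exists_firstBad hx hnb
  refine ⟨m, w', hm, ?_⟩
  rcases lt_or_ge i m with hlt | hle
  · obtain ⟨u, h1, h2⟩ := hm.lt_of_lt hlt hw
    have := h u h1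
    omega
  · exact hy.getElem?_le (by omega) hm.get hw

theorem FirstBad.lt_length {d : ℕ} {x y : List ℤ} {m : ℕ} {w : ℤ} (h : FirstBad d x y m w) :
    d + m < y.length := (List.getElem?_eq_some_iff.1 h.get).1

theorem FirstBad.take_le {d : ℕ} {x y : List ℤ} {m : ℕ} {w : ℤ} (h : FirstBad d x y m w)
    (hy : IsRow y) : ∀ a ∈ y.take (d + m + 1), a ≤ w := by
  intro a ha
  obtain ⟨i, hi, rfl⟩ := List.mem_take_iff_getElem.1 ha
  exact hy.getElem?_le (i := i) (j := d + m) (by omega) (by rw [List.getElem?_eq_getElem]) h.get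

theorem FirstBad.le_drop {d : ℕ} {x y : List ℤ} {m : ℕ} {w : ℤ} (h : FirstBad d x y m w)
    (hy : IsRow y) : ∀ a ∈ y.drop (d + m), w ≤ a := by
  intro a ha
  obtain ⟨i, hi, rfl⟩ := List.mem_drop_iff_getElem.1 ha
  exact hy.getElem?_le (i := d + m) (j := d + m + i) (by omega) h.get
    (by rw [List.getElem?_eq_getElem])

theorem FirstBad.take_lt {d : ℕ} {x y : List ℤ} {m : ℕ} {w : ℤ} (h : FirstBad d x y m w)
    (hy : IsRow y) : ∀ a ∈ x.take m, a < w := by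
  intro a ha
  obtain ⟨i, hi, rfl⟩ := List.mem_take_iff_getElem.1 ha
  have hlt := h.lt_length
  have hy' : y[d + i]? = some y[d + i] := by rw [List.getElem?_eq_getElem]
  obtain ⟨u, h1, h2⟩ := h.lt_of_lt (i := i) (by omega) hy'
  have : x[i] = u := by rwa [List.getElem?_eq_getElem (by omega), Option.some_inj] at h1
  have := hy.getElem?_le (i := d + i) (j := d + m) (by omega) hy' h.get
  omega

theorem FirstBad.sublist {d : ℕ} (y : List ℤ) {m n : ℕ} (hn : d + m ≤ n) :
    ((y.drop d).take m).Sublist (y.take n) := by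
  rw [List.take_drop]
  refine (List.drop_sublist _ _).trans ?_
  have : y.take (m + d) = (y.take n).take (m + d) := by
    rw [List.take_take, min_eq_left (by omega)]
  rw [add_comm d m] at *
  rw [this]
  exact List.take_sublist _ _

/-- Exchange of the tails of the rows `k` and `k + 1` after the first bad position. -/
noncomputable def swapAt (d : ℕ) (z : ℕ → List ℤ) (k m : ℕ) : ℕ → List ℤ :=
  Function.update
    (Function.update z k ((z k).take m ++
      (swapPair ((z (k + 1)).drop (d + m + 1)) ((z k).drop m)).2))
    (k + 1) ((z (k + 1)).take (d + m + 1) ++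
      (swapPair ((z (k + 1)).drop (d + m + 1)) ((z k).drop m)).1)

section swapAt

variable {d : ℕ} {z : ℕ → List ℤ} {k m : ℕ} {w : ℤ}

theorem swapAt_of_ne {i : ℕ} (h1 : i ≠ k) (h2 : i ≠ k + 1) : swapAt d z k m i = z i := by
  rw [swapAt, Function.update_of_ne h2, Function.update_of_ne h1]

theorem swapAt_self : swapAt d z k m k = (z k).take m ++
    (swapPair ((z (k + 1)).drop (d + m + 1)) ((z k).drop m)).2 := by
  rw [swapAt, Function.update_of_ne (by omega), Function.update_self]

theorem swapAt_succ : swapAt d z k m (k + 1) = (z (k + 1)).take (d + m + 1) ++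
    (swapPair ((z (k + 1)).drop (d + m + 1)) ((z k).drop m)).1 := by
  rw [swapAt, Function.update_self]

theorem IsRow.sublist {s t : List ℤ} (ht : IsRow t) (h : s.Sublist t) : IsRow s :=
  List.Pairwise.sublist h ht

/-- Both old tails consist of letters at least `w`, hence so do the new ones, and they can be glued
to the unchanged heads. -/
theorem le_swapPair (hz : ∀ i, IsRow (z i)) (h : FirstBad d (z k) (z (k + 1)) m w) {a : ℤ}
    (ha : a ∈ (swapPair ((z (k + 1)).drop (d + m + 1)) ((z k).drop m)).1 ∨
      a ∈ (swapPair ((z (k + 1)).drop (d + m + 1)) ((z k).drop m)).2) : w ≤ a := by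
  rcases mem_swapPair ((hz _).sublist (List.drop_sublist _ _))
    ((hz _).sublist (List.drop_sublist _ _)) ha with ha | ha
  · refine h.le_drop (hz _) a ?_
    rw [← List.drop_drop] at ha
    exact List.mem_of_mem_drop ha
  · exact h.le a ha

theorem swapAt_isRow (hz : ∀ i, IsRow (z i)) (h : FirstBad d (z k) (z (k + 1)) m w) (i : ℕ) :
    IsRow (swapAt d z k m i) := by
  have hs := swapPair_spec ((hz (k + 1)).sublist (List.drop_sublist (d + m + 1) _))
    ((hz k).sublist (List.drop_sublist m _))
  by_cases h1 : i = k
  · subst h1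
    rw [swapAt_self, isRow_append]
    exact ⟨(hz _).sublist (List.take_sublist _ _), hs.2.1, fun a ha b hb =>
      (h.take_lt (hz _) a ha).le.trans (le_swapPair hz h (Or.inr hb))⟩
  · by_cases h2 : i = k + 1
    · subst h2
      rw [swapAt_succ, isRow_append]
      exact ⟨(hz _).sublist (List.take_sublist _ _), hs.1, fun a ha b hb =>
        (h.take_le (hz _) a ha).trans (le_swapPair hz h (Or.inl hb))⟩
    · rw [swapAt_of_ne h1 h2]
      exact hz i

theorem swapAt_take (h : FirstBad d (z k) (z (k + 1)) m w) :
    (swapAt d z k m k).take m = (z k).take m ∧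
    (swapAt d z k m k).drop m = (swapPair ((z (k + 1)).drop (d + m + 1)) ((z k).drop m)).2 ∧
    (swapAt d z k m (k + 1)).take (d + m + 1) = (z (k + 1)).take (d + m + 1) ∧
    (swapAt d z k m (k + 1)).drop (d + m + 1) =
      (swapPair ((z (k + 1)).drop (d + m + 1)) ((z k).drop m)).1 := by
  have h1 : ((z k).take m).length = m := by simp [h.length]
  have h2 : ((z (k + 1)).take (d + m + 1)).length = d + m + 1 := by
    have := h.lt_length; simp; omega
  rw [swapAt_self, swapAt_succ]
  exact ⟨List.take_left' h1, List.drop_left' h1, List.take_left' h2, List.drop_left' h2⟩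

theorem swapAt_firstBad (hz : ∀ i, IsRow (z i)) (h : FirstBad d (z k) (z (k + 1)) m w) :
    FirstBad d (swapAt d z k m k) (swapAt d z k m (k + 1)) m w := by
  obtain ⟨e1, e2, e3, e4⟩ := swapAt_take h
  refine ⟨?_, ?_, ?_, ?_⟩
  · have : ((swapAt d z k m k).take m).length = m := by rw [e1]; simp [h.length]
    simp at this
    exact this
  · rw [e1]
    have : ∀ l : List ℤ, (l.drop d).take m = ((l.take (d + m + 1)).drop d).take m := by
      intro l
      rw [List.drop_take, List.take_take]
      congr 1
      omega
    rw [this, e3, ← this]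
    exact h.forall₂
  · have : ∀ l : List ℤ, l[d + m]? = (l.take (d + m + 1))[d + m]? := by
      intro l
      rw [List.getElem?_take_of_lt (by omega)]
    rw [this, e3, ← this]
    exact h.get
  · rw [e2]
    exact fun u hu => le_swapPair hz h (Or.inr hu)

theorem swapAt_swapAt (hz : ∀ i, IsRow (z i)) (h : FirstBad d (z k) (z (k + 1)) m w) :
    swapAt d (swapAt d z k m) k m = z := by
  obtain ⟨e1, e2, e3, e4⟩ := swapAt_take h
  have hs := swapPair_swapPair ((hz (k + 1)).sublist (List.drop_sublist (d + m + 1) _))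
    ((hz k).sublist (List.drop_sublist m _))
  funext i
  by_cases h1 : i = k
  · subst h1
    rw [swapAt_self, e1, e2, e4, hs]
    exact List.take_append_drop _ _
  · by_cases h2 : i = k + 1
    · subst h2
      rw [swapAt_succ, e3, e2, e4, hs]
      exact List.take_append_drop _ _
    · rw [swapAt_of_ne h1 h2, swapAt_of_ne h1 h2]

/-- The bad entry `w` stays in the lower row; this is the source of the `+ 1` and of the `∓ 1` in
`reflect`. -/
theorem swapAt_length (hz : ∀ i, IsRow (z i)) (h : FirstBad d (z k) (z (k + 1)) m w) :
    (swapAt d z k m k).length + d + 1 = (z (k + 1)).length ∧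
    (swapAt d z k m (k + 1)).length = (z k).length + d + 1 := by
  have hs := swapPair_spec ((hz (k + 1)).sublist (List.drop_sublist (d + m + 1) _))
    ((hz k).sublist (List.drop_sublist m _))
  have h1 := h.length
  have h2 := h.lt_length
  rw [swapAt_self, swapAt_succ, List.length_append, List.length_append, hs.2.2.1, hs.2.2.2.1]
  simp
  omega

/-- Before the first bad position the upper row is matched strictly into the lower one, so its head
commutes with the tail of the lower row. The two tails become neighbors and may be replaced by any
pair with the same product. -/
theorem FirstBad.pl_mul {x y : List ℤ} (h : FirstBad d x y m w) (hx : IsRow x)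
    (n : ℕ) (hn : d + m ≤ n) {y' x' : List ℤ} (hr : IsRow (y.take n ++ y')) :
    pl (y.take n ++ y') * pl (x.take m ++ x') =
      pl (y.take n) * pl (x.take m) * (pl y' * pl x') := by
  have := pl_comm_of_forall₂ hr (hx.sublist (List.take_sublist m x))
    (FirstBad.sublist y hn) h.forall₂
  rw [pl_append, pl_append, ← mul_assoc, this]
  simp only [mul_assoc]

theorem swapAt_pl (hz : ∀ i, IsRow (z i)) (h : FirstBad d (z k) (z (k + 1)) m w) :
    pl (swapAt d z k m (k + 1)) * pl (swapAt d z k m k) = pl (z (k + 1)) * pl (z k) := by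
  have hs := swapPair_spec ((hz (k + 1)).sublist (List.drop_sublist (d + m + 1) _))
    ((hz k).sublist (List.drop_sublist m _))
  have hr := swapAt_isRow hz h (k + 1)
  rw [swapAt_succ] at hr ⊢
  rw [swapAt_self, h.pl_mul (hz k) _ (by omega) hr, hs.2.2.2.2]
  have hr' : IsRow ((z (k + 1)).take (d + m + 1) ++ (z (k + 1)).drop (d + m + 1)) := by
    rw [List.take_append_drop]; exact hz _
  rw [← h.pl_mul (hz k) _ (by omega) hr', List.take_append_drop, List.take_append_drop]

end swapAt

/-- The first bad position of an array: the bad entry is minimal, and the row is as low as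
possible. -/
structure Selected (J : Finset ℕ) (d : ℕ → ℕ) (z : ℕ → List ℤ) (k m : ℕ) (w : ℤ) : Prop where
  mem : k ∈ J
  firstBad : FirstBad (d k) (z k) (z (k + 1)) m w
  min : ∀ k' ∈ J, ∀ m' w', FirstBad (d k') (z k') (z (k' + 1)) m' w' →
    w < w' ∨ (w = w' ∧ k' ≤ k)

theorem Selected.unique {J : Finset ℕ} {d : ℕ → ℕ} {z : ℕ → List ℤ} {k m k' m' : ℕ} {w w' : ℤ}
    (h : Selected J d z k m w) (h' : Selected J d z k' m' w') : k = k' ∧ m = m' := by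
  have h1 := h.min k' h'.mem m' w' h'.firstBad
  have h2 := h'.min k h.mem m w h.firstBad
  have hk : k = k' := by omega
  subst hk
  exact ⟨rfl, (h.firstBad.unique h'.firstBad).1⟩

theorem exists_selected {J : Finset ℕ} {d : ℕ → ℕ} {z : ℕ → List ℤ} (hz : ∀ i, IsRow (z i))
    (h : ¬ ∀ k ∈ J, Below (z k) ((z (k + 1)).drop (d k))) : ∃ k m w, Selected J d z k m w := by
  classical
  push Not at h
  obtain ⟨k₀, hk₀, hb₀⟩ := h
  have hex : ∀ k, ∃ w : ℤ, ¬ Below (z k) ((z (k + 1)).drop (d k)) →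
      ∃ m, FirstBad (d k) (z k) (z (k + 1)) m w := by
    intro k
    by_cases hb : Below (z k) ((z (k + 1)).drop (d k))
    · exact ⟨0, fun h => absurd hb h⟩
    · obtain ⟨m, w, h⟩ := exists_firstBad (hz k) hb
      exact ⟨w, fun _ => ⟨m, h⟩⟩
  choose w hw using hex
  -- The lexicographic order on `(w, -k)` picks the smallest bad entry and, among equal ones, the
  -- lowest row.
  obtain ⟨k, hk, hmin⟩ := Finset.exists_min_image
    (J.filter fun k => ¬ Below (z k) ((z (k + 1)).drop (d k)))
    (fun k => toLex (w k, -(k : ℤ))) ⟨k₀, by simp [hk₀, hb₀]⟩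
  rw [Finset.mem_filter] at hk
  obtain ⟨m, hm⟩ := hw k hk.2
  refine ⟨k, m, w k, hk.1, hm, ?_⟩
  intro k' hk' m' w' h'
  have hb' := h'.not_below
  have := hmin k' (by simp [hk', hb'])
  obtain ⟨m'', hm''⟩ := hw k' hb'
  obtain ⟨-, rfl⟩ := h'.unique hm''
  rw [Prod.Lex.toLex_le_toLex] at this
  simp only at this
  omega

/-- The swap alters only entries that are at least `w`, so it creates no bad position that would be
selected earlier. Hence a second swap takes place at the same spot and undoes the first. -/
theorem Selected.swapAt {J : Finset ℕ} {d : ℕ → ℕ} {z : ℕ → List ℤ} {k m : ℕ} {w : ℤ}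
    (hz : ∀ i, IsRow (z i)) (h : Selected J d z k m w) :
    Selected J d (swapAt (d k) z k m) k m w := by
  have hfb := h.firstBad
  have hz' := swapAt_isRow hz hfb
  refine ⟨h.mem, swapAt_firstBad hz hfb, ?_⟩
  intro k' hk' m' w' h'
  by_cases h1 : k' = k
  · subst h1
    obtain ⟨-, rfl⟩ := h'.unique (swapAt_firstBad hz hfb)
    right; simp
  · by_cases h2 : k' = k + 1
    · subst h2
      -- A bad entry `w' ≤ w` below row `k + 1` would have been bad before the swap: the entry above
      -- it is unchanged, or it lies in the old tail and was at least `w` there. The old array would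
      -- then have selected row `k + 1` or a smaller entry.
      left
      by_contra hlt
      push Not at hlt
      have hne : (QuiverFactor.swapAt (d k) z k m) (k + 1 + 1) = z (k + 1 + 1) :=
        swapAt_of_ne (by omega) (by omega)
      have hget := h'.get
      rw [hne] at hget
      obtain ⟨m₁, w₁, hb, hw₁⟩ := exists_firstBad_of_viol (d := d (k + 1)) (x := z (k + 1))
        (y := z (k + 1 + 1)) (hz _) (hz _) hget (by
          intro u hu
          rcases lt_or_ge m' (d k + m + 1) with hlt' | hge
          · refine h'.viol u ?_
            have e : ∀ l : List ℤ, l[m']? = (l.take (d k + m + 1))[m']? := fun l => by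
              rw [List.getElem?_take_of_lt hlt']
            rw [e, (swapAt_take hfb).2.2.1, ← e]
            exact hu
          · refine hlt.trans (hfb.le_drop (hz _) u ?_)
            obtain ⟨j, rfl⟩ : ∃ j, m' = d k + m + j := ⟨m' - (d k + m), by omega⟩
            rw [← List.getElem?_drop] at hu
            exact List.mem_of_getElem? hu)
      have := h.min (k + 1) hk' m₁ w₁ hb
      omega
    · by_cases h3 : k' + 1 = k
      · subst h3
        -- Row `k' + 1` now serves as the lower row. Its new entries are at least `w`, so a smaller
        -- bad entry is an old one; equality is harmless because `k'` is the higher row.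
        rcases lt_or_ge w' w with hlt | hge
        · exfalso
          have hne : (QuiverFactor.swapAt (d (k' + 1)) z (k' + 1) m) k' = z k' :=
            swapAt_of_ne (by omega) (by omega)
          have hget := h'.get
          rw [swapAt_self] at hget
          have hm : d k' + m' < ((z (k' + 1)).take m).length := by
            by_contra hge
            push Not at hge
            rw [List.getElem?_append_right hge] at hget
            have := le_swapPair hz hfb (Or.inr (List.mem_of_getElem? hget))
            omega
          rw [List.getElem?_append_left hm, List.getElem?_take_of_lt (by simp at hm; omega)] at hget
          obtain ⟨m₁, w₁, hb, hw₁⟩ := exists_firstBad_of_viol (hz _) (hz _) hget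
            (by rw [← hne]; exact h'.viol)
          have := h.min k' hk' m₁ w₁ hb
          omega
        · omega
      · rw [swapAt_of_ne h1 h2, swapAt_of_ne (by omega) (by omega)] at h'
        exact h.min k' hk' m' w' h'

/-- The reflection `(α_k, α_{k+1}) ↦ (α_{k+1} - 1, α_k + 1)`. -/
def reflect (k : ℕ) (α : ℕ → ℤ) : ℕ → ℤ :=
  Function.update (Function.update α k (α (k + 1) - 1)) (k + 1) (α k + 1)

/-- The tail swap at the selected position is an involution on the arrays that are not good. It acts
on the shifted row lengths by `reflect`, so it changes the sign of `F`. The shifts `s` allow the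
rows to start in different columns, with `d k` the offset between neighbors. -/
theorem sum_arrays_eq_sum_good {M : Type*} [AddCommGroup M] (h2 : ∀ a : M, a + a = 0 → a = 0)
    (J : Finset ℕ) (d : ℕ → ℕ) (s : ℕ → ℤ) (hs : ∀ k ∈ J, s k = s (k + 1) + d k)
    (F : (ℕ → ℤ) → M) (hF : ∀ k ∈ J, ∀ α, F (reflect k α) = -F α)
    (B : Finset (ℕ → List ℤ)) (hrow : ∀ z ∈ B, ∀ k, IsRow (z k))
    (hB : ∀ z ∈ B, ∀ k ∈ J, ∀ m w, FirstBad (d k) (z k) (z (k + 1)) m w →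
      swapAt (d k) z k m ∈ B) {G : Finset (ℕ → List ℤ)}
    (hG : ∀ z, z ∈ G ↔ z ∈ B ∧ ∀ k ∈ J, Below (z k) ((z (k + 1)).drop (d k))) :
    ∑ z ∈ B, F (fun i => s i + (z i).length) = ∑ z ∈ G, F (fun i => s i + (z i).length) := by
  classical
  have hG' : G = B.filter (fun z => ∀ k ∈ J, Below (z k) ((z (k + 1)).drop (d k))) :=
    Finset.ext fun z => by rw [hG, Finset.mem_filter]
  rw [hG', ← Finset.sum_filter_add_sum_filter_not B
    (fun z => ∀ k ∈ J, Below (z k) ((z (k + 1)).drop (d k))), add_eq_left]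
  have hsel : ∀ z ∈ B.filter (fun z => ¬ ∀ k ∈ J, Below (z k) ((z (k + 1)).drop (d k))),
      ∃ p : ℕ × ℕ, ∃ w, Selected J d z p.1 p.2 w := by
    intro z hz
    rw [Finset.mem_filter] at hz
    obtain ⟨k, m, w, h⟩ := exists_selected (hrow z hz.1) hz.2
    exact ⟨(k, m), w, h⟩
  choose p w hp using hsel
  have hneg : ∀ z hz, F (fun i => s i + ((swapAt (d (p z hz).1) z (p z hz).1 (p z hz).2) i).length)
      = - F (fun i => s i + (z i).length) := by
    intro z hz
    have hr := hrow z (Finset.mem_filter.1 hz).1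
    have hf := (hp z hz).firstBad
    rw [← hF _ (hp z hz).mem]
    congr 1
    funext i
    obtain ⟨l1, l2⟩ := swapAt_length hr hf
    have := hs _ (hp z hz).mem
    generalize (p z hz).1 = k at *
    generalize (p z hz).2 = m at *
    by_cases h1 : i = k
    · subst h1
      rw [reflect, Function.update_of_ne (by omega), Function.update_self]
      omega
    · by_cases h2 : i = k + 1
      · subst h2
        rw [reflect, Function.update_self]
        omega
      · rw [reflect, Function.update_of_ne h2, Function.update_of_ne h1, swapAt_of_ne h1 h2]
  have hmem : ∀ z hz, swapAt (d (p z hz).1) z (p z hz).1 (p z hz).2 ∈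
      B.filter (fun z => ¬ ∀ k ∈ J, Below (z k) ((z (k + 1)).drop (d k))) := by
    intro z hz
    have hr := hrow z (Finset.mem_filter.1 hz).1
    rw [Finset.mem_filter]
    refine ⟨hB z (Finset.mem_filter.1 hz).1 _ (hp z hz).mem _ _ (hp z hz).firstBad, ?_⟩
    intro hgood
    exact (swapAt_firstBad hr (hp z hz).firstBad).not_below (hgood _ (hp z hz).mem)
  refine Finset.sum_involution (fun z hz => swapAt (d (p z hz).1) z (p z hz).1 (p z hz).2)
    ?_ ?_ hmem ?_
  · intro z hz
    rw [hneg, add_neg_cancel]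
  · intro z hz hne heq
    have := hneg z hz
    rw [heq] at this
    -- At a fixed array `F` equals its own negative, hence vanishes in the absence of 2-torsion.
    exact hne (h2 _ (by nth_rewrite 1 [this]; rw [neg_add_cancel]))
  · intro z hz
    have hr := hrow z (Finset.mem_filter.1 hz).1
    obtain ⟨h1, h2⟩ := (hp _ (hmem z hz)).unique ((hp z hz).swapAt hr)
    simp only [h1, h2]
    exact swapAt_swapAt hr (hp z hz).firstBad

/-! ### Determinants attached to integer sequences -/

/-- The determinant `det (h_{α_i + j - i})` of size `N`. -/
noncomputable def schurZ (N : ℕ) (α : ℕ → ℤ) : SymFun :=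
  Matrix.det (Matrix.of fun i j : Fin N => hSym (α i + ((j : ℕ) : ℤ) - ((i : ℕ) : ℤ)))

theorem schurZ_congr {N : ℕ} {α β : ℕ → ℤ} (h : ∀ i < N, α i = β i) :
    schurZ N α = schurZ N β := by
  rw [schurZ, schurZ]
  congr 2
  funext i j
  rw [h i i.2]

/-- In the coordinates `α_i - i` the reflection is an adjacent transposition; determinants in these
coordinates are therefore antisymmetric. -/
theorem reflect_sub (k : ℕ) (α : ℕ → ℤ) (i : ℕ) :
    reflect k α i - i = α (Equiv.swap k (k + 1) i) - (Equiv.swap k (k + 1) i : ℕ) := by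
  by_cases h1 : i = k
  · subst h1
    rw [reflect, Function.update_of_ne (by omega), Function.update_self, Equiv.swap_apply_left]
    push_cast; ring
  · by_cases h2 : i = k + 1
    · subst h2
      rw [reflect, Function.update_self, Equiv.swap_apply_right]
      push_cast; ring
    · rw [reflect, Function.update_of_ne h2, Function.update_of_ne h1,
        Equiv.swap_apply_of_ne_of_ne h1 h2]

theorem coe_swap_fin {N k : ℕ} (hk : k + 1 < N) (i : Fin N) :
    ((Equiv.swap (⟨k, by omega⟩ : Fin N) ⟨k + 1, hk⟩ i : Fin N) : ℕ) = Equiv.swap k (k + 1) i := by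
  rw [Equiv.swap_apply_def, Equiv.swap_apply_def]
  simp only [Fin.ext_iff]
  split_ifs <;> rfl

theorem schurZ_reflect {N k : ℕ} (hk : k + 1 < N) (α : ℕ → ℤ) :
    schurZ N (reflect k α) = - schurZ N α := by
  have := Matrix.det_permute (Equiv.swap (⟨k, by omega⟩ : Fin N) ⟨k + 1, hk⟩)
    (Matrix.of fun i j : Fin N => hSym (α i + ((j : ℕ) : ℤ) - ((i : ℕ) : ℤ)))
  rw [Equiv.Perm.sign_swap (by simp [Fin.ext_iff])] at this
  rw [schurZ, schurZ]
  simp only [Units.val_neg, Units.val_one, Int.cast_neg, Int.cast_one, neg_mul, one_mul] at this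
  rw [← this]
  congr 1
  ext1 i j
  simp only [Matrix.of_apply, Matrix.submatrix_apply, id]
  congr 1
  have := reflect_sub k α i
  rw [coe_swap_fin hk]
  linarith

theorem schurZ_succ {N : ℕ} {α : ℕ → ℤ} (h : α N = 0) : schurZ (N + 1) α = schurZ N α := by
  rw [schurZ, Matrix.det_succ_row _ (Fin.last N), Finset.sum_eq_single (Fin.last N)]
  · simp only [Fin.succAbove_last, Matrix.of_apply, Fin.val_last, h]
    have : hSym (0 + (N : ℤ) - N) = 1 := by simp; rfl
    rw [this, ← two_mul, pow_mul]
    simp only [even_two, Even.neg_pow, one_pow, mul_one, one_mul]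
    rfl
  · intro j _ hj
    have hlt : (j : ℕ) < N := by
      have := j.2
      have : (j : ℕ) ≠ N := fun h => hj (Fin.ext h)
      omega
    have : hSym (α N + (j : ℤ) - N) = 0 := by
      rw [hSym_eq, if_pos (by omega)]
    simp [this]
  · simp

theorem schurZ_add {N : ℕ} {α : ℕ → ℤ} (m : ℕ) (h : ∀ i, N ≤ i → α i = 0) :
    schurZ (N + m) α = schurZ N α := by
  induction m with
  | zero => rfl
  | succ m ih => rw [← add_assoc, schurZ_succ (h _ (by omega)), ih]

theorem schur_eq_schurZ {I : List ℕ} {N : ℕ} (h : I.length ≤ N) :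
    schur I = schurZ N (fun i => (I.getD i 0 : ℕ)) := by
  obtain ⟨m, rfl⟩ : ∃ m, N = I.length + m := ⟨N - I.length, by omega⟩
  rw [schurZ_add m (fun i hi => by rw [List.getD_eq_default _ _ hi]; rfl), schur, schurZ]
  congr 2
  funext i j
  simp

/-- The alternating indicator function of the sequence `β`. -/
def indZ (N : ℕ) (β α : ℕ → ℤ) : ℤ :=
  Matrix.det (Matrix.of fun i j : Fin N => if α j - (j : ℕ) = β i - (i : ℕ) then (1 : ℤ) else 0)

theorem indZ_reflect {N k : ℕ} (hk : k + 1 < N) (β α : ℕ → ℤ) :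
    indZ N β (reflect k α) = - indZ N β α := by
  have := Matrix.det_permute' (Equiv.swap (⟨k, by omega⟩ : Fin N) ⟨k + 1, hk⟩)
    (Matrix.of fun i j : Fin N => if α j - (j : ℕ) = β i - (i : ℕ) then (1 : ℤ) else 0)
  rw [Equiv.Perm.sign_swap (by simp [Fin.ext_iff])] at this
  rw [indZ, indZ]
  simp only [Units.val_neg, Units.val_one, Int.cast_neg, Int.cast_one, neg_mul, one_mul] at this
  rw [← this]
  congr 1
  ext1 i j
  simp only [Matrix.of_apply, Matrix.submatrix_apply, id]
  rw [reflect_sub k α j, coe_swap_fin hk]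

/-- The numbers `β_i - i` and `α_j - j` both decrease strictly, so only the identity permutation can
match them. -/
theorem indZ_of_antitone {N : ℕ} {β α : ℕ → ℤ} (hβ : ∀ i, i + 1 < N → β (i + 1) ≤ β i)
    (hα : ∀ i, i + 1 < N → α (i + 1) ≤ α i) :
    indZ N β α = if ∀ i < N, α i = β i then 1 else 0 := by
  have anti : ∀ γ : ℕ → ℤ, (∀ i, i + 1 < N → γ (i + 1) ≤ γ i) →
      ∀ i j, i < j → j < N → γ j - j < γ i - i := by
    intro γ hγ i j hij
    induction j, hij using Nat.le_induction with
    | base => intro h; have := hγ i h; simp only [Nat.succ_eq_add_one] at *; push_cast; omega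
    | succ j hj ih => intro h; have := hγ j h; have := ih (by omega); push_cast; omega
  split_ifs with h
  · rw [indZ]
    have : (Matrix.of fun i j : Fin N => if α j - (j : ℕ) = β i - (i : ℕ) then (1 : ℤ) else 0)
        = 1 := by
      ext1 i j
      rw [Matrix.of_apply, Matrix.one_apply, h j j.2]
      by_cases hij : i = j
      · simp [hij]
      · rw [if_neg hij, if_neg]
        intro he
        rcases lt_or_gt_of_ne (fun h => hij (Fin.ext h) : (i : ℕ) ≠ j) with hlt | hlt
        · have := anti β hβ i j hlt j.2; omega
        · have := anti β hβ j i hlt i.2; omega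
    rw [this, Matrix.det_one]
  · rw [indZ, Matrix.det_apply]
    refine Finset.sum_eq_zero fun p _ => ?_
    by_contra hne
    apply h
    have hne' : ∏ j, (Matrix.of fun i j : Fin N => if α j - (j : ℕ) = β i - (i : ℕ) then (1 : ℤ)
      else 0) (p j) j ≠ 0 := fun h0 => hne (by rw [h0, smul_zero])
    have hall : ∀ j : Fin N, α j - (j : ℕ) = β (p j) - (p j : ℕ) := by
      intro j
      by_contra hj
      exact hne' (Finset.prod_eq_zero (Finset.mem_univ j) (by rw [Matrix.of_apply, if_neg hj]))
    have hmono : StrictMono p := by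
      intro i j hij
      have h1 := anti α hα i j hij j.2
      rw [hall, hall] at h1
      by_contra hle
      push Not at hle
      rcases hle.eq_or_lt with heq | hlt
      · rw [heq] at h1; omega
      · have := anti β hβ _ _ hlt (p i).2
        omega
    have hid : p = 1 := by
      ext i
      have := congrFun (Subsingleton.elim (α := Fin N ≃o Fin N)
        (hmono.orderIsoOfSurjective p p.surjective) (OrderIso.refl _) ▸ rfl :
          ((hmono.orderIsoOfSurjective p p.surjective : Fin N ≃o Fin N) : Fin N → Fin N) =
            (OrderIso.refl _)) i
      simpa using congrArg Fin.val this
    intro i hi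
    have := hall ⟨i, hi⟩
    rw [hid] at this
    simp at this
    exact this

/-! ### Finiteness -/

theorem finite_lists (A : Set ℤ) (hA : A.Finite) (n : ℕ) :
    {l : List ℤ | l.length ≤ n ∧ ∀ x ∈ l, x ∈ A}.Finite := by
  have : Finite A := hA
  refine ((List.finite_length_le A n).image (List.map Subtype.val)).subset ?_
  rintro l ⟨h1, h2⟩
  refine ⟨l.attach.map fun x => ⟨x.1, h2 x.1 x.2⟩, by simpa using h1, ?_⟩
  simp [Function.comp_def]

theorem rowsProd_eq_mul_row {N k : ℕ} (hk : k < N) (z : ℕ → List ℤ) :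
    ∃ U V, rowsProd N z = U * pl (z k) * V := by
  obtain ⟨m, rfl⟩ : ∃ m, N = k + (1 + m) := ⟨N - k - 1, by omega⟩
  rw [rowsProd_add, rowsProd_add 1]
  exact ⟨rowsProd m fun i => z (k + (1 + i)), rowsProd k z, by simp [rowsProd]⟩

/-- Each row is a factor of a word in the class `V`, so its letters and its length are bounded by
those of one fixed word. -/
theorem finite_arrays (N : ℕ) (V : Plactic) :
    {z : ℕ → List ℤ | (∀ k, IsRow (z k)) ∧ (∀ k, N ≤ k → z k = []) ∧ rowsProd N z = V}.Finite := by
  obtain ⟨w, rfl⟩ := pl_surjective V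
  have hL := finite_lists {x | x ∈ w} (List.finite_toSet w) w.length
  set L := {l : List ℤ | l.length ≤ w.length ∧ ∀ x ∈ l, x ∈ {x | x ∈ w}}
  have hpi : {f : Fin N → List ℤ | ∀ i, f i ∈ L}.Finite := Set.Finite.pi' fun _ => hL
  refine (hpi.image fun f k => if h : k < N then f ⟨k, h⟩ else []).subset ?_
  rintro z ⟨h1, h2, h3⟩
  refine ⟨fun i => z i, ?_, ?_⟩
  · intro i
    obtain ⟨U, V, h⟩ := rowsProd_eq_mul_row i.2 z
    obtain ⟨u, rfl⟩ := pl_surjective U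
    obtain ⟨v, rfl⟩ := pl_surjective V
    rw [h3, ← pl_append, ← pl_append] at h
    have hp := perm_of_pl_eq h
    refine ⟨?_, fun x hx => ?_⟩
    · have := hp.length_eq
      simp only [List.length_append] at this
      show (z i).length ≤ w.length
      omega
    · exact hp.symm.subset (by simp [hx])
  · funext k
    by_cases hk : k < N
    · simp [hk]
    · simp [hk, h2 k (by omega)]

theorem isLetter_rowsProd {N : ℕ} {z : ℕ → List ℤ} {x : ℤ} :
    IsLetter x (rowsProd N z) ↔ ∃ k < N, x ∈ z k := by
  induction N with
  | zero => simp [rowsProd]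
  | succ N ih =>
    rw [rowsProd_succ_top, isLetter_mul, isLetter_pl, ih]
    constructor
    · rintro (h | ⟨k, hk, h⟩)
      · exact ⟨N, by omega, h⟩
      · exact ⟨k, by omega, h⟩
    · rintro ⟨k, hk, h⟩
      rcases Nat.lt_succ_iff_lt_or_eq.1 hk with hk | rfl
      · exact Or.inr ⟨k, hk, h⟩
      · exact Or.inl h

/-! ### Symmetric functions in the plactic algebra -/

theorem finite_rowSet (A : Finset ℤ) (k : ℤ) :
    {l : List ℤ | IsRow l ∧ (l.length : ℤ) = k ∧ ∀ x ∈ l, x ∈ A}.Finite := by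
  refine (finite_lists A A.finite_toSet k.toNat).subset ?_
  rintro l ⟨_, h1, h2⟩
  exact ⟨by omega, h2⟩

/-- The rows of length `k` with entries in `A`. -/
noncomputable def rowSet (A : Finset ℤ) (k : ℤ) : Finset (List ℤ) := (finite_rowSet A k).toFinset

theorem mem_rowSet {A : Finset ℤ} {k : ℤ} {l : List ℤ} :
    l ∈ rowSet A k ↔ IsRow l ∧ (l.length : ℤ) = k ∧ ∀ x ∈ l, x ∈ A := by
  simp [rowSet]

/-- The complete symmetric function `h_k` in the plactic algebra. -/
noncomputable def plH (A : Finset ℤ) (k : ℤ) : MonoidAlgebra ℤ Plactic :=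
  ∑ l ∈ rowSet A k, MonoidAlgebra.single (pl l) 1

/-- The map `swapPair` matches the pairs of rows of lengths `(p, q)` with those of lengths `(q, p)`
and preserves their products. -/
theorem plH_comm (A : Finset ℤ) (p q : ℤ) : plH A p * plH A q = plH A q * plH A p := by
  have key : ∀ p q : ℤ, ∀ u ∈ rowSet A p ×ˢ rowSet A q,
      swapPair u.1 u.2 ∈ rowSet A q ×ˢ rowSet A p := by
    intro p q u hu
    rw [Finset.mem_product, mem_rowSet, mem_rowSet] at hu
    obtain ⟨⟨h1, h2, h3⟩, h4, h5, h6⟩ := hu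
    obtain ⟨k1, k2, k3, k4, k5⟩ := swapPair_spec h1 h4
    rw [Finset.mem_product, mem_rowSet, mem_rowSet]
    refine ⟨⟨k1, by omega, fun x hx => ?_⟩, k2, by omega, fun x hx => ?_⟩
    · rcases mem_swapPair h1 h4 (Or.inl hx) with h | h
      · exact h3 x h
      · exact h6 x h
    · rcases mem_swapPair h1 h4 (Or.inr hx) with h | h
      · exact h3 x h
      · exact h6 x h
  rw [plH, plH, Finset.sum_mul_sum, Finset.sum_mul_sum, ← Finset.sum_product', ← Finset.sum_product']
  refine Finset.sum_bij' (fun u _ => swapPair u.1 u.2) (fun u _ => swapPair u.1 u.2)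
    (key p q) (key q p) ?_ ?_ ?_
  · intro u hu
    rw [Finset.mem_product, mem_rowSet, mem_rowSet] at hu
    exact swapPair_swapPair hu.1.1 hu.2.1
  · intro u hu
    rw [Finset.mem_product, mem_rowSet, mem_rowSet] at hu
    exact swapPair_swapPair hu.1.1 hu.2.1
  · intro u hu
    rw [Finset.mem_product, mem_rowSet, mem_rowSet] at hu
    rw [MonoidAlgebra.single_mul_single, MonoidAlgebra.single_mul_single,
      (swapPair_spec hu.1.1 hu.2.1).2.2.2.2]

/-- The plactic algebra is not commutative, but the elements `plH A k` commute and generate a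
commutative subring, to which the polynomial ring maps. -/
theorem exists_plactic_hom (A : Finset ℤ) :
    ∃ Φ : SymFun →+* MonoidAlgebra ℤ Plactic, ∀ k, Φ (hSym k) = plH A k := by
  have := Subring.isMulCommutative_closure (s := Set.range (plH A)) (by
    rintro _ ⟨p, rfl⟩ _ ⟨q, rfl⟩
    exact plH_comm A p q)
  let : CommRing (Subring.closure (Set.range (plH A))) :=
    { (inferInstance : Ring (Subring.closure (Set.range (plH A)))) with
      mul_comm := fun a b => this.is_comm.comm a b }
  let f : SymFun →+* Subring.closure (Set.range (plH A)) :=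
    MvPolynomial.eval₂Hom (Int.castRingHom _) fun k : ℕ =>
      ⟨plH A (k + 1), Subring.subset_closure ⟨_, rfl⟩⟩
  refine ⟨(Subring.closure (Set.range (plH A))).subtype.comp f, fun k => ?_⟩
  match k with
  | Int.ofNat 0 =>
    have : rowSet A (Int.ofNat 0) = {[]} := by
      ext l
      simp only [mem_rowSet, Finset.mem_singleton]
      constructor
      · rintro ⟨_, h, _⟩
        simpa using h
      · rintro rfl
        simp [isRow_nil]
    rw [plH, this]
    simp only [hSym, map_one, Finset.sum_singleton, pl_nil]
    rfl
  | Int.ofNat (k + 1) =>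
    have : f (hSym (Int.ofNat (k + 1))) = ⟨plH A (k + 1), Subring.subset_closure ⟨_, rfl⟩⟩ :=
      MvPolynomial.eval₂Hom_X' _ _ _
    rw [RingHom.comp_apply, this]
    rfl
  | Int.negSucc k =>
    have : rowSet A (Int.negSucc k) = ∅ := by
      ext l
      simp only [mem_rowSet, Finset.notMem_empty, iff_false]
      rintro ⟨_, h, _⟩
      omega
    rw [plH, this]
    simp [hSym]

/-- The product `h_{α_{N-1}} ⋯ h_{α_0}` in the plactic algebra. -/
noncomputable def plHProd (A : Finset ℤ) : ℕ → (ℕ → ℤ) → MonoidAlgebra ℤ Plactic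
  | 0, _ => 1
  | N + 1, α => plHProd A N (fun k => α (k + 1)) * plH A (α 0)

theorem map_prod_hSym {A : Finset ℤ} {Φ : SymFun →+* MonoidAlgebra ℤ Plactic}
    (hΦ : ∀ k, Φ (hSym k) = plH A k) (N : ℕ) (α : ℕ → ℤ) :
    Φ (∏ i : Fin N, hSym (α i)) = plHProd A N α := by
  induction N generalizing α with
  | zero => simp [plHProd]
  | succ N ih =>
    rw [Fin.prod_univ_succ, mul_comm, map_mul, hΦ, plHProd, ← ih]
    rfl

/-- The arrays with `N` rows, entries in `A` and row lengths `α`. -/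
def arraySet (A : Finset ℤ) (N : ℕ) (α : ℕ → ℤ) : Set (ℕ → List ℤ) :=
  {z | (∀ k, N ≤ k → z k = []) ∧ ∀ k < N, z k ∈ rowSet A (α k)}

theorem exists_plHProd (A : Finset ℤ) (N : ℕ) (α : ℕ → ℤ) :
    ∃ s : Finset (ℕ → List ℤ), (s : Set (ℕ → List ℤ)) = arraySet A N α ∧
      plHProd A N α = ∑ z ∈ s, MonoidAlgebra.single (rowsProd N z) 1 := by
  classical
  induction N generalizing α with
  | zero =>
    refine ⟨{fun _ => []}, ?_, by simp [plHProd, rowsProd, MonoidAlgebra.one_def]⟩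
    ext z
    simp only [Finset.coe_singleton, Set.mem_singleton_iff, arraySet, Set.mem_ofPred_eq]
    constructor
    · rintro rfl; simp
    · rintro ⟨h, _⟩; exact funext fun k => h k (by omega)
  | succ N ih =>
    obtain ⟨s, hs, hsum⟩ := ih fun k => α (k + 1)
    let e : (ℕ → List ℤ) × List ℤ → ℕ → List ℤ := fun p k => Nat.casesOn k p.2 p.1
    have he : Function.Injective e := by
      rintro ⟨z, l⟩ ⟨z', l'⟩ h
      exact Prod.ext (funext fun k => congrFun h (k + 1)) (congrFun h 0)
    refine ⟨(s ×ˢ rowSet A (α 0)).image e, ?_, ?_⟩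
    · ext z
      simp only [Finset.coe_image, Set.mem_image, Finset.mem_coe, Finset.mem_product]
      constructor
      · rintro ⟨⟨z', l⟩, ⟨h1, h2⟩, rfl⟩
        have h1' : z' ∈ arraySet A N fun k => α (k + 1) := by rw [← hs]; exact h1
        refine ⟨?_, ?_⟩
        · rintro (_ | k) hk
          · omega
          · exact h1'.1 k (by omega)
        · rintro (_ | k) hk
          · exact h2
          · exact h1'.2 k (by omega)
      · rintro ⟨h1, h2⟩
        refine ⟨(fun k => z (k + 1), z 0), ⟨?_, h2 0 (by omega)⟩, ?_⟩
        · rw [← Finset.mem_coe, hs]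
          exact ⟨fun k hk => h1 _ (by omega), fun k hk => h2 _ (by omega)⟩
        · funext k
          cases k <;> rfl
    · rw [Finset.sum_image (fun a _ b _ h => he h), plHProd, hsum, plH, Finset.sum_mul_sum,
        ← Finset.sum_product']
      refine Finset.sum_congr rfl fun p _ => ?_
      rw [MonoidAlgebra.single_mul_single, mul_one]
      rfl

theorem length_antitone {z : ℕ → List ℤ} (hz : IsTabFun z) (i : ℕ) :
    (z (i + 1)).length ≤ (z i).length := (hz.2 i).length_le

theorem shape_getD (T : Filling) (k : ℕ) : (shape T).getD k 0 = (rowsOf T k).length := by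
  rw [shape, rowsOf, List.getD_eq_getElem?_getD, List.getD_eq_getElem?_getD, List.getElem?_map]
  rcases T[k]? with _ | s <;> rfl

theorem shape_eq_of_length {T : Filling} (hT : IsTableau T) {I : List ℕ} (hI : ∀ x ∈ I, 0 < x)
    (h : ∀ k, (rowsOf T k).length = I.getD k 0) : shape T = I := by
  have hlen : T.length = I.length := by
    apply le_antisymm
    · by_contra hlt
      push Not at hlt
      have := h I.length
      rw [List.getD_eq_default _ _ le_rfl, rowsOf, List.getD_eq_getElem _ _ hlt] at this
      exact hT.ne_nil _ (List.getElem_mem hlt) (List.eq_nil_of_length_eq_zero this)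
    · by_contra hlt
      push Not at hlt
      have := h T.length
      rw [rowsOf_of_length_le le_rfl, List.getD_eq_getElem _ _ hlt] at this
      have := hI _ (List.getElem_mem hlt)
      simp at *
      omega
  refine List.ext_getElem (by simpa [shape] using hlen) fun k h1 h2 => ?_
  have := h k
  rw [← shape_getD, List.getD_eq_getElem _ _ h1, List.getD_eq_getElem _ _ h2] at this
  exact this

/-- The alternating indicator is antisymmetric, so the arrays that are not tableaux cancel. There is
only one tableau in the class `V`, and its row lengths decrease, so the indicator just compares its
shape with `I`. -/
theorem sum_indZ_arrays {I : List ℕ} (hI : I.SortedGE) (hpos : ∀ x ∈ I, 0 < x) (V : Plactic) :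
    ∑ z ∈ (finite_arrays I.length V).toFinset,
      indZ I.length (fun i => (I.getD i 0 : ℕ)) (fun i => ((z i).length : ℤ)) =
    if shape (tab V) = I then 1 else 0 := by
  classical
  set N := I.length with hN
  -- The good arrays with product `V` are none or one: the tableau of `V`, if it has at most `N`
  -- rows.
  have hgood : ∀ z, z ∈ (if (tab V).length ≤ N then {rowsOf (tab V)} else ∅ :
      Finset (ℕ → List ℤ)) ↔ z ∈ (finite_arrays N V).toFinset ∧
      ∀ k ∈ Finset.range (N - 1), Below (z k) ((z (k + 1)).drop 0) := by
    intro z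
    rw [Set.Finite.mem_toFinset]
    trans z = rowsOf (tab V) ∧ (tab V).length ≤ N
    · split_ifs with h <;> simp [h]
    constructor
    · rintro ⟨rfl, hlen⟩
      have := (isTableau_tab V).isTabFun
      exact ⟨⟨this.1, fun k hk => rowsOf_of_length_le (hlen.trans hk), by
        rw [rowsProd_rowsOf hlen, cl_tab]⟩, fun k _ => this.2 k⟩
    · rintro ⟨⟨h1, h2, h3⟩, h4⟩
      have htf : IsTabFun z := by
        refine ⟨h1, fun k => ?_⟩
        by_cases hk : k + 1 < N
        · exact h4 k (by rw [Finset.mem_range]; omega)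
        · rw [h2 (k + 1) (by omega)]; exact below_nil _
      obtain ⟨T, k1, k2, rfl⟩ := exists_tableau htf h2
      rw [rowsProd_rowsOf k2] at h3
      rw [← h3, tab_cl k1]
      exact ⟨rfl, k2⟩
  have hF := sum_arrays_eq_sum_good (M := ℤ) (fun a ha => by omega) (Finset.range (N - 1))
    (fun _ => 0) (fun _ => 0) (by simp) (indZ N (fun i => (I.getD i 0 : ℕ)))
    (fun k hk α => indZ_reflect (by rw [Finset.mem_range] at hk; omega) _ α)
    (finite_arrays N V).toFinset
    (fun z hz => by rw [Set.Finite.mem_toFinset] at hz; exact hz.1)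
    (by
      intro z hz k hk m w hfb
      rw [Set.Finite.mem_toFinset] at hz ⊢
      rw [Finset.mem_range] at hk
      refine ⟨swapAt_isRow hz.1 hfb, fun i hi => ?_, ?_⟩
      · rw [swapAt_of_ne (by omega) (by omega)]
        exact hz.2.1 i hi
      · rw [rowsProd_two_rows (k := k) (by omega) (fun i h1 h2 => swapAt_of_ne h1 h2)
          (swapAt_pl hz.1 hfb)]
        exact hz.2.2) hgood
  simp only [zero_add] at hF
  rw [hF]
  have hanti : ∀ i, i + 1 < N → ((I.getD (i + 1) 0 : ℕ) : ℤ) ≤ (I.getD i 0 : ℕ) := by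
    intro i hi
    rw [List.getD_eq_getElem _ _ hi, List.getD_eq_getElem _ _ (by omega : i < I.length)]
    exact_mod_cast hI.getElem_ge_getElem_of_le (by omega)
  have hval : (tab V).length ≤ N → indZ N (fun i => (I.getD i 0 : ℕ))
      (fun i => ((rowsOf (tab V) i).length : ℤ)) = if shape (tab V) = I then 1 else 0 := by
    intro hlen
    rw [indZ_of_antitone hanti
      (fun i _ => by exact_mod_cast length_antitone (isTableau_tab V).isTabFun i)]
    congr 1
    rw [eq_iff_iff]
    constructor
    · intro h
      refine shape_eq_of_length (isTableau_tab V) hpos fun k => ?_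
      by_cases hk : k < N
      · exact_mod_cast h k hk
      · rw [rowsOf_of_length_le (by omega), List.getD_eq_default _ _ (by omega)]
        rfl
    · intro h i hi
      rw [← shape_getD, h]
  split_ifs with hlen h h
  · rw [Finset.sum_singleton, hval hlen, if_pos h]
  · rw [Finset.sum_singleton, hval hlen, if_neg h]
  · exact absurd (by rw [hN, ← h]; simp [shape]) hlen
  · rfl

open scoped Classical in
-- In the plactic algebra `s_I` becomes the sum of all tableaux of shape `I` over the alphabet.
-- Expanding the determinant, the coefficient of `V` in a product of `h`'s counts arrays with
-- product `V` and given row lengths; the signed count is `sum_indZ_arrays`.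
theorem coeff_map_schur {A : Finset ℤ} {Φ : SymFun →+* MonoidAlgebra ℤ Plactic}
    (hΦ : ∀ k, Φ (hSym k) = plH A k) {I : List ℕ} (hI : I.SortedGE) (hpos : ∀ x ∈ I, 0 < x)
    (V : Plactic) :
    (Φ (schur I)).coeff V = if (∀ x, IsLetter x V → x ∈ A) ∧ shape (tab V) = I then 1 else 0 := by
  classical
  set N := I.length with hN
  have hcoe : ∀ s : Finset (ℕ → List ℤ),
      (∑ z ∈ s, MonoidAlgebra.single (rowsProd N z) (1 : ℤ)).coeff V =
        ((s.filter fun z => rowsProd N z = V).card : ℤ) := by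
    intro s
    rw [Finset.card_filter]
    push_cast
    rw [MonoidAlgebra.coeff_sum, Finsupp.finsetSum_apply]
    refine Finset.sum_congr rfl fun z _ => ?_
    rw [MonoidAlgebra.coeff_single, Finsupp.single_apply]
  have hexp : Φ (schur I) = ∑ p : Equiv.Perm (Fin N), ((Equiv.Perm.sign p : ℤˣ) : ℤ) •
      plHProd A N (fun k => if h : k < N then (I.getD (p ⟨k, h⟩) 0 : ℕ) + (k : ℤ) -
        ((p ⟨k, h⟩ : Fin N) : ℕ) else 0) := by
    rw [schur_eq_schurZ le_rfl, schurZ, Matrix.det_apply, map_sum]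
    refine Finset.sum_congr rfl fun p _ => ?_
    rw [Units.smul_def, map_zsmul, ← map_prod_hSym hΦ]
    congr 2
    refine Finset.prod_congr rfl fun i _ => ?_
    rw [Matrix.of_apply, dif_pos i.2]
  rw [hexp, MonoidAlgebra.coeff_sum, Finsupp.finsetSum_apply]
  have hterm : ∀ p : Equiv.Perm (Fin N), (((Equiv.Perm.sign p : ℤˣ) : ℤ) •
      plHProd A N (fun k => if h : k < N then (I.getD (p ⟨k, h⟩) 0 : ℕ) + (k : ℤ) -
        ((p ⟨k, h⟩ : Fin N) : ℕ) else 0) : MonoidAlgebra ℤ Plactic).coeff V =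
      if (∀ x, IsLetter x V → x ∈ A) then ∑ z ∈ (finite_arrays N V).toFinset,
        ((Equiv.Perm.sign p : ℤˣ) : ℤ) • ∏ j : Fin N,
        (if ((z j).length : ℤ) - (j : ℕ) = (I.getD (p j) 0 : ℕ) - ((p j : Fin N) : ℕ)
          then (1 : ℤ) else 0) else 0 := by
    intro p
    obtain ⟨s, hs, hsum⟩ := exists_plHProd A N (fun k => if h : k < N then
      (I.getD (p ⟨k, h⟩) 0 : ℕ) + (k : ℤ) - ((p ⟨k, h⟩ : Fin N) : ℕ) else 0)
    rw [hsum]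
    have hms : ∀ z, z ∈ s ↔ z ∈ arraySet A N (fun k => if h : k < N then
      (I.getD (p ⟨k, h⟩) 0 : ℕ) + (k : ℤ) - ((p ⟨k, h⟩ : Fin N) : ℕ) else 0) := by
      intro z; rw [← hs]; rfl
    rw [MonoidAlgebra.coeff_smul, Finsupp.smul_apply, hcoe]
    split_ifs with hA
    · rw [← Finset.smul_sum]
      congr 1
      rw [Finset.card_eq_sum_ones, Nat.cast_sum]
      simp only [Finset.prod_ite_zero, Finset.prod_const_one]
      rw [← Finset.sum_filter]
      simp only [Nat.cast_one]
      refine Finset.sum_congr ?_ fun _ _ => rfl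
      ext z
      rw [Finset.mem_filter, Finset.mem_filter, hms, Set.Finite.mem_toFinset]
      constructor
      · rintro ⟨⟨h1, h2⟩, h3⟩
        refine ⟨⟨fun k => ?_, h1, h3⟩, fun i _ => ?_⟩
        · by_cases hk : k < N
          · exact (mem_rowSet.1 (h2 k hk)).1
          · rw [h1 k (by omega)]; exact isRow_nil
        · have := (mem_rowSet.1 (h2 i i.2)).2.1
          beta_reduce at this
          rw [dif_pos i.2] at this
          rw [this]; ring
      · rintro ⟨⟨h1, h2, h3⟩, h4⟩
        refine ⟨⟨h2, fun k hk => mem_rowSet.2 ⟨h1 k, ?_, fun x hx => hA x ?_⟩⟩, h3⟩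
        · beta_reduce
          rw [dif_pos hk]
          have := h4 ⟨k, hk⟩ (Finset.mem_univ _)
          simp only at this
          linarith
        · rw [← h3, isLetter_rowsProd]
          exact ⟨k, hk, hx⟩
    · rw [Finset.card_eq_zero.2, Nat.cast_zero, smul_zero]
      rw [Finset.filter_eq_empty_iff]
      intro z hz h3
      apply hA
      intro x hx
      rw [← h3, isLetter_rowsProd] at hx
      obtain ⟨k, hk, hx⟩ := hx
      exact (mem_rowSet.1 (((hms z).1 hz).2 k hk)).2.2 x hx
  rw [Finset.sum_congr rfl fun p _ => hterm p]
  by_cases hA : ∀ x, IsLetter x V → x ∈ A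
  · rw [Finset.sum_congr rfl fun p _ => if_pos hA]
    simp only [show ((∀ x, IsLetter x V → x ∈ A) ∧ shape (tab V) = I) ↔ shape (tab V) = I from
      and_iff_right hA]
    rw [← sum_indZ_arrays hI hpos V, Finset.sum_comm]
    refine Finset.sum_congr rfl fun z _ => ?_
    rw [indZ, Matrix.det_apply]
    rfl
  · rw [if_neg (fun h => hA h.1)]
    exact Finset.sum_eq_zero fun p _ => if_neg hA

/-! ### The Littlewood-Richardson rule -/

theorem finite_factorizations (V : Plactic) : {p : Plactic × Plactic | p.1 * p.2 = V}.Finite := by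
  obtain ⟨w, rfl⟩ := pl_surjective V
  have hL := finite_lists {x | x ∈ w} (List.finite_toSet w) w.length
  refine ((hL.prod hL).image fun p => (pl p.1, pl p.2)).subset ?_
  rintro ⟨P, Q⟩ h
  obtain ⟨u, rfl⟩ := pl_surjective P
  obtain ⟨v, rfl⟩ := pl_surjective Q
  have hp := perm_of_pl_eq ((pl_append u v).trans h)
  have hlen := hp.length_eq
  rw [List.length_append] at hlen
  refine ⟨(u, v), ⟨⟨?_, fun x hx => ?_⟩, ?_, fun x hx => ?_⟩, rfl⟩
  · show u.length ≤ _; omega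
  · exact hp.subset (List.mem_append_left _ hx)
  · show v.length ≤ _; omega
  · exact hp.subset (List.mem_append_right _ hx)

/-- The pairs `(P, Q)` with `P * Q = V`. -/
noncomputable def factorizations (V : Plactic) : Finset (Plactic × Plactic) :=
  (finite_factorizations V).toFinset

theorem mem_factorizations {V : Plactic} {p : Plactic × Plactic} :
    p ∈ factorizations V ↔ p.1 * p.2 = V := by simp [factorizations]

theorem shape_sortedGE {T : Filling} (hT : IsTableau T) : (shape T).SortedGE := by
  rw [List.sortedGE_iff_getElem_ge_getElem_of_le]
  have hanti : Antitone fun k => (rowsOf T k).length :=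
    antitone_nat_of_succ_le fun i => length_antitone hT.isTabFun i
  intro i j h1 h2 h
  have := hanti h
  simp only [← shape_getD] at this
  rwa [List.getD_eq_getElem _ _ h1, List.getD_eq_getElem _ _ h2] at this

theorem shape_pos {T : Filling} (hT : IsTableau T) : ∀ x ∈ shape T, 0 < x := by
  intro x hx
  obtain ⟨s, hs, rfl⟩ := List.mem_map.1 hx
  exact List.length_pos_iff.2 (hT.ne_nil s hs)

/-- The shape of the tableau in a plactic class, as a Young diagram. -/
noncomputable def ydiag (V : Plactic) : YoungDiagram :=
  YoungDiagram.ofRowLens (shape (tab V)) (shape_sortedGE (isTableau_tab V))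

theorem rowLens_ydiag (V : Plactic) : (ydiag V).rowLens = shape (tab V) :=
  YoungDiagram.rowLens_ofRowLens_eq_self (shape_pos (isTableau_tab V))

theorem ydiag_eq_iff {V : Plactic} {μ : YoungDiagram} :
    ydiag V = μ ↔ shape (tab V) = μ.rowLens := by
  rw [← rowLens_ydiag]
  refine ⟨fun h => h ▸ rfl, fun h => YoungDiagram.equivListRowLens.injective (Subtype.ext h)⟩

open scoped Classical in
theorem coeff_map_schur_diagram {A : Finset ℤ} {Φ : SymFun →+* MonoidAlgebra ℤ Plactic}
    (hΦ : ∀ k, Φ (hSym k) = plH A k) (μ : YoungDiagram) {V : Plactic}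
    (hV : ∀ x, IsLetter x V → x ∈ A) :
    (Φ (schur μ.rowLens)).coeff V = if ydiag V = μ then 1 else 0 := by
  rw [coeff_map_schur hΦ μ.rowLens_sorted (fun x hx => μ.pos_of_mem_rowLens x hx)]
  simp only [and_iff_right hV, ydiag_eq_iff]

theorem schurBasis_apply (μ : YoungDiagram) : schurBasis μ = schur μ.rowLens :=
  Module.Basis.mk_apply _ _ _

open scoped Classical in
-- The coefficient of `V` in the image of `s_σ s_τ` is computed twice: by expansion in Schur
-- functions, where only that of the shape of `V` contributes, and as a product in the plactic
-- algebra, where it counts factorizations. The alphabet is the set of letters of `V`.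
theorem lrCoeff_ydiag (V : Plactic) (σ τ : YoungDiagram) :
    lrCoeff (ydiag V) σ τ =
      ((factorizations V).filter fun p => ydiag p.1 = σ ∧ ydiag p.2 = τ).card := by
  obtain ⟨v, hv⟩ := pl_surjective V
  have hA : ∀ x, IsLetter x V → x ∈ v.toFinset := by
    intro x hx
    rw [← hv, isLetter_pl] at hx
    simpa using hx
  obtain ⟨Φ, hΦ⟩ := exists_plactic_hom v.toFinset
  have hexp := congrArg (fun f => (Φ f).coeff V)
    (schurBasis.linearCombination_repr (schur σ.rowLens * schur τ.rowLens))
  beta_reduce at hexp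
  rw [Finsupp.linearCombination_apply, Finsupp.sum, map_sum, MonoidAlgebra.coeff_sum,
    Finsupp.finsetSum_apply, map_mul Φ] at hexp
  have hl : ∀ μ, (Φ (schurBasis.repr (schur σ.rowLens * schur τ.rowLens) μ • schurBasis μ)).coeff V
      = if μ = ydiag V then lrCoeff μ σ τ else 0 := by
    intro μ
    rw [map_zsmul, MonoidAlgebra.coeff_smul, Finsupp.smul_apply, schurBasis_apply,
      coeff_map_schur_diagram hΦ μ hA, lrCoeff]
    by_cases h : μ = ydiag V
    · simp [h]
    · simp [h, Ne.symm h]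
  rw [Finset.sum_congr rfl fun μ _ => hl μ, Finset.sum_ite_eq',
    MonoidAlgebra.coeff_mul_antidiag _ _ _ (factorizations V) mem_factorizations] at hexp
  have hlet : ∀ p ∈ factorizations V, (Φ (schur σ.rowLens)).coeff p.1 *
      (Φ (schur τ.rowLens)).coeff p.2 = if ydiag p.1 = σ ∧ ydiag p.2 = τ then 1 else 0 := by
    intro p hp
    rw [mem_factorizations] at hp
    rw [coeff_map_schur_diagram hΦ σ (fun x hx => hA x (by rw [← hp, isLetter_mul]; exact Or.inl hx)),
      coeff_map_schur_diagram hΦ τ (fun x hx => hA x (by rw [← hp, isLetter_mul]; exact Or.inr hx)),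
      ite_zero_mul_ite_zero, mul_one]
  rw [Finset.sum_congr rfl hlet, ← Finset.sum_filter, Finset.sum_const, nsmul_one] at hexp
  rw [← hexp]
  split_ifs with h
  · rfl
  · rw [lrCoeff]
    exact Finsupp.notMem_support_iff.1 h

/-! ### Small and large letters -/

/-- The restriction of a plactic class to the letters `≤ t`. -/
noncomputable def sm (t : ℤ) : Plactic →* Plactic := (exists_small_hom t).choose

/-- The restriction of a plactic class to the letters `> t`. -/
noncomputable def lg (t : ℤ) : Plactic →* Plactic := (exists_large_hom t).choose

theorem sm_pl (t : ℤ) (w : List ℤ) : sm t (pl w) = pl (w.filter (· ≤ t)) :=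
  (exists_small_hom t).choose_spec w

theorem lg_pl (t : ℤ) (w : List ℤ) : lg t (pl w) = pl (w.filter (t < ·)) :=
  (exists_large_hom t).choose_spec w

theorem sm_eq_self {t : ℤ} {V : Plactic} (h : ∀ x, IsLetter x V → x ≤ t) : sm t V = V := by
  obtain ⟨w, rfl⟩ := pl_surjective V
  rw [sm_pl, List.filter_eq_self.2 fun x hx => by simpa using h x (isLetter_pl.2 hx)]

theorem sm_eq_one {t : ℤ} {V : Plactic} (h : ∀ x, IsLetter x V → t < x) : sm t V = 1 := by
  obtain ⟨w, rfl⟩ := pl_surjective V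
  rw [sm_pl, List.filter_eq_nil_iff.2 fun x hx => by simpa using h x (isLetter_pl.2 hx), pl_nil]

theorem lg_eq_self {t : ℤ} {V : Plactic} (h : ∀ x, IsLetter x V → t < x) : lg t V = V := by
  obtain ⟨w, rfl⟩ := pl_surjective V
  rw [lg_pl, List.filter_eq_self.2 fun x hx => by simpa using h x (isLetter_pl.2 hx)]

theorem lg_eq_one {t : ℤ} {V : Plactic} (h : ∀ x, IsLetter x V → x ≤ t) : lg t V = 1 := by
  obtain ⟨w, rfl⟩ := pl_surjective V
  rw [lg_pl, List.filter_eq_nil_iff.2 fun x hx => by simpa using h x (isLetter_pl.2 hx), pl_nil]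

theorem sm_rowsProd (t : ℤ) (N : ℕ) (z : ℕ → List ℤ) :
    sm t (rowsProd N z) = rowsProd N fun k => (z k).filter (· ≤ t) := by
  induction N generalizing z with
  | zero => exact map_one _
  | succ N ih => rw [rowsProd, map_mul, ih, sm_pl]; rfl

theorem lg_rowsProd (t : ℤ) (N : ℕ) (z : ℕ → List ℤ) :
    lg t (rowsProd N z) = rowsProd N fun k => (z k).filter (t < ·) := by
  induction N generalizing z with
  | zero => exact map_one _
  | succ N ih => rw [rowsProd, map_mul, ih, lg_pl]; rfl

theorem IsRow.filter_append {s : List ℤ} (hs : IsRow s) (t : ℤ) :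
    s.filter (· ≤ t) ++ s.filter (t < ·) = s := by
  induction s with
  | nil => rfl
  | cons a s ih =>
    rw [isRow_cons] at hs
    by_cases h : a ≤ t
    · rw [List.filter_cons_of_pos (by simpa using h), List.filter_cons_of_neg (by simpa using h),
        List.cons_append, ih hs.2]
    · have h1 : s.filter (· ≤ t) = [] := by
        rw [List.filter_eq_nil_iff]
        intro x hx
        have := hs.1 x hx
        simp; omega
      have h2 := ih hs.2
      rw [h1, List.nil_append] at h2
      rw [List.filter_cons_of_neg (by simpa using h), List.filter_cons_of_pos (by simpa using h),
        h1, h2, List.nil_append]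

theorem Below.filter {s u : List ℤ} (hs : IsRow s) (hu : IsRow u) (h : Below s u) (t : ℤ) :
    Below (s.filter (· ≤ t)) (u.filter (· ≤ t)) := by
  induction u generalizing s with
  | nil => simp
  | cons b u ih =>
    cases s with
    | nil => simp at h
    | cons a s =>
      rw [isRow_cons] at hs hu
      rw [below_cons_cons] at h
      by_cases hb : b ≤ t
      · rw [List.filter_cons_of_pos (by simp; omega),
          List.filter_cons_of_pos (by simpa using hb), below_cons_cons]
        exact ⟨h.1, ih hs.2 hu.2 h.2⟩
      · have : (b :: u).filter (· ≤ t) = [] := by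
          rw [List.filter_eq_nil_iff]
          intro x hx
          rcases List.mem_cons.1 hx with rfl | hx
          · simpa using hb
          · have := hu.1 x hx
            simp; omega
        rw [this]
        exact below_nil _

theorem IsTabFun.filter {z : ℕ → List ℤ} (hz : IsTabFun z) (t : ℤ) :
    IsTabFun fun k => (z k).filter (· ≤ t) :=
  ⟨fun k => (hz.1 k).sublist List.filter_sublist,
    fun k => (hz.2 k).filter (hz.1 k) (hz.1 (k + 1)) t⟩

/-! ### Rows and columns of products -/

theorem length_foldl_row_le {x : List ℤ} (hx : IsRow x) {T : Filling} (hT : ∀ s ∈ T, IsRow s) :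
    (x.foldl rowInsert T).length ≤ T.length + 1 := by
  induction T generalizing x with
  | nil =>
    cases x with
    | nil => simp
    | cons a x =>
      rw [List.foldl_cons]
      show (x.foldl rowInsert ([a] :: [])).length ≤ _
      rw [foldl_rowInsert_cons, rowRun_cons_of_forall_le (isRow_cons.1 hx).1,
        rowRun_nil_left (isRow_cons.1 hx).2]
      simp
  | cons s T ih =>
    rw [foldl_rowInsert_cons]
    have := ih (rowRun_pair (hT s (by simp)) hx).1 fun u hu => hT u (by simp [hu])
    simpa using this

theorem length_tab_mul_row_le {x : List ℤ} (hx : IsRow x) (U : Plactic) :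
    (tab (U * pl x)).length ≤ (tab U).length + 1 := by
  obtain ⟨u, rfl⟩ := pl_surjective U
  rw [← pl_append, tab_pl, tab_pl, List.foldl_append]
  exact length_foldl_row_le hx (isTableau_nil.foldl u).isRow

theorem length_tab_rowsProd_le {N : ℕ} {z : ℕ → List ℤ} (hz : ∀ k < N, IsRow (z k)) :
    (tab (rowsProd N z)).length ≤ N := by
  induction N generalizing z with
  | zero =>
    have : tab (1 : Plactic) = [] := tab_cl isTableau_nil
    rw [rowsProd, this]; simp
  | succ N ih =>
    exact (length_tab_mul_row_le (hz 0 (by omega)) _).trans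
      (Nat.succ_le_succ (ih fun k hk => hz _ (by omega)))

theorem rowsProd_tab {V : Plactic} {N : ℕ} (h : (tab V).length ≤ N) :
    rowsProd N (rowsOf (tab V)) = V := by rw [rowsProd_rowsOf h, cl_tab]

theorem WidthLE.length_le {V A : Plactic} {c : ℕ} (h : WidthLE V c) {y : List ℤ} (hy : IsRow y)
    (hA : A * pl y = V) : y.length ≤ c := by
  subst hA
  exact h.mul_right y rfl y (List.Sublist.refl y) hy

theorem WidthLE.mono {V : Plactic} {c c' : ℕ} (h : WidthLE V c) (hc : c ≤ c') : WidthLE V c' :=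
  fun w hw s hs hr => (h w hw s hs hr).trans hc

/-- The letters of `M` are smaller and come later, so a weakly increasing subword lies in one of the
factors. -/
theorem widthLE_mul {Y M : Plactic} {c : ℕ} (hY : WidthLE Y c) (hM : WidthLE M c)
    (h : ∀ x, IsLetter x M → ∀ y, IsLetter y Y → x < y) : WidthLE (Y * M) c := by
  obtain ⟨u, rfl⟩ := pl_surjective Y
  obtain ⟨v, rfl⟩ := pl_surjective M
  rw [← pl_append]
  apply widthLE_of_forall
  intro s hs hr
  obtain ⟨s1, s2, rfl, h1, h2⟩ := List.sublist_append_iff.1 hs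
  rw [isRow_append] at hr
  rcases s1 with _ | ⟨a, s1⟩
  · exact hM v rfl _ h2 hr.2.1
  rcases s2 with _ | ⟨b, s2⟩
  · rw [List.append_nil]
    exact hY u rfl _ h1 hr.1
  have := hr.2.2 a (by simp) b (by simp)
  have := h b (isLetter_pl.2 (h2.subset (by simp))) a (isLetter_pl.2 (h1.subset (by simp)))
  omega

theorem IsRect.isTabFun {p c : ℕ} {m : ℕ → List ℤ} (h : IsRect p c m) :
    IsTabFun fun k => if k < p then m k else [] := by
  refine ⟨fun k => ?_, fun k => ?_⟩
  · beta_reduce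
    split_ifs with hk
    · exact h.isRow k hk
    · exact isRow_nil
  · beta_reduce
    by_cases hk : k + 1 < p
    · rw [if_pos hk, if_pos (by omega)]; exact h.below k hk
    · rw [if_neg hk]; exact below_nil _

theorem rowsProd_ite (p : ℕ) (m : ℕ → List ℤ) :
    (rowsProd p fun k => if k < p then m k else []) = rowsProd p m :=
  rowsProd_congr fun _ hk => if_pos hk

theorem IsTabFun.length_le {z : ℕ → List ℤ} (hz : IsTabFun z) (k : ℕ) :
    (z k).length ≤ (z 0).length := by
  induction k with
  | zero => exact le_rfl
  | succ k ih => exact (length_antitone hz k).trans ih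

theorem widthLE_rowsProd {z : ℕ → List ℤ} (hz : IsTabFun z) {N : ℕ} (hN : ∀ k, N ≤ k → z k = [])
    {c : ℕ} : WidthLE (rowsProd N z) c ↔ (z 0).length ≤ c := by
  obtain ⟨T, hT, hl, rfl⟩ := exists_tableau hz hN
  rw [rowsProd_rowsOf hl, widthLE_cl hT, rowsOf_zero]

theorem IsRect.widthLE {p c : ℕ} {m : ℕ → List ℤ} (h : IsRect p c m) :
    WidthLE (rowsProd p m) c := by
  rw [← rowsProd_ite, widthLE_rowsProd h.isTabFun fun k hk => if_neg (by omega)]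
  split_ifs with hp
  · exact (h.length 0 hp).le
  · simp

theorem IsRect.length_tab_mul_le {p c : ℕ} {m : ℕ → List ℤ} (h : IsRect p c m) {X : Plactic}
    (hX : (tab X).length ≤ p) (hmX : ∀ k < p, ∀ x ∈ m k, ∀ y, IsLetter y X → x ≤ y) :
    (tab (rowsProd p m * X)).length ≤ p := by
  have hz := (isTableau_tab X).isTabFun
  have hmz : ∀ k < p, ∀ l < p, ∀ x ∈ m k, ∀ y ∈ rowsOf (tab X) l, x ≤ y := by
    intro k hk l hl x hx y hy
    refine hmX k hk x hx y ?_
    rw [← rowsProd_tab hX, isLetter_rowsProd]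
    exact ⟨l, hl, hy⟩
  rw [← rowsProd_tab hX, ← h.rowsProd_append (fun k _ => hz.1 k) hmz]
  refine length_tab_rowsProd_le fun k hk => ?_
  rw [isRow_append]
  exact ⟨h.isRow k hk, hz.1 k, hmz k hk k hk⟩

/-! ### Recognizing products with a rectangle -/

theorem IsRect.filter_eq {t : ℤ} {p c : ℕ} {m : ℕ → List ℤ} (h : IsRect p c m) {z : ℕ → List ℤ}
    (hz : IsTabFun z) {N : ℕ} (hp : p ≤ N) (hN : ∀ k, N ≤ k → z k = [])
    (hZ : sm t (rowsProd N z) = rowsProd p m) :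
    (fun k => (z k).filter (· ≤ t)) = fun k => if k < p then m k else [] := by
  refine isTabFun_unique (hz.filter t) h.isTabFun (N := N) (fun k hk => by simp [hN k hk])
    (fun k hk => if_neg (by omega)) ?_
  rw [← sm_rowsProd, hZ, ← rowsProd_ite]
  obtain ⟨K, rfl⟩ := Nat.exists_eq_add_of_le hp
  rw [rowsProd_add, show (fun k => if p + k < p then m (p + k) else []) = fun _ => [] from
    funext fun k => if_neg (by omega), rowsProd_nil, one_mul]

/-- The small letters of the tableau fill the rectangle. With no rows beneath it, all large letters
stand to its right, and rows attached on the right factor off by `IsRect.rowsProd_append`. -/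
theorem IsRect.eq_mul_lg {t : ℤ} {p c : ℕ} {m : ℕ → List ℤ} (h : IsRect p c m) {Z : Plactic}
    (hZ : sm t Z = rowsProd p m) (hl : (tab Z).length ≤ p) :
    Z = rowsProd p m * lg t Z := by
  have hz := (isTableau_tab Z).isTabFun
  have hf := h.filter_eq (t := t) hz le_rfl (fun k hk => rowsOf_of_length_le (hl.trans hk))
    (by rw [rowsProd_tab hl, hZ])
  have hf' : ∀ k < p, (rowsOf (tab Z) k).filter (· ≤ t) = m k := fun k hk => by
    simpa [hk] using congrFun hf k
  conv_rhs => rw [← rowsProd_tab hl, lg_rowsProd]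
  rw [← h.rowsProd_append (fun k _ => (hz.1 k).sublist List.filter_sublist)]
  · conv_lhs => rw [← rowsProd_tab hl]
    refine rowsProd_congr fun k hk => ?_
    rw [← hf' k hk, (hz.1 k).filter_append]
  · intro k hk l hl x hx y hy
    rw [← hf' k hk] at hx
    simp only [List.mem_filter, decide_eq_true_eq] at hx hy
    omega

/-- Dually, with no columns beyond the rectangle all large letters stand beneath it, and the lower
rows are the left factor of the reading word. -/
theorem IsRect.eq_lg_mul {t : ℤ} {p c : ℕ} {m : ℕ → List ℤ} (h : IsRect p c m) {Z : Plactic}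
    (hZ : sm t Z = rowsProd p m) (hw : WidthLE Z c) : Z = lg t Z * rowsProd p m := by
  have hz := (isTableau_tab Z).isTabFun
  set K := (tab Z).length
  have hl : (tab Z).length ≤ p + K := by omega
  have hN : ∀ k, p + K ≤ k → rowsOf (tab Z) k = [] := fun k hk =>
    rowsOf_of_length_le (hl.trans hk)
  have hf := h.filter_eq (t := t) hz (by omega) hN (by rw [rowsProd_tab hl, hZ])
  have hf1 : ∀ k < p, (rowsOf (tab Z) k).filter (· ≤ t) = m k := fun k hk => by
    simpa [hk] using congrFun hf k
  have hf2 : ∀ k, p ≤ k → (rowsOf (tab Z) k).filter (· ≤ t) = [] := fun k hk => by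
    simpa [not_lt.2 hk] using congrFun hf k
  rw [← rowsProd_tab hl, widthLE_rowsProd hz hN] at hw
  have hrow : ∀ k < p, rowsOf (tab Z) k = m k := by
    intro k hk
    rw [← hf1 k hk]
    refine (List.Sublist.eq_of_length_le List.filter_sublist ?_).symm
    rw [hf1 k hk, h.length k hk]
    exact (hz.length_le k).trans hw
  have hm : ∀ x, IsLetter x (rowsProd p m) → x ≤ t := by
    intro x hx
    obtain ⟨k, hk, hx⟩ := isLetter_rowsProd.1 hx
    rw [← hf1 k hk] at hx
    simpa using (List.mem_filter.1 hx).2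
  have hZ2 : Z = rowsProd K (fun k => rowsOf (tab Z) (p + k)) * rowsProd p m := by
    conv_lhs => rw [← rowsProd_tab hl, rowsProd_add]
    rw [rowsProd_congr hrow]
  have hlg : lg t Z = rowsProd K (fun k => rowsOf (tab Z) (p + k)) := by
    conv_lhs => rw [hZ2]
    rw [map_mul, lg_eq_one hm, mul_one, lg_eq_self]
    intro x hx
    obtain ⟨k, hk, hx⟩ := isLetter_rowsProd.1 hx
    by_contra hlt
    have : x ∈ (rowsOf (tab Z) (p + k)).filter (· ≤ t) :=
      List.mem_filter.2 ⟨hx, by simpa using hlt⟩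
    rw [hf2 _ (by omega)] at this
    simp at this
  rw [hlg]
  exact hZ2

/-! ### Exchanging letters between neighboring factors -/

theorem IsRow.lt_of_mem_drop {y : List ℤ} (hy : IsRow y) {t : ℤ} {b : ℕ}
    (h : (y.filter (· ≤ t)).length ≤ b) {v : ℤ} (hv : v ∈ y.drop b) : t < v := by
  rw [← hy.filter_append t, List.drop_append, List.drop_eq_nil_of_le h, List.nil_append] at hv
  simpa using (List.mem_filter.1 (List.mem_of_mem_drop hv)).2

theorem exists_forall₂_filter {x e : List ℤ} (h : List.Forall₂ (· < ·) x e) (p : ℤ → Bool) :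
    ∃ s, s.Sublist e ∧ List.Forall₂ (· < ·) (x.filter p) s := by
  induction h with
  | nil => exact ⟨[], List.Sublist.refl _, List.Forall₂.nil⟩
  | @cons a b x e hab _ ih =>
    obtain ⟨s, h1, h2⟩ := ih
    by_cases hp : p a
    · exact ⟨b :: s, h1.cons_cons b, by rw [List.filter_cons_of_pos hp]; exact h2.cons hab⟩
    · exact ⟨s, h1.cons b, by rwa [List.filter_cons_of_neg hp]⟩

/-- `m1`, `m2` are neighboring rectangles of the second row and `S` is the class between them, with
letters above `t`. The swap between the row `y₀ ++ yp`, at the right end of one factor, and the row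
`xm ++ xp`, at the left end of the next, involves only letters of `S`. Restricted to these letters
it leaves the product `X * Y` unchanged. It remains to recognize the two new factors as products
with the rectangles, through a bound on rows for the first and on width for the second. -/
theorem exchange_letters {t : ℤ} {p1 c1 p2 c2 b : ℕ} {m1 m2 : ℕ → List ℤ} (h1 : IsRect p1 c1 m1)
    (h2 : IsRect p2 c2 m2) (hs1 : ∀ x, IsLetter x (rowsProd p1 m1) → x ≤ t)
    (hs2 : ∀ x, IsLetter x (rowsProd p2 m2) → x ≤ t) {S X Y A D : Plactic}
    (hSl : ∀ x, IsLetter x S → t < x) (hSw : WidthLE S c2) (hSr : (tab S).length ≤ p1)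
    (hXY : X * Y = S) (hb : c1 ≤ b) {y₀ yp xm xp y' x' : List ℤ} {w : ℤ}
    (hA : A * pl (y₀ ++ yp) = rowsProd p1 m1 * X) (hD : pl (xm ++ xp) * D = Y * rowsProd p2 m2)
    (hy : IsRow (y₀ ++ yp)) (hx : IsRow (xm ++ xp)) (hy' : IsRow (y₀ ++ y'))
    (hm : List.Forall₂ (· < ·) xm ((y₀.drop b).take xm.length)) (hw₀ : ∀ a ∈ y₀, a ≤ w)
    (hwp : ∀ a ∈ yp, w ≤ a) (hwx : ∀ a ∈ xp, w ≤ a) (hw : w ∈ (y₀ ++ yp).drop b)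
    (hpl : pl yp * pl xp = pl y' * pl x') :
    ∃ X' Y', X' * Y' = S ∧ A * pl (y₀ ++ y') = rowsProd p1 m1 * X' ∧
      pl (xm ++ x') * D = Y' * rowsProd p2 m2 := by
  have hXl : ∀ x, IsLetter x X → t < x := fun x hx =>
    hSl x (by rw [← hXY, isLetter_mul]; exact Or.inl hx)
  have hYl : ∀ x, IsLetter x Y → t < x := fun x hx =>
    hSl x (by rw [← hXY, isLetter_mul]; exact Or.inr hx)
  have hsmA : sm t A * sm t (pl (y₀ ++ yp)) = rowsProd p1 m1 := by
    rw [← map_mul, hA, map_mul, sm_eq_self hs1, sm_eq_one hXl, mul_one]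
  -- The small letters form a rectangle with `c1` columns, so at most `c1 ≤ b` of them fit into one
  -- row. Beyond column `b` only large letters occur, among them `w`.
  have hlarge : ∀ v ∈ (y₀ ++ yp).drop b, t < v := by
    intro v hv
    refine hy.lt_of_mem_drop (le_trans ?_ hb) hv
    rw [sm_pl] at hsmA
    exact h1.widthLE.length_le (hy.sublist List.filter_sublist) hsmA
  have hwt := hlarge w hw
  have hperm : (yp ++ xp).Perm (y' ++ x') := perm_of_pl_eq (by rw [pl_append, pl_append, hpl])
  have hlex : ∀ a ∈ y' ++ x', w ≤ a := by
    intro a ha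
    rcases List.mem_append.1 (hperm.symm.subset ha) with h | h
    · exact hwp a h
    · exact hwx a h
  have filt : ∀ s : List ℤ, (∀ a ∈ s, w ≤ a) → s.filter (t < ·) = s ∧ s.filter (· ≤ t) = [] := by
    intro s hs
    refine ⟨List.filter_eq_self.2 fun a ha => ?_, List.filter_eq_nil_iff.2 fun a ha => ?_⟩
    · have := hs a ha
      simp; omega
    · have := hs a ha
      simp; omega
  have fyp := filt yp hwp
  have fxp := filt xp hwx
  have fy' := filt y' fun a ha => hlex a (by simp [ha])
  have fx' := filt x' fun a ha => hlex a (by simp [ha])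
  set e := (y₀.drop b).take xm.length
  have he0 : e.Sublist y₀ := (List.take_sublist _ _).trans (List.drop_sublist _ _)
  have hel : ∀ v ∈ e, t < v := by
    intro v hv
    apply hlarge
    rw [List.drop_append]
    exact List.mem_append_left _ (List.mem_of_mem_take hv)
  have heg : e.Sublist (y₀.filter (t < ·)) := by
    have := he0.filter (t < ·)
    rwa [List.filter_eq_self.2 fun v hv => by simpa using hel v hv] at this
  obtain ⟨s, hse, hs⟩ := exists_forall₂_filter hm (t < ·)
  -- The letters matched with `xm` lie beyond column `b` and are large, so the strict matching
  -- survives the deletion of small letters, and with it the commutation.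
  have comm : ∀ yq, IsRow (y₀ ++ yq) → yq.filter (t < ·) = yq →
      pl (y₀.filter (t < ·)) * pl yq * pl (xm.filter (t < ·)) =
        pl (y₀.filter (t < ·)) * pl (xm.filter (t < ·)) * pl yq := by
    intro yq hq hf
    refine pl_comm_of_forall₂ ?_ ?_ (hse.trans heg) hs
    · have := hq.sublist (List.filter_sublist (p := (t < ·)))
      rwa [List.filter_append, hf] at this
    · exact (isRow_append.1 hx).1.sublist List.filter_sublist
  have hXeq : X = lg t A * pl (y₀.filter (t < ·)) * pl yp := by
    have := congrArg (lg t) hA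
    rw [map_mul, map_mul, lg_eq_one hs1, one_mul, lg_eq_self hXl, lg_pl, List.filter_append,
      fyp.1, pl_append] at this
    rw [← this, mul_assoc]
  have hYeq : Y = pl (xm.filter (t < ·)) * pl xp * lg t D := by
    have := congrArg (lg t) hD
    rw [map_mul, map_mul, lg_eq_one hs2, mul_one, lg_eq_self hYl, lg_pl, List.filter_append,
      fxp.1, pl_append] at this
    exact this.symm
  have hS' : lg t A * pl (y₀.filter (t < ·)) * pl y' *
      (pl (xm.filter (t < ·)) * pl x' * lg t D) = S := by
    calc _ = lg t A * (pl (y₀.filter (t < ·)) * pl y' * pl (xm.filter (t < ·))) * pl x' * lg t D := by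
          simp only [mul_assoc]
      _ = lg t A * (pl (y₀.filter (t < ·)) * pl (xm.filter (t < ·))) * (pl y' * pl x') * lg t D := by
          rw [comm y' hy' fy'.1]; simp only [mul_assoc]
      _ = lg t A * (pl (y₀.filter (t < ·)) * pl yp * pl (xm.filter (t < ·))) * pl xp * lg t D := by
          rw [comm yp hy fyp.1, ← hpl]; simp only [mul_assoc]
      _ = X * Y := by rw [hXeq, hYeq]; simp only [mul_assoc]
      _ = S := hXY
  refine ⟨_, _, hS', ?_, ?_⟩
  -- The class `A * pl y₀` is a left factor of the old product, which has at most `p1` rows because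
  -- `X` is a left factor of `S`.
  · have hrows : (tab (A * pl y₀)).length ≤ p1 := by
      refine (length_tab_le_mul _ (pl yp)).trans ?_
      rw [mul_assoc, ← pl_append, hA]
      refine h1.length_tab_mul_le ((length_tab_le_mul X Y).trans (hXY ▸ hSr)) ?_
      intro k hk x hx z hz
      exact (hs1 x (isLetter_rowsProd.2 ⟨k, hk, hx⟩)).trans (hXl z hz).le
    have hsmZ : sm t (A * pl y₀) = rowsProd p1 m1 := by
      rw [← hsmA, map_mul, sm_pl, sm_pl, List.filter_append, fyp.2, List.append_nil]
    have := h1.eq_mul_lg hsmZ hrows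
    rw [pl_append, ← mul_assoc, this, map_mul, lg_pl]
    simp only [mul_assoc]
  · have hsmZ : sm t (pl (xm ++ x') * D) = rowsProd p2 m2 := by
      have := congrArg (sm t) hD
      rw [map_mul, map_mul, sm_eq_self hs2, sm_eq_one hYl, one_mul, sm_pl, List.filter_append,
        fxp.2, List.append_nil] at this
      rw [← this, map_mul, sm_pl, List.filter_append, fx'.2, List.append_nil]
    have hwidth : WidthLE (pl (xm ++ x') * D) c2 := by
      have hYM : WidthLE (Y * rowsProd p2 m2) c2 := by
        refine widthLE_mul ?_ h2.widthLE fun x hx z hz => (hs2 x hx).trans_lt (hYl z hz)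
        rw [← hXY] at hSw
        exact hSw.mul_right
      obtain ⟨δ, rfl⟩ := pl_surjective D
      obtain ⟨α, hα⟩ := pl_surjective (lg t A)
      rw [← pl_append]
      apply widthLE_of_forall
      intro u hu hr
      obtain ⟨u12, u3, rfl, hu12, hu3⟩ := List.sublist_append_iff.1 hu
      obtain ⟨u1, u2, rfl, hu1, hu2⟩ := List.sublist_append_iff.1 hu12
      -- A weakly increasing subword that avoids `x'` occurs in the old product. Otherwise its
      -- letters after those of `xm` are large.
      rcases u2 with _ | ⟨a, u2⟩
      · rw [List.append_nil] at hr ⊢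
        refine hYM (xm ++ xp ++ δ) (by rw [pl_append, hD]) _ ?_ hr
        exact (hu1.trans (List.sublist_append_left _ _)).append hu3
      · have hax : w ≤ a := hlex a (List.mem_append_right _ (hu2.subset (by simp)))
        rw [isRow_append] at hr
        have hu3l : ∀ v ∈ u3, t < v := fun v hv => by
          have := hr.2.2 a (by simp) v hv
          omega
        have hr2 := (isRow_append.1 hr.1).2.1
        have hle : ∀ v ∈ a :: u2, a ≤ v := by
          intro v hv
          rcases List.mem_cons.1 hv with rfl | hv
          · exact le_rfl
          · exact (isRow_cons.1 hr2).1 v hv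
        -- The part `u1` from `xm` is replaced by the partners `e` in `y₀`, which are at least as
        -- many, large, and at most `w`. This gives a weakly increasing subword of a word for `S`,
        -- whose width is at most `c2`.
        have hlen : u1.length ≤ e.length := by
          rw [← hm.length_eq]; exact hu1.length_le
        have key := hSw (α ++ y₀.filter (t < ·) ++ y' ++ (xm.filter (t < ·) ++ x' ++
          δ.filter (t < ·))) (by
            rw [pl_append, pl_append, pl_append, pl_append, pl_append, hα, ← lg_pl t δ, hS'])
          (e ++ (a :: u2 ++ u3)) ?_ ?_
        · simp only [List.length_append] at key ⊢
          omega
        · refine List.Sublist.append ?_ ?_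
          · rw [List.append_assoc]
            exact heg.trans ((List.sublist_append_left _ _).trans (List.sublist_append_right _ _))
          · refine List.Sublist.append (hu2.trans (List.sublist_append_right _ _)) ?_
            have := hu3.filter (t < ·)
            rwa [List.filter_eq_self.2 fun v hv => by simpa using hu3l v hv] at this
        · rw [isRow_append, isRow_append]
          refine ⟨(isRow_append.1 hy).1.sublist he0, ⟨hr2, hr.2.1, ?_⟩, ?_⟩
          · exact fun p hp q hq => hr.2.2 p (List.mem_append_right _ hp) q hq
          · intro p hp q hq
            have h3 := hw₀ p (he0.subset hp)
            rcases List.mem_append.1 hq with hq | hq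
            · have := hle q hq; omega
            · have := hr.2.2 a (by simp) q hq; omega
    have := h2.eq_lg_mul hsmZ hwidth
    rw [this, map_mul, lg_pl, List.filter_append, fx'.1, pl_append]

/-- The small letters occupy at most `p2 ≤ a` rows, so the rows to be moved contain only letters of
`S`. They can be split off from the left end of `Y` and appended to `X`. -/
theorem move_rows {t : ℤ} {p1 p2 c2 a K : ℕ} {m1 m2 : ℕ → List ℤ}
    (h2 : IsRect p2 c2 m2) (hs2 : ∀ x, IsLetter x (rowsProd p2 m2) → x ≤ t) {S X Y A D : Plactic}
    (hSl : ∀ x, IsLetter x S → t < x) (hSw : WidthLE S c2)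
    (hXY : X * Y = S) (ha : p2 ≤ a) {c : ℕ → List ℤ} (hc : IsTabFun c)
    (hA : A = rowsProd p1 m1 * X) (hD : rowsProd (a + K) c * D = Y * rowsProd p2 m2) :
    ∃ X' Y', X' * Y' = S ∧
      A * rowsProd K (fun k => c (a + k)) = rowsProd p1 m1 * X' ∧
      rowsProd a c * D = Y' * rowsProd p2 m2 := by
  have hYl : ∀ x, IsLetter x Y → t < x := fun x hx =>
    hSl x (by rw [← hXY, isLetter_mul]; exact Or.inr hx)
  -- The small part of `rowsProd (a + K) c` is a left factor of the rectangle `m2`, hence has at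
  -- most `p2` rows; beneath row `a` nothing small is left.
  have hlow : ∀ x, IsLetter x (rowsProd K fun k => c (a + k)) → t < x := by
    intro x hx
    obtain ⟨k, hk, hx⟩ := isLetter_rowsProd.1 hx
    have hsm : sm t (rowsProd (a + K) c) * sm t D = rowsProd p2 m2 := by
      rw [← map_mul, hD, map_mul, sm_eq_self hs2, sm_eq_one hYl, one_mul]
    have hlen : (tab (sm t (rowsProd (a + K) c))).length ≤ p2 :=
      (length_tab_le_mul _ _).trans (hsm ▸ length_tab_rowsProd_le h2.isRow)
    set f : ℕ → List ℤ := fun k => if k < a + K then (c k).filter (· ≤ t) else []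
    have hf : IsTabFun f := by
      refine ⟨fun k => ?_, fun k => ?_⟩
      · simp only [f]
        split_ifs
        · exact (hc.filter t).1 k
        · exact isRow_nil
      · simp only [f]
        by_cases hk : k + 1 < a + K
        · rw [if_pos hk, if_pos (by omega)]; exact (hc.filter t).2 k
        · rw [if_neg hk]; exact below_nil _
    have heq : rowsOf (tab (sm t (rowsProd (a + K) c))) = f := by
      refine isTabFun_unique (isTableau_tab _).isTabFun hf (N := a + K)
        (fun k hk => rowsOf_of_length_le (by omega)) (fun k hk => if_neg (by omega)) ?_
      rw [rowsProd_tab (by omega), sm_rowsProd]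
      exact (rowsProd_ite _ _).symm
    have h0 : f (a + k) = [] := by rw [← heq]; exact rowsOf_of_length_le (by omega)
    simp only [f] at h0
    rw [if_pos (by omega)] at h0
    by_contra hlt
    have : x ∈ (c (a + k)).filter (· ≤ t) := List.mem_filter.2 ⟨hx, by simpa using hlt⟩
    rw [h0] at this
    simp at this
  have hD' := hD
  rw [rowsProd_add, mul_assoc] at hD'
  have hsmZ : sm t (rowsProd a c * D) = rowsProd p2 m2 := by
    have := congrArg (sm t) hD'
    rwa [map_mul, map_mul _ Y, sm_eq_self hs2, sm_eq_one hYl, sm_eq_one hlow, one_mul,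
      one_mul] at this
  have hw : WidthLE (rowsProd a c * D) c2 := by
    have hYM : WidthLE (Y * rowsProd p2 m2) c2 := by
      refine widthLE_mul ?_ h2.widthLE fun x hx z hz => (hs2 x hx).trans_lt (hYl z hz)
      rw [← hXY] at hSw
      exact hSw.mul_right
    rw [← hD'] at hYM
    exact hYM.mul_right
  refine ⟨X * rowsProd K (fun k => c (a + k)), lg t (rowsProd a c * D), ?_, ?_,
    h2.eq_lg_mul hsmZ hw⟩
  · have := congrArg (lg t) hD'
    rw [map_mul, map_mul _ Y, lg_eq_one hs2, lg_eq_self hYl, lg_eq_self hlow, mul_one] at this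
    rw [mul_assoc, this, hXY]
  · rw [hA, mul_assoc]

/-! ### Junctions -/

/-- The closure properties of a set of pairs `(q, p)` that make it possible to attach `p` to the
right of and `q` beneath a rectangle with `a` rows and `b` columns. -/
structure JunctionClosed (a b : ℕ) (G : Set (Plactic × Plactic)) : Prop where
  exchange : ∀ {A D : Plactic} {y₀ yp xm xp y' x' : List ℤ} {w : ℤ},
    (A * pl (y₀ ++ yp), pl (xm ++ xp) * D) ∈ G → IsRow (y₀ ++ yp) → IsRow (xm ++ xp) →
    IsRow (y₀ ++ y') → List.Forall₂ (· < ·) xm ((y₀.drop b).take xm.length) →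
    (∀ a ∈ y₀, a ≤ w) → (∀ a ∈ yp, w ≤ a) → (∀ a ∈ xp, w ≤ a) → w ∈ (y₀ ++ yp).drop b →
    pl yp * pl xp = pl y' * pl x' → (A * pl (y₀ ++ y'), pl (xm ++ x') * D) ∈ G
  rows : ∀ {A : Plactic} {c : ℕ → List ℤ} {K : ℕ}, IsTabFun c → (A, rowsProd (a + K) c) ∈ G →
    (A * rowsProd K (fun k => c (a + k)), rowsProd a c) ∈ G

/-- The classes of the lower and the upper part of an array. -/
def splitArray (a K : ℕ) (z : ℕ → List ℤ) : Plactic × Plactic :=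
  (rowsProd K (fun k => z (a + k)), rowsProd a z)

/-- The offset between row `k` and row `k + 1`. -/
def shiftAt (a b k : ℕ) : ℕ := if k + 1 = a then b else 0

theorem splitArray_eq {a K k : ℕ} (hk : k + 1 < a + K) (ha : k + 1 ≠ a) {z z' : ℕ → List ℤ}
    (hz : ∀ i, i ≠ k → i ≠ k + 1 → z' i = z i)
    (h : pl (z' (k + 1)) * pl (z' k) = pl (z (k + 1)) * pl (z k)) :
    splitArray a K z' = splitArray a K z := by
  rw [splitArray, splitArray]
  by_cases hlt : k + 1 < a
  · rw [rowsProd_two_rows hlt hz h,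
      rowsProd_congr (z := fun k => z' (a + k)) (z' := fun k => z (a + k))
        fun j _ => hz _ (by omega) (by omega)]
  · obtain ⟨l, rfl⟩ : ∃ l, k = a + l := ⟨k - a, by omega⟩
    rw [rowsProd_congr (z := z') (z' := z) fun j _ => hz _ (by omega) (by omega),
      rowsProd_two_rows (z := fun k => z (a + k)) (z' := fun k => z' (a + k)) (k := l) (by omega)
        (fun i h1 h2 => hz _ (by omega) (by omega)) h]

theorem splitArray_eq_mul {a K : ℕ} (z : ℕ → List ℤ) :
    splitArray (a + 1) (K + 1) z =
      (rowsProd K (fun k => z (a + 1 + (k + 1))) * pl (z (a + 1)), pl (z a) * rowsProd a z) := by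
  rw [splitArray, rowsProd_succ_top a]
  rfl

/-- The freedom in `n` serves two purposes: with `n = b + m + 1` the bad entry stays in the lower
row, as in `swapAt`; with `n = b + m` it takes part, as in straightening. -/
theorem JunctionClosed.splitArray_mem {a b K : ℕ} {G : Set (Plactic × Plactic)}
    (hG : JunctionClosed (a + 1) b G) {z z' : ℕ → List ℤ} (h : splitArray (a + 1) (K + 1) z ∈ G)
    (hz : ∀ i, i ≠ a → i ≠ a + 1 → z' i = z i) (hrow : ∀ i, IsRow (z i))
    (hrow' : IsRow (z' (a + 1))) {m n : ℕ} {w : ℤ} (hb : FirstBad b (z a) (z (a + 1)) m w)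
    (hn : b + m ≤ n) (hn' : n ≤ b + m + 1) {y' x' : List ℤ}
    (hy' : z' (a + 1) = (z (a + 1)).take n ++ y') (hx' : z' a = (z a).take m ++ x')
    (hpl : pl ((z (a + 1)).drop n) * pl ((z a).drop m) = pl y' * pl x') :
    splitArray (a + 1) (K + 1) z' ∈ G := by
  rw [splitArray_eq_mul] at h ⊢
  have e1 : rowsProd K (fun k => z' (a + 1 + (k + 1))) =
      rowsProd K (fun k => z (a + 1 + (k + 1))) :=
    rowsProd_congr fun j _ => hz _ (by omega) (by omega)
  have e2 : rowsProd a z' = rowsProd a z := rowsProd_congr fun j hj => hz _ (by omega) (by omega)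
  rw [e1, e2, hy', hx']
  rw [hy'] at hrow'
  have hlen : ((z a).take m).length = m := by rw [List.length_take]; have := hb.length; omega
  have hle : (((z (a + 1)).take n).drop b).take m = ((z (a + 1)).drop b).take m := by
    rw [List.drop_take, List.take_take]
    congr 1
    omega
  refine hG.exchange (w := w) (yp := (z (a + 1)).drop n) (xp := (z a).drop m) ?_ ?_ ?_ hrow' ?_ ?_
    ?_ hb.le ?_ hpl
  · rw [List.take_append_drop, List.take_append_drop]
    exact h
  · rw [List.take_append_drop]; exact hrow _
  · rw [List.take_append_drop]; exact hrow _
  · rw [hlen, hle]; exact hb.forall₂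
  · intro v hv
    refine hb.take_le (hrow _) v ?_
    exact (List.take_subset_take_left _ hn') hv
  · intro v hv
    refine hb.le_drop (hrow _) v ?_
    obtain ⟨j, rfl⟩ := Nat.exists_eq_add_of_le hn
    rw [← List.drop_drop] at hv
    exact List.mem_of_mem_drop hv
  · rw [List.take_append_drop]
    refine List.mem_of_getElem? (i := m) ?_
    rw [List.getElem?_drop]
    exact hb.get

/-! ### Straightening -/

/-- Row insertion makes a tableau of the two rows. If the lower row kept its length, it would be `y`
itself, and by uniqueness the upper row would be `x`, so the pair would have been a tableau from the
start. -/
theorem exists_straight_pair {y x : List ℤ} (hy : IsRow y) (hx : IsRow x) (h : ¬ Below x y) :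
    ∃ c d, IsRow d ∧ c.Sublist y ∧ c.length < y.length ∧
      c.length + d.length = y.length + x.length ∧ pl y * pl x = pl c * pl d ∧
      ∀ v ∈ d, v ∈ y ∨ v ∈ x := by
  obtain ⟨h1, h2, h3, h4⟩ := rowRun_pair hy hx
  have hd := rowRun_isRow (u := x) hy
  have hlen := rowRun_length y x
  refine ⟨(rowRun y x).2, (rowRun y x).1, hd, h3, ?_, by omega, pl_rowRun hy,
    fun v hv => mem_rowRun_row hv⟩
  by_contra hlt
  have heq : (rowRun y x).2 = y := h3.eq_of_length_le (by omega)
  have := (pair_unique hy hx h1 hd (by rw [heq] at hlen; omega) (pl_rowRun hy)).2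
  rw [heq, ← this] at h2
  exact h h2

theorem forall₂_of_forall_lt {s u : List ℤ} (hl : s.length = u.length)
    (h : ∀ a ∈ s, ∀ b ∈ u, a < b) : List.Forall₂ (· < ·) s u := by
  induction s generalizing u with
  | nil =>
    rw [List.eq_nil_of_length_eq_zero hl.symm]
    exact List.Forall₂.nil
  | cons a s ih =>
    cases u with
    | nil => simp at hl
    | cons b u =>
      exact List.Forall₂.cons (h a (by simp) b (by simp))
        (ih (by simpa using hl) fun p hp q hq => h p (by simp [hp]) q (by simp [hq]))

/-- The last row `t a` of the rectangle can be placed directly before `xm`. The row `t a ++ xm` is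
matched strictly into the lower row, its first `b` letters going under `t a`, and so it commutes
with `yp`. The tails meet and can be replaced. -/
theorem IsRect.mul_exchange {a b : ℕ} {t : ℕ → List ℤ} (ht : IsRect (a + 1) b t)
    {y₀ yp xm xp y' x' : List ℤ} (hy : IsRow (y₀ ++ yp)) (hx : IsRow (xm ++ xp))
    (hy' : IsRow (y₀ ++ y')) (hx' : IsRow (xm ++ x')) (hb : b ≤ y₀.length)
    (hm : List.Forall₂ (· < ·) xm ((y₀.drop b).take xm.length))
    (hpl : pl yp * pl xp = pl y' * pl x')
    (hty : ∀ k < a + 1, ∀ u ∈ t k, ∀ v ∈ y₀, u < v)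
    (htx : ∀ k < a + 1, ∀ u ∈ t k, ∀ v ∈ xm ++ xp, u ≤ v)
    (htx' : ∀ k < a + 1, ∀ u ∈ t k, ∀ v ∈ xm ++ x', u ≤ v) :
    pl (y₀ ++ y') * rowsProd (a + 1) t * pl (xm ++ x') =
      pl (y₀ ++ yp) * rowsProd (a + 1) t * pl (xm ++ xp) := by
  have hsub : (y₀.take b ++ (y₀.drop b).take xm.length).Sublist y₀ := by
    conv_rhs => rw [← List.take_append_drop b y₀]
    exact (List.Sublist.refl _).append (List.take_sublist _ _)
  have hf : List.Forall₂ (· < ·) (t a ++ xm) (y₀.take b ++ (y₀.drop b).take xm.length) := by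
    refine List.rel_append (forall₂_of_forall_lt ?_ ?_) hm
    · rw [ht.length a (by omega), List.length_take]; omega
    · exact fun u hu v hv => hty a (by omega) u hu v (List.mem_of_mem_take hv)
  have hrow : IsRow (t a ++ xm) := by
    rw [isRow_append]
    refine ⟨ht.isRow a (by omega), (isRow_append.1 hx).1, fun u hu v hv => ?_⟩
    exact htx a (by omega) u hu v (List.mem_append_left _ hv)
  have key : ∀ yq xq, IsRow (y₀ ++ yq) → IsRow (xm ++ xq) →
      (∀ k < a + 1, ∀ u ∈ t k, ∀ v ∈ xm ++ xq, u ≤ v) →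
      pl (y₀ ++ yq) * rowsProd (a + 1) t * pl (xm ++ xq) =
        pl y₀ * pl (t a ++ xm) * (pl yq * pl xq) * rowsProd a t := by
    intro yq xq h1 h2 h3
    have hcomm := pl_comm_of_forall₂ h1 hrow hsub hf
    have hmove := ht.move h2 h3
    calc _ = pl y₀ * pl yq * (pl (t a) * rowsProd a t * pl (xm ++ xq)) := by
          rw [rowsProd_succ_top, pl_append y₀]; simp only [mul_assoc]
      _ = pl y₀ * pl yq * pl (t a ++ xm) * pl xq * rowsProd a t := by
          rw [← hmove, pl_append xm, pl_append (t a)]; simp only [mul_assoc]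
      _ = _ := by rw [hcomm]; simp only [mul_assoc]
  rw [key y' x' hy' hx' htx', key yp xp hy hx htx, hpl]

/-- The weight of an array that decreases under straightening. -/
def weight (N : ℕ) (z : ℕ → List ℤ) : ℕ := ∑ k ∈ Finset.range N, k * (z k).length

theorem weight_lt {N k : ℕ} (hk : k + 1 < N) {z z' : ℕ → List ℤ}
    (hz : ∀ i, i ≠ k → i ≠ k + 1 → z' i = z i)
    (h : (z' (k + 1)).length < (z (k + 1)).length)
    (hl : (z' (k + 1)).length + (z' k).length = (z (k + 1)).length + (z k).length) :
    weight N z' < weight N z := by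
  have h1 : k + 1 ∈ (Finset.range N).erase k := by
    rw [Finset.mem_erase, Finset.mem_range]; omega
  have h0 : k ∈ Finset.range N := by rw [Finset.mem_range]; omega
  rw [weight, weight, ← Finset.add_sum_erase _ _ h0, ← Finset.add_sum_erase _ _ h1,
    ← Finset.add_sum_erase (Finset.range N) (fun k => k * (z k).length) h0,
    ← Finset.add_sum_erase _ (fun k => k * (z k).length) h1]
  have : ∑ x ∈ ((Finset.range N).erase k).erase (k + 1), x * (z' x).length =
      ∑ x ∈ ((Finset.range N).erase k).erase (k + 1), x * (z x).length := by
    refine Finset.sum_congr rfl fun i hi => ?_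
    rw [Finset.mem_erase, Finset.mem_erase] at hi
    rw [hz i hi.2.1 hi.1]
  rw [this, ← add_assoc, ← add_assoc]
  apply Nat.add_lt_add_right
  have e : k * (z' k).length + k * (z' (k + 1)).length =
      k * (z k).length + k * (z (k + 1)).length := by
    rw [← mul_add, ← mul_add]; congr 1; omega
  rw [add_mul, add_mul, one_mul, one_mul]
  omega

/-- The array has `a + K` rows, and its two parts form a pair in `G`. -/
structure ArrayIn (a K : ℕ) (G : Set (Plactic × Plactic)) (z : ℕ → List ℤ) : Prop where
  isRow : ∀ k, IsRow (z k)
  nil : ∀ k, a + K ≤ k → z k = []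
  mem : splitArray a K z ∈ G

theorem splitArray_letter_left {a K : ℕ} {z : ℕ → List ℤ} {v : ℤ} {k : ℕ} (h1 : a ≤ k)
    (h2 : k < a + K) (hv : v ∈ z k) : IsLetter v (splitArray a K z).1 := by
  obtain ⟨l, rfl⟩ := Nat.exists_eq_add_of_le h1
  exact isLetter_rowsProd.2 ⟨l, by omega, hv⟩

theorem splitArray_letter_right {a K : ℕ} {z : ℕ → List ℤ} {v : ℤ} {k : ℕ} (h1 : k < a)
    (hv : v ∈ z k) : IsLetter v (splitArray a K z).2 :=
  isLetter_rowsProd.2 ⟨k, h1, hv⟩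

theorem ArrayIn.straighten_step {a b K : ℕ} {t : ℕ → List ℤ} (ht : IsRect a b t)
    {G : Set (Plactic × Plactic)} (hG : JunctionClosed a b G)
    (hlet : ∀ g ∈ G, ∀ k < a, ∀ x ∈ t k, ∀ y, IsLetter y g.1 ∨ IsLetter y g.2 → x < y)
    {z : ℕ → List ℤ} (hz : ArrayIn a K G z) {k : ℕ} (hk : k + 1 < a + K)
    (hbad : ¬ Below (z k) ((z (k + 1)).drop (shiftAt a b k))) :
    ∃ z', ArrayIn a K G z' ∧ weight (a + K) z' < weight (a + K) z ∧
      (splitArray a K z').1 * rowsProd a t * (splitArray a K z').2 =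
        (splitArray a K z).1 * rowsProd a t * (splitArray a K z).2 := by
  rw [shiftAt] at hbad
  by_cases ha : k + 1 = a
  · rw [if_pos ha] at hbad
    subst ha
    obtain ⟨K, rfl⟩ : ∃ L, K = L + 1 := ⟨K - 1, by omega⟩
    obtain ⟨m, w, hfb⟩ := exists_firstBad (hz.isRow k) hbad
    have hlt := hfb.lt_length
    have hml := hfb.length
    have hy := hz.isRow (k + 1)
    have hx := hz.isRow k
    -- The pair that is straightened consists of the tails from the bad column on, including `w`; it
    -- is already bad in its first column.
    have hnb : ¬ Below ((z k).drop m) ((z (k + 1)).drop (b + m)) := by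
      intro h
      obtain ⟨u, hu1, hu2⟩ := h.getElem? (i := 0) (w := w) (by
        rw [List.getElem?_drop]; exact hfb.get)
      rw [List.getElem?_drop] at hu1
      have := hfb.viol u hu1
      omega
    obtain ⟨c, d, hd, hc, hcl, hcd, hpl, hdm⟩ := exists_straight_pair
      (hy.sublist (List.drop_sublist (b + m) _)) (hx.sublist (List.drop_sublist m _)) hnb
    set z' := Function.update (Function.update z k ((z k).take m ++ d)) (k + 1)
      ((z (k + 1)).take (b + m) ++ c) with hz'
    have hz'0 : z' k = (z k).take m ++ d := by
      rw [hz', Function.update_of_ne (by omega), Function.update_self]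
    have hz'1 : z' (k + 1) = (z (k + 1)).take (b + m) ++ c := by
      rw [hz', Function.update_self]
    have hne : ∀ i, i ≠ k → i ≠ k + 1 → z' i = z i := by
      intro i h1 h2
      rw [hz', Function.update_of_ne h2, Function.update_of_ne h1]
    have hrow1 : IsRow (z' (k + 1)) := by
      rw [hz'1]
      refine hy.sublist ?_
      conv_rhs => rw [← List.take_append_drop (b + m) (z (k + 1))]
      exact (List.Sublist.refl _).append hc
    have hrow0 : IsRow (z' k) := by
      rw [hz'0, isRow_append]
      refine ⟨hx.sublist (List.take_sublist _ _), hd, fun p hp q hq => ?_⟩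
      have h1 := hfb.take_lt hy p hp
      rcases hdm q hq with h | h
      · have := hfb.le_drop hy q h; omega
      · have := hfb.le q h; omega
    have hrow : ∀ i, IsRow (z' i) := by
      intro i
      by_cases h1 : i = k
      · rw [h1]; exact hrow0
      by_cases h2 : i = k + 1
      · rw [h2]; exact hrow1
      rw [hne i h1 h2]; exact hz.isRow i
    have hmem := hG.splitArray_mem hz.mem hne hz.isRow hrow1 hfb le_rfl (by omega) hz'1 hz'0 hpl
    refine ⟨z', ⟨hrow, fun i hi => ?_, hmem⟩, ?_, ?_⟩
    · rw [hne i (by omega) (by omega)]; exact hz.nil i hi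
    · refine weight_lt hk hne ?_ ?_
      · rw [hz'1, List.length_append, List.length_take]
        rw [List.length_drop] at hcl
        omega
      · rw [hz'1, hz'0]
        simp only [List.length_append, List.length_take, List.length_drop] at hcd ⊢
        omega
    · have l1 : ∀ j < k + 1, ∀ u ∈ t j, ∀ v ∈ z (k + 1), u < v := fun j hj u hu v hv =>
        hlet _ hz.mem j hj u hu v (Or.inl (splitArray_letter_left le_rfl (by omega) hv))
      have l2 : ∀ j < k + 1, ∀ u ∈ t j, ∀ v ∈ z k, u < v := fun j hj u hu v hv =>
        hlet _ hz.mem j hj u hu v (Or.inr (splitArray_letter_right (by omega) hv))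
      have l3 : ∀ j < k + 1, ∀ u ∈ t j, ∀ v ∈ z' k, u < v := fun j hj u hu v hv =>
        hlet _ hmem j hj u hu v (Or.inr (splitArray_letter_right (by omega) hv))
      have hlm : ((z k).take m).length = m := by rw [List.length_take]; omega
      have hex := ht.mul_exchange (y₀ := (z (k + 1)).take (b + m))
        (yp := (z (k + 1)).drop (b + m)) (xm := (z k).take m) (xp := (z k).drop m) (y' := c)
        (x' := d) (by rw [List.take_append_drop]; exact hy) (by rw [List.take_append_drop]; exact hx)
        (hz'1 ▸ hrow1) (hz'0 ▸ hrow0) (by rw [List.length_take]; omega)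
        (by
          rw [hlm, List.drop_take, List.take_take, show min m (b + m - b) = m by omega]
          exact hfb.forall₂) hpl
        (fun j hj u hu v hv => l1 j hj u hu v (List.mem_of_mem_take hv))
        (fun j hj u hu v hv => (l2 j hj u hu v (by rwa [List.take_append_drop] at hv)).le)
        (fun j hj u hu v hv => (l3 j hj u hu v (by rwa [hz'0])).le)
      rw [List.take_append_drop, List.take_append_drop, ← hz'1, ← hz'0] at hex
      rw [splitArray_eq_mul, splitArray_eq_mul]
      have e1 : rowsProd K (fun j => z' (k + 1 + (j + 1))) =
          rowsProd K (fun j => z (k + 1 + (j + 1))) :=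
        rowsProd_congr fun j _ => hne _ (by omega) (by omega)
      have e2 : rowsProd k z' = rowsProd k z :=
        rowsProd_congr fun j hj => hne _ (by omega) (by omega)
      rw [e1, e2]
      have := congrArg (fun V => rowsProd K (fun j => z (k + 1 + (j + 1))) * V * rowsProd k z) hex
      simp only [mul_assoc] at this ⊢
      exact this
  · rw [if_neg ha, List.drop_zero] at hbad
    obtain ⟨c, d, hd, hc, hcl, hcd, hpl, hdm⟩ :=
      exists_straight_pair (hz.isRow (k + 1)) (hz.isRow k) hbad
    set z' := Function.update (Function.update z k d) (k + 1) c with hz'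
    have hz'0 : z' k = d := by
      rw [hz', Function.update_of_ne (by omega), Function.update_self]
    have hz'1 : z' (k + 1) = c := by rw [hz', Function.update_self]
    have hne : ∀ i, i ≠ k → i ≠ k + 1 → z' i = z i := by
      intro i h1 h2
      rw [hz', Function.update_of_ne h2, Function.update_of_ne h1]
    have heq : splitArray a K z' = splitArray a K z :=
      splitArray_eq hk ha hne (by rw [hz'0, hz'1, hpl])
    refine ⟨z', ⟨fun i => ?_, fun i hi => ?_, heq ▸ hz.mem⟩, ?_, by rw [heq]⟩
    · by_cases h1 : i = k
      · rw [h1, hz'0]; exact hd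
      by_cases h2 : i = k + 1
      · rw [h2, hz'1]; exact (hz.isRow (k + 1)).sublist hc
      rw [hne i h1 h2]; exact hz.isRow i
    · rw [hne i (by omega) (by omega)]; exact hz.nil i hi
    · exact weight_lt hk hne (by rw [hz'1]; exact hcl) (by rw [hz'0, hz'1]; exact hcd)

/-! ### Good pairs -/

theorem Below.append_append {s t u v : List ℤ} (h : Below s t) (hl : s.length = t.length)
    (h' : Below u v) : Below (s ++ u) (t ++ v) := by
  induction t generalizing s with
  | nil =>
    rw [List.eq_nil_of_length_eq_zero hl]
    exact h'
  | cons b t ih =>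
    cases s with
    | nil => simp at hl
    | cons a s => exact ⟨h.1, ih h.2 (by simpa using hl)⟩

theorem below_of_forall_lt {s u : List ℤ} (hl : u.length ≤ s.length)
    (h : ∀ a ∈ s, ∀ b ∈ u, a < b) : Below s u := by
  induction u generalizing s with
  | nil => exact below_nil _
  | cons b u ih =>
    cases s with
    | nil => simp at hl
    | cons a s =>
      exact ⟨h a (by simp) b (by simp),
        ih (by simpa using hl) fun p hp q hq => h p (by simp [hp]) q (by simp [hq])⟩

/-- `p` to the right of and `q` beneath a rectangle with `a` rows and `b` columns form a
tableau (if the letters of the rectangle are small). -/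
def Good (a b : ℕ) (g : Plactic × Plactic) : Prop :=
  (tab g.2).length ≤ a ∧
    ∀ k, k + 1 = a → Below (rowsOf (tab g.2) k) ((rowsOf (tab g.1) 0).drop b)

/-- The rows of the tableau of `p`, followed by those of the tableau of `q`. -/
noncomputable def pairArray (a : ℕ) (g : Plactic × Plactic) (k : ℕ) : List ℤ :=
  if k < a then rowsOf (tab g.2) k else rowsOf (tab g.1) (k - a)

theorem pairArray_isRow (a : ℕ) (g : Plactic × Plactic) (k : ℕ) : IsRow (pairArray a g k) := by
  rw [pairArray]
  split_ifs
  · exact (isTableau_tab _).isTabFun.1 _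
  · exact (isTableau_tab _).isTabFun.1 _

theorem pairArray_of_lt {a k : ℕ} (h : k < a) (g : Plactic × Plactic) :
    pairArray a g k = rowsOf (tab g.2) k := if_pos h

theorem pairArray_add (a k : ℕ) (g : Plactic × Plactic) :
    pairArray a g (a + k) = rowsOf (tab g.1) k := by
  rw [pairArray, if_neg (by omega), Nat.add_sub_cancel_left]

theorem pairArray_of_le {a K k : ℕ} {g : Plactic × Plactic} (h : (tab g.1).length ≤ K)
    (hk : a + K ≤ k) : pairArray a g k = [] := by
  obtain ⟨j, rfl⟩ := Nat.exists_eq_add_of_le (show a ≤ k by omega)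
  rw [pairArray_add]
  exact rowsOf_of_length_le (by omega)

theorem splitArray_pairArray {a K : ℕ} {g : Plactic × Plactic} (h1 : (tab g.1).length ≤ K)
    (h2 : (tab g.2).length ≤ a) : splitArray a K (pairArray a g) = g := by
  rw [splitArray]
  refine Prod.ext ?_ ?_
  · simp only [pairArray_add]
    exact rowsProd_tab h1
  · rw [rowsProd_congr fun k hk => pairArray_of_lt hk g]
    exact rowsProd_tab h2

theorem below_pairArray {a k : ℕ} (hk : k + 1 ≠ a) (g : Plactic × Plactic) :
    Below (pairArray a g k) (pairArray a g (k + 1)) := by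
  by_cases h : k + 1 < a
  · rw [pairArray_of_lt h, pairArray_of_lt (by omega)]
    exact (isTableau_tab _).isTabFun.2 k
  · obtain ⟨j, rfl⟩ := Nat.exists_eq_add_of_le (show a ≤ k by omega)
    rw [add_assoc, pairArray_add, pairArray_add]
    exact (isTableau_tab _).isTabFun.2 j

theorem Good.below {a b : ℕ} {g : Plactic × Plactic} (h : Good a b g) (k : ℕ) :
    Below (pairArray a g k) ((pairArray a g (k + 1)).drop (shiftAt a b k)) := by
  rw [shiftAt]
  split_ifs with hk
  · have := h.2 k hk
    rw [pairArray_of_lt (by omega), hk]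
    have e := pairArray_add a 0 g
    rw [add_zero] at e
    rwa [e]
  · exact below_pairArray hk g

theorem rowsOf_tab_rowsProd {N : ℕ} {z : ℕ → List ℤ} (h1 : ∀ k < N, IsRow (z k))
    (h2 : ∀ k, k + 1 < N → Below (z k) (z (k + 1))) :
    rowsOf (tab (rowsProd N z)) = fun k => if k < N then z k else [] := by
  have hz : IsTabFun fun k => if k < N then z k else [] := by
    refine ⟨fun k => ?_, fun k => ?_⟩
    · beta_reduce
      split_ifs with hk
      · exact h1 k hk
      · exact isRow_nil
    · beta_reduce
      by_cases hk : k + 1 < N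
      · rw [if_pos hk, if_pos (by omega)]; exact h2 k hk
      · rw [if_neg hk]; exact below_nil _
  obtain ⟨T, hT, hl, he⟩ := exists_tableau hz fun k (hk : N ≤ k) => if_neg (by omega)
  rw [← he, ← rowsProd_ite, ← he, rowsProd_rowsOf hl, tab_cl hT]

theorem pairArray_splitArray {a K : ℕ} {z : ℕ → List ℤ} (h1 : ∀ k, IsRow (z k))
    (h0 : ∀ k, a + K ≤ k → z k = [])
    (h2 : ∀ k, k + 1 < a + K → k + 1 ≠ a → Below (z k) (z (k + 1))) :
    pairArray a (splitArray a K z) = z := by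
  funext k
  rw [pairArray, splitArray]
  split_ifs with hk
  · rw [rowsOf_tab_rowsProd (fun k _ => h1 k) fun k hk => h2 k (by omega) (by omega)]
    exact if_pos hk
  · obtain ⟨j, rfl⟩ := Nat.exists_eq_add_of_le (show a ≤ k by omega)
    dsimp only
    rw [rowsOf_tab_rowsProd (z := fun k => z (a + k)) (fun k _ => h1 _)
      fun k hk => h2 (a + k) (by omega) (by omega), Nat.add_sub_cancel_left]
    beta_reduce
    split_ifs with hj
    · rfl
    · exact (h0 _ (by omega)).symm

theorem length_tab_splitArray {a K : ℕ} {z : ℕ → List ℤ} (h1 : ∀ k, IsRow (z k)) :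
    (tab (splitArray a K z).1).length ≤ K ∧ (tab (splitArray a K z).2).length ≤ a :=
  ⟨length_tab_rowsProd_le fun _ _ => h1 _, length_tab_rowsProd_le fun k _ => h1 k⟩

theorem good_splitArray {a b K : ℕ} {z : ℕ → List ℤ} (h1 : ∀ k, IsRow (z k))
    (h0 : ∀ k, a + K ≤ k → z k = [])
    (h2 : ∀ k, k + 1 < a + K → Below (z k) ((z (k + 1)).drop (shiftAt a b k))) :
    Good a b (splitArray a K z) := by
  refine ⟨(length_tab_splitArray h1).2, fun k hk => ?_⟩
  have he : pairArray a (splitArray a K z) = z := by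
    refine pairArray_splitArray h1 h0 fun k hk hka => ?_
    have := h2 k hk
    rwa [shiftAt, if_neg hka] at this
  rw [← pairArray_of_lt (a := a) (by omega), ← pairArray_add a 0, he]
  by_cases hK : k + 1 < a + K
  · have := h2 k hK
    rw [shiftAt, if_pos hk, hk] at this
    exact this
  · rw [h0 (a + 0) (by omega), List.drop_nil]
    exact below_nil _

/-- Straightening lowers `weight`, which favors upper rows, so it terminates. Each step keeps the
product around the rectangle, and the pair stays in `G` by the closure properties. -/
theorem exists_good {a b : ℕ} {t : ℕ → List ℤ} (ht : IsRect a b t) {G : Set (Plactic × Plactic)}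
    (hG : JunctionClosed a b G)
    (hlet : ∀ g ∈ G, ∀ k < a, ∀ x ∈ t k, ∀ y, IsLetter y g.1 ∨ IsLetter y g.2 → x < y)
    {g : Plactic × Plactic} (hg : g ∈ G) :
    ∃ g' ∈ G, Good a b g' ∧ g'.1 * rowsProd a t * g'.2 = g.1 * rowsProd a t * g.2 := by
  have main : ∀ n K z, weight (a + K) z = n → ArrayIn a K G z →
      ∃ g' ∈ G, Good a b g' ∧ g'.1 * rowsProd a t * g'.2 =
        (splitArray a K z).1 * rowsProd a t * (splitArray a K z).2 := by
    intro n
    induction n using Nat.strong_induction_on with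
    | _ n ih =>
      intro K z hn hz
      by_cases hgood : ∀ k, k + 1 < a + K → Below (z k) ((z (k + 1)).drop (shiftAt a b k))
      · exact ⟨_, hz.mem, good_splitArray hz.isRow hz.nil hgood, rfl⟩
      · push Not at hgood
        obtain ⟨k, hk, hbad⟩ := hgood
        obtain ⟨z', h1, h2, h3⟩ := hz.straighten_step ht hG hlet hk hbad
        obtain ⟨g', h4, h5, h6⟩ := ih _ (hn ▸ h2) K z' rfl h1
        exact ⟨g', h4, h5, h6.trans h3⟩
  obtain ⟨q, p⟩ := g
  set c := rowsOf (tab p) with hc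
  have hct : IsTabFun c := (isTableau_tab p).isTabFun
  have hpc : rowsProd (a + (tab p).length) c = p := rowsProd_tab (by omega)
  -- Before straightening, the rows of `p` beneath row `a` are moved to `q`; by
  -- `IsRect.mul_rowsProd` they pass the rectangle without changing the product.
  have hmem : (q * rowsProd (tab p).length (fun k => c (a + k)), rowsProd a c) ∈ G :=
    hG.rows hct (by rw [hpc]; exact hg)
  set g₁ := (q * rowsProd (tab p).length (fun k => c (a + k)), rowsProd a c) with hg₁
  have hl2 : (tab g₁.2).length ≤ a := length_tab_rowsProd_le fun k _ => hct.1 k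
  have hsp := splitArray_pairArray (a := a) (g := g₁) le_rfl hl2
  obtain ⟨g', h1, h2, h3⟩ := main _ (tab g₁.1).length (pairArray a g₁) rfl
    ⟨pairArray_isRow a g₁, fun k hk => pairArray_of_le le_rfl hk, by rw [hsp]; exact hmem⟩
  refine ⟨g', h1, h2, h3.trans ?_⟩
  rw [hsp, hg₁]
  have hcc : ∀ k < a, ∀ l, ∀ x ∈ t k, ∀ y ∈ c l, x ≤ y := by
    intro k hk l x hx y hy
    refine (hlet _ hg k hk x hx y (Or.inr ?_)).le
    show IsLetter y p
    rw [← hpc, isLetter_rowsProd]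
    refine ⟨l, ?_, hy⟩
    by_contra hl
    rw [hc, rowsOf_of_length_le (by omega)] at hy
    simp at hy
  have := ht.mul_rowsProd hct hcc (tab p).length
  rw [hpc] at this
  simp only [mul_assoc] at this ⊢
  rw [this]

/-- The array of attached rows is a tableau: inside the first `a` rows and beneath them this is
clear, and across the junction the first `b` letters of `q` lie under the smaller letters of the
rectangle while the rest fits by goodness. Its reading word represents the product. -/
theorem rowsOf_tab_good {a b : ℕ} {t : ℕ → List ℤ} (ht : IsRect a b t) {g : Plactic × Plactic}
    (hlet : ∀ k < a, ∀ x ∈ t k, ∀ y, IsLetter y g.1 ∨ IsLetter y g.2 → x < y) (hg : Good a b g) :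
    rowsOf (tab (g.1 * rowsProd a t * g.2)) =
      fun k => if k < a then t k ++ pairArray a g k else pairArray a g k := by
  set K := (tab g.1).length
  set z := pairArray a g with hzdef
  have hsp : splitArray a K z = g := splitArray_pairArray le_rfl hg.1
  have hzr : ∀ k, IsRow (z k) := pairArray_isRow a g
  have lz : ∀ k < a, ∀ x ∈ t k, ∀ l < a + K, ∀ y ∈ z l, x < y := by
    intro k hk x hx l hl y hy
    apply hlet k hk x hx y
    rw [← hsp]
    by_cases hla : l < a
    · exact Or.inr (splitArray_letter_right hla hy)
    · exact Or.inl (splitArray_letter_left (by omega) hl hy)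
  have hprod : g.1 * rowsProd a t * g.2 =
      rowsProd (a + K) fun k => if k < a then t k ++ z k else z k := by
    rw [rowsProd_add, rowsProd_congr (N := a) (z' := fun k => t k ++ z k) fun k hk => if_pos hk,
      ht.rowsProd_append (fun k _ => hzr k)
        fun k hk l hl x hx y hy => (lz k hk x hx l (by omega) y hy).le,
      rowsProd_congr (N := K) (z' := fun k => z (a + k)) fun k hk => if_neg (by omega),
      ← mul_assoc]
    conv_lhs => rw [← hsp]
    rfl
  rw [hprod, rowsOf_tab_rowsProd]
  · funext k
    by_cases hk : k < a + K
    · rw [if_pos hk]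
    · rw [if_neg hk, if_neg (by omega)]
      exact (pairArray_of_le le_rfl (by omega)).symm
  · intro k hk
    split_ifs with hka
    · rw [isRow_append]
      exact ⟨ht.isRow k hka, hzr k, fun x hx y hy => (lz k hka x hx k hk y hy).le⟩
    · exact hzr k
  · intro k hk
    have hb := hg.below k
    rw [← hzdef] at hb
    by_cases h1 : k + 1 < a
    · rw [if_pos h1, if_pos (by omega)]
      rw [shiftAt, if_neg (by omega), List.drop_zero] at hb
      have h2 := ht.below k h1
      have h3 : (t k).length = (t (k + 1)).length := by
        rw [ht.length k (by omega), ht.length (k + 1) h1]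
      exact h2.append_append h3 hb
    · rw [if_neg h1]
      by_cases h2 : k < a
      · rw [if_pos h2]
        rw [shiftAt, if_pos (by omega)] at hb
        rw [← List.take_append_drop b (z (k + 1))]
        by_cases h3 : b ≤ (z (k + 1)).length
        · have h4 : ((z (k + 1)).take b).length = b := by rw [List.length_take]; omega
          refine Below.append_append ?_ (by rw [ht.length k h2, h4]) hb
          refine below_of_forall_lt (by rw [ht.length k h2, h4]) fun x hx y hy => ?_
          exact lz k h2 x hx (k + 1) hk y (List.mem_of_mem_take hy)
        · rw [List.drop_eq_nil_of_le (by omega), List.append_nil]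
          refine Below.append_left (below_of_forall_lt ?_ fun x hx y hy => ?_) _
          · rw [ht.length k h2, List.length_take]; omega
          · exact lz k h2 x hx (k + 1) hk y (List.mem_of_mem_take hy)
      · rw [if_neg h2]
        rwa [shiftAt, if_neg (by omega), List.drop_zero] at hb

theorem good_injective {a b : ℕ} {t : ℕ → List ℤ} (ht : IsRect a b t) {g g' : Plactic × Plactic}
    (hlet : ∀ k < a, ∀ x ∈ t k, ∀ y, IsLetter y g.1 ∨ IsLetter y g.2 → x < y) (hg : Good a b g)
    (hlet' : ∀ k < a, ∀ x ∈ t k, ∀ y, IsLetter y g'.1 ∨ IsLetter y g'.2 → x < y)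
    (hg' : Good a b g') (h : g.1 * rowsProd a t * g.2 = g'.1 * rowsProd a t * g'.2) : g = g' := by
  have h1 := rowsOf_tab_good ht hlet hg
  rw [h, rowsOf_tab_good ht hlet' hg'] at h1
  have h2 : pairArray a g = pairArray a g' := by
    funext k
    have := congrFun h1 k
    beta_reduce at this
    split_ifs at this with hk
    · exact (List.append_cancel_left this).symm
    · exact this.symm
  set K := max (tab g.1).length (tab g'.1).length
  rw [← splitArray_pairArray (K := K) (le_max_left _ _) hg.1, h2,
    splitArray_pairArray (le_max_right _ _) hg'.1]

/-! ### Sums over a junction -/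

theorem rowLen_eq_getD (μ : YoungDiagram) (k : ℕ) : μ.rowLen k = μ.rowLens.getD k 0 := by
  by_cases h : k < μ.rowLens.length
  · rw [List.getD_eq_getElem _ _ h, YoungDiagram.get_rowLens]
  · rw [List.getD_eq_default _ _ (by omega)]
    rw [YoungDiagram.length_rowLens] at h
    by_contra hne
    exact h (YoungDiagram.mem_iff_lt_colLen.1 (YoungDiagram.mem_iff_lt_rowLen.2 (by omega)))

theorem rowLen_ydiag (V : Plactic) (k : ℕ) : (ydiag V).rowLen k = (rowsOf (tab V) k).length := by
  rw [rowLen_eq_getD, rowLens_ydiag, shape_getD]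

theorem colLen_ydiag (V : Plactic) : (ydiag V).colLen 0 = (tab V).length := by
  rw [← YoungDiagram.length_rowLens, rowLens_ydiag, shape, List.length_map]

/-- The Schur function of the rectangle with `p` to its right and `q` beneath it. -/
noncomputable def pairSchur (a b : ℕ) (g : Plactic × Plactic) : SymFun :=
  schur (attach a b (ydiag g.2) (ydiag g.1))

theorem pairSchur_eq {a b K : ℕ} {g : Plactic × Plactic} (h : (tab g.1).length ≤ K) :
    pairSchur a b g = schurZ (a + K) fun k =>
      (if k < a then (b : ℤ) else 0) + (pairArray a g k).length := by
  have hl : (ydiag g.1).rowLens.length = (tab g.1).length := by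
    rw [YoungDiagram.length_rowLens, colLen_ydiag]
  rw [pairSchur, schur_eq_schurZ (N := a + K) (by
    rw [attach, List.length_append, List.length_map, List.length_range, hl]; omega)]
  refine schurZ_congr fun k _ => ?_
  rw [attach]
  by_cases hk : k < a
  · rw [if_pos hk, List.getD_append _ _ _ _ (by simpa using hk),
      List.getD_eq_getElem _ _ (by simpa using hk), List.getElem_map, List.getElem_range,
      rowLen_ydiag, pairArray_of_lt hk]
    push_cast
    rfl
  · rw [if_neg hk, List.getD_append_right _ _ _ _ (by simpa using hk), List.length_map,
      List.length_range, ← rowLen_eq_getD, rowLen_ydiag, pairArray, if_neg hk, zero_add]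

theorem schur_ydiag_good {a b : ℕ} {t : ℕ → List ℤ} (ht : IsRect a b t) {g : Plactic × Plactic}
    (hlet : ∀ k < a, ∀ x ∈ t k, ∀ y, IsLetter y g.1 ∨ IsLetter y g.2 → x < y) (hg : Good a b g) :
    schur (ydiag (g.1 * rowsProd a t * g.2)).rowLens = pairSchur a b g := by
  set W := g.1 * rowsProd a t * g.2 with hW
  set K := max (tab g.1).length (tab W).length
  rw [pairSchur_eq (K := K) (le_max_left _ _), schur_eq_schurZ (N := a + K) (by
    rw [YoungDiagram.length_rowLens, colLen_ydiag]
    exact (le_max_right _ _).trans (Nat.le_add_left _ _))]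
  refine schurZ_congr fun k _ => ?_
  rw [← rowLen_eq_getD, rowLen_ydiag, hW, rowsOf_tab_good ht hlet hg]
  by_cases hk : k < a
  · simp only [if_pos hk, List.length_append, ht.length k hk]
    push_cast
    rfl
  · simp only [if_neg hk, zero_add]

theorem finite_arrayIn (a K : ℕ) (G : Finset (Plactic × Plactic)) :
    {z | ArrayIn a K (G : Set (Plactic × Plactic)) z}.Finite := by
  refine (G.finite_toSet.biUnion fun g _ => finite_arrays (a + K) (g.1 * g.2)).subset ?_
  intro z hz
  simp only [Set.mem_iUnion]
  exact ⟨splitArray a K z, hz.mem, hz.isRow, hz.nil, rowsProd_add a K z⟩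

theorem JunctionClosed.arrayIn_swapAt {a b K : ℕ} {G : Set (Plactic × Plactic)}
    (hG : JunctionClosed a b G) {z : ℕ → List ℤ} (hz : ArrayIn a K G z) {k : ℕ}
    (hk : k + 1 < a + K) {m : ℕ} {w : ℤ}
    (hb : FirstBad (shiftAt a b k) (z k) (z (k + 1)) m w) :
    ArrayIn a K G (swapAt (shiftAt a b k) z k m) := by
  have hrow := swapAt_isRow hz.isRow hb
  have hne : ∀ i, i ≠ k → i ≠ k + 1 → swapAt (shiftAt a b k) z k m i = z i :=
    fun i h1 h2 => swapAt_of_ne h1 h2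
  refine ⟨hrow, fun i hi => ?_, ?_⟩
  · rw [hne i (by omega) (by omega)]; exact hz.nil i hi
  · by_cases ha : k + 1 = a
    · subst ha
      have hsh : shiftAt (k + 1) b k = b := if_pos rfl
      rw [hsh] at hb hrow hne ⊢
      obtain ⟨K, rfl⟩ : ∃ L, K = L + 1 := ⟨K - 1, by omega⟩
      exact hG.splitArray_mem hz.mem hne hz.isRow (hrow _) hb (by omega) le_rfl swapAt_succ
        swapAt_self (swapPair_spec ((hz.isRow _).sublist (List.drop_sublist _ _))
          ((hz.isRow _).sublist (List.drop_sublist _ _))).2.2.2.2.symm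
    · rw [splitArray_eq hk ha hne (swapAt_pl hz.isRow hb)]
      exact hz.mem

open scoped Classical in
-- Both sides equal the sum over all arrays of rows whose two parts form a pair in `G`. Cancellation
-- at all places except the junction leaves arbitrary pairs of tableaux; cancellation at all places
-- leaves the good pairs.
theorem sum_junction {a b : ℕ} (G : Finset (Plactic × Plactic))
    (hG : JunctionClosed a b (G : Set (Plactic × Plactic))) :
    ∑ g ∈ G.filter (fun g => (tab g.2).length ≤ a), pairSchur a b g =
      ∑ g ∈ G.filter (fun g => Good a b g), pairSchur a b g := by
  set K := G.sup fun g => (tab g.1).length with hK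
  have hKg : ∀ g ∈ G, (tab g.1).length ≤ K := fun g hg =>
    Finset.le_sup (f := fun g : Plactic × Plactic => (tab g.1).length) hg
  set B := (finite_arrayIn a K G).toFinset with hB
  have hBm : ∀ z, z ∈ B ↔ ArrayIn a K (G : Set (Plactic × Plactic)) z := fun z =>
    Set.Finite.mem_toFinset _
  set s : ℕ → ℤ := fun k => if k < a then (b : ℤ) else 0 with hs
  have hsJ : ∀ k, s k = s (k + 1) + shiftAt a b k := by
    intro k
    simp only [hs, shiftAt]
    split_ifs <;> omega
  have tors : ∀ f : SymFun, f + f = 0 → f = 0 := fun f hf => by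
    rw [← two_mul] at hf
    exact (mul_eq_zero.1 hf).resolve_left two_ne_zero
  have inj : ∀ g ∈ G, (tab g.2).length ≤ a → splitArray a K (pairArray a g) = g :=
    fun g hg h => splitArray_pairArray (hKg g hg) h
  have hin : ∀ g ∈ G, (tab g.2).length ≤ a →
      ArrayIn a K (G : Set (Plactic × Plactic)) (pairArray a g) := fun g hg h =>
    ⟨pairArray_isRow a g, fun k hk => pairArray_of_le (hKg g hg) hk, by rw [inj g hg h]; exact hg⟩
  -- `J` is the set of places where cancellation is carried out, and `C` the set of pairs whose
  -- arrays are good at these places.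
  have key : ∀ (J : Finset ℕ) (C : Finset (Plactic × Plactic)),
      (∀ k ∈ J, k + 1 < a + K) → (∀ g ∈ C, g ∈ G ∧ (tab g.2).length ≤ a) →
      (∀ k, k + 1 < a + K → k + 1 ≠ a → k ∈ J) →
      (∀ g ∈ C, ∀ k ∈ J, Below (pairArray a g k) ((pairArray a g (k + 1)).drop (shiftAt a b k))) →
      (∀ z, ArrayIn a K (G : Set (Plactic × Plactic)) z →
        (∀ k ∈ J, Below (z k) ((z (k + 1)).drop (shiftAt a b k))) → splitArray a K z ∈ C) →
      ∑ g ∈ C, pairSchur a b g = ∑ z ∈ B, schurZ (a + K) fun i => s i + (z i).length := by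
    intro J C hJ hC hJ' hgood hCz
    rw [sum_arrays_eq_sum_good tors J (shiftAt a b) s (fun k _ => hsJ k) (schurZ (a + K))
      (fun k hk α => schurZ_reflect (hJ k hk) α) B (fun z hz => ((hBm z).1 hz).isRow)
      (fun z hz k hk m w hb => (hBm _).2 (hG.arrayIn_swapAt ((hBm z).1 hz) (hJ k hk) hb))
      (G := C.image (pairArray a)) ?_]
    · rw [Finset.sum_image]
      · refine Finset.sum_congr rfl fun g hg => ?_
        rw [pairSchur_eq (hKg g (hC g hg).1)]
      · intro g hg g' hg' h
        rw [← inj g (hC g hg).1 (hC g hg).2, h, inj g' (hC g' hg').1 (hC g' hg').2]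
    · intro z
      rw [Finset.mem_image, hBm]
      constructor
      · rintro ⟨g, hg, rfl⟩
        exact ⟨hin g (hC g hg).1 (hC g hg).2, hgood g hg⟩
      · rintro ⟨h1, h2⟩
        refine ⟨_, hCz z h1 h2, pairArray_splitArray h1.isRow h1.nil fun k hk hka => ?_⟩
        have := h2 k (hJ' k hk hka)
        rwa [shiftAt, if_neg hka] at this
  rw [key ((Finset.range (a + K - 1)).filter fun k => k + 1 ≠ a),
    key (Finset.range (a + K - 1))]
  · intro k hk; rw [Finset.mem_range] at hk; omega
  · intro g hg
    rw [Finset.mem_filter] at hg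
    exact ⟨hg.1, hg.2.1⟩
  · intro k hk _; rw [Finset.mem_range]; omega
  · intro g hg k _
    exact (Finset.mem_filter.1 hg).2.below k
  · intro z hz h
    refine Finset.mem_filter.2 ⟨hz.mem, good_splitArray hz.isRow hz.nil fun k hk => h k ?_⟩
    rw [Finset.mem_range]; omega
  · intro k hk; rw [Finset.mem_filter, Finset.mem_range] at hk; omega
  · intro g hg; exact Finset.mem_filter.1 hg
  · intro k hk hka; rw [Finset.mem_filter, Finset.mem_range]; omega
  · intro g _ k hk
    rw [shiftAt, if_neg (Finset.mem_filter.1 hk).2]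
    exact below_pairArray (Finset.mem_filter.1 hk).2 g
  · intro z hz _
    exact Finset.mem_filter.2 ⟨hz.mem, (length_tab_splitArray hz.isRow).2⟩

/-! ### Factorizations along a sequence of rectangles -/

theorem mul_eq_one_plactic {P Q : Plactic} (h : P * Q = 1) : P = 1 ∧ Q = 1 := by
  obtain ⟨u, rfl⟩ := pl_surjective P
  obtain ⟨v, rfl⟩ := pl_surjective Q
  have := eq_nil_of_pl_eq_one ((pl_append u v).trans h)
  rw [List.append_eq_nil_iff] at this
  rw [this.1, this.2, pl_nil]
  exact ⟨rfl, rfl⟩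

/-- The sequences `Y_i M_i X_i` with `Y_0 = 1` and `X_i Y_{i+1} = S_i`. -/
def chainSet (M S : ℕ → Plactic) : Set (ℕ → Plactic) :=
  {U | ∃ x : ℕ → Plactic × Plactic, (x 0).1 = 1 ∧ (∀ i, (x i).2 * (x (i + 1)).1 = S i) ∧
    ∀ i, U i = (x i).1 * M i * (x i).2}

/-- The conditions on rectangles `M_i` and on classes `S_i`, no two neighbors of which are
non-trivial, that make the sequences of `chainSet M S` well behaved. -/
structure Layer (M S : ℕ → Plactic) (p c : ℕ → ℕ) : Prop where
  rect : ∀ i, ∃ m, IsRect (p i) (c i) m ∧ M i = rowsProd (p i) m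
  lt_left : ∀ i x y, IsLetter x (M i) → IsLetter y (S i) → x < y
  lt_right : ∀ i x y, IsLetter x (M (i + 1)) → IsLetter y (S i) → x < y
  width : ∀ i, WidthLE (S i) (c (i + 1))
  rows : ∀ i, (tab (S i)).length ≤ p i
  sparse : ∀ i, S i = 1 ∨ S (i + 1) = 1

theorem widthLE_one (c : ℕ) : WidthLE 1 c := by
  rw [← pl_nil]
  apply widthLE_of_forall
  intro s hs _
  rw [List.sublist_nil.1 hs]
  simp

theorem isLetter_mul_left {x : ℤ} {P Q : Plactic} (h : IsLetter x P) : IsLetter x (P * Q) :=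
  isLetter_mul.2 (Or.inl h)

theorem isLetter_mul_right {x : ℤ} {P Q : Plactic} (h : IsLetter x Q) : IsLetter x (P * Q) :=
  isLetter_mul.2 (Or.inr h)

/-- With `S i = 1` nothing is attached to the right of `M i`, and what lies to its left is a right
factor of `S (i - 1)` with larger letters. So no row is long enough for an exchange. -/
theorem Layer.widthLE {M S : ℕ → Plactic} {p c : ℕ → ℕ} (h : Layer M S p c) {U : ℕ → Plactic}
    (hU : U ∈ chainSet M S) {i : ℕ} (hS : S i = 1) : WidthLE (U i) (c i) := by
  obtain ⟨x, h0, h1, h2⟩ := hU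
  have hx : (x i).2 = 1 := (mul_eq_one_plactic ((h1 i).trans hS)).1
  obtain ⟨m, hm, hM⟩ := h.rect i
  rw [h2, hx, mul_one]
  have hMw : WidthLE (M i) (c i) := hM ▸ hm.widthLE
  cases i with
  | zero => rwa [h0, one_mul]
  | succ i =>
    refine widthLE_mul ?_ hMw fun u hu v hv => ?_
    · have := h.width i
      rw [← h1 i] at this
      exact this.mul_right
    · exact h.lt_right i u v hu (h1 i ▸ isLetter_mul_right hv)

/-- With nothing attached on the left, `U i` is `M i` with a left factor of `S i` to its right,
which adds no rows. -/
theorem Layer.length_le {M S : ℕ → Plactic} {p c : ℕ → ℕ} (h : Layer M S p c) {U : ℕ → Plactic}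
    (hU : U ∈ chainSet M S) {i : ℕ} (hS : ∀ j, j + 1 = i → S j = 1) :
    (tab (U i)).length ≤ p i := by
  obtain ⟨x, h0, h1, h2⟩ := hU
  have hx : (x i).1 = 1 := by
    cases i with
    | zero => exact h0
    | succ i => exact (mul_eq_one_plactic ((h1 i).trans (hS i rfl))).2
  obtain ⟨m, hm, hM⟩ := h.rect i
  rw [h2, hx, one_mul, hM]
  refine hm.length_tab_mul_le ((length_tab_le_mul _ _).trans (h1 i ▸ h.rows i)) ?_
  intro k hk u hu v hv
  exact (h.lt_left i u v (hM ▸ isLetter_rowsProd.2 ⟨k, hk, hu⟩)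
    (h1 i ▸ isLetter_mul_left hv)).le

/-- Here sparseness is used: next to a non-trivial `S i` both neighbors are trivial, so `U i` and `U
(i + 1)` carry no other attachments, and the factorization of `S i` can be changed freely without
affecting the rest. -/
theorem Layer.exists_split {M S : ℕ → Plactic} {p c : ℕ → ℕ} (h : Layer M S p c)
    {U : ℕ → Plactic} (hU : U ∈ chainSet M S) {i : ℕ} (hS : S i ≠ 1) :
    ∃ X Y, X * Y = S i ∧ U i = M i * X ∧ U (i + 1) = Y * M (i + 1) ∧
      ∀ X' Y' U', X' * Y' = S i → (∀ j, j ≠ i → j ≠ i + 1 → U' j = U j) → U' i = M i * X' →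
        U' (i + 1) = Y' * M (i + 1) → U' ∈ chainSet M S := by
  obtain ⟨x, h0, h1, h2⟩ := hU
  have hl : (x i).1 = 1 := by
    cases i with
    | zero => exact h0
    | succ i =>
      exact (mul_eq_one_plactic ((h1 i).trans ((h.sparse i).resolve_right hS))).2
  have hr : (x (i + 1)).2 = 1 :=
    (mul_eq_one_plactic ((h1 (i + 1)).trans ((h.sparse i).resolve_left hS))).1
  refine ⟨(x i).2, (x (i + 1)).1, h1 i, by rw [h2, hl, one_mul], by rw [h2, hr, mul_one], ?_⟩
  intro X' Y' U' hXY hne hi hi'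
  set x' := Function.update (Function.update x i (1, X')) (i + 1) (Y', 1) with hx'
  have e0 : x' i = (1, X') := by rw [hx', Function.update_of_ne (by omega), Function.update_self]
  have e1 : x' (i + 1) = (Y', 1) := by rw [hx', Function.update_self]
  have e2 : ∀ j, j ≠ i → j ≠ i + 1 → x' j = x j := fun j hj hj' => by
    rw [hx', Function.update_of_ne hj', Function.update_of_ne hj]
  have f1 : ∀ j, j ≠ i + 1 → (x' j).1 = (x j).1 := by
    intro j hj
    by_cases hji : j = i
    · rw [hji, e0, hl]
    · rw [e2 j hji hj]
  have f2 : ∀ j, j ≠ i → (x' j).2 = (x j).2 := by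
    intro j hj
    by_cases hji : j = i + 1
    · rw [hji, e1, hr]
    · rw [e2 j hj hji]
  refine ⟨x', by rw [f1 0 (by omega), h0], fun j => ?_, fun j => ?_⟩
  · by_cases hj : j = i
    · rw [hj, e0, e1, hXY]
    · rw [f2 j hj, f1 (j + 1) (by omega), h1]
  · by_cases hj : j = i
    · rw [hj, e0, hi, one_mul]
    · by_cases hj' : j = i + 1
      · rw [hj', e1, hi', mul_one]
      · rw [hne j hj hj', e2 j hj hj', h2]

theorem Layer.exists_threshold {M S : ℕ → Plactic} {p c : ℕ → ℕ} (h : Layer M S p c) {i : ℕ}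
    (hS : S i ≠ 1) : ∃ t : ℤ, (∀ x, IsLetter x (M i) → x ≤ t) ∧
      (∀ x, IsLetter x (M (i + 1)) → x ≤ t) ∧ ∀ x, IsLetter x (S i) → t < x := by
  obtain ⟨s, hs⟩ := pl_surjective (S i)
  have hne : s.toFinset.Nonempty := by
    rw [List.toFinset_nonempty_iff]
    rintro rfl
    exact hS (hs.symm.trans pl_nil)
  obtain ⟨v, hv, hmin⟩ := Finset.exists_min_image s.toFinset id hne
  have hvS : IsLetter v (S i) := by rw [← hs, isLetter_pl]; simpa using hv
  refine ⟨v - 1, fun x hx => ?_, fun x hx => ?_, fun x hx => ?_⟩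
  · have := h.lt_left i x v hx hvS; omega
  · have := h.lt_right i x v hx hvS; omega
  · rw [← hs, isLetter_pl] at hx
    have := hmin x (by simpa using hx)
    simp only [id] at this
    omega

/-- The sequence `(p_i q_{i+1})_i` of a sequence of pairs `(q_i, p_i)`. -/
def linkSeq (x : ℕ → Plactic × Plactic) (i : ℕ) : Plactic := (x i).2 * (x (i + 1)).1

/-- The sequences of pairs `(q_i, p_i)` with `q_0 = 1` such that `(p_i q_{i+1})_i` is in `𝒰`. -/
def Admissible (𝒰 : Set (ℕ → Plactic)) (x : ℕ → Plactic × Plactic) : Prop :=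
  (x 0).1 = 1 ∧ linkSeq x ∈ 𝒰

theorem rowsProd_of_length_le {a K : ℕ} {c : ℕ → List ℤ} (hc : IsTabFun c)
    (h : (tab (rowsProd (a + K) c)).length ≤ a) :
    rowsProd K (fun k => c (a + k)) = 1 ∧ rowsProd a c = rowsProd (a + K) c := by
  have hz := rowsOf_tab_rowsProd (N := a + K) (fun k _ => hc.1 k) fun k _ => hc.2 k
  have : rowsProd K (fun k => c (a + k)) = 1 := by
    rw [← rowsProd_nil K]
    refine rowsProd_congr fun k hk => ?_
    have := congrFun hz (a + k)
    rw [rowsOf_of_length_le (by omega)] at this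
    rw [if_pos (by omega)] at this
    exact this.symm
  rw [rowsProd_add, this, one_mul]
  exact ⟨rfl, rfl⟩

/-- A change of the pair `(q_{i+1}, p_{i+1})` affects only `U_i` and `U_{i+1}`. If `S_i` is trivial,
the bounds on width and rows leave nothing to move. Otherwise the change amounts to a new
factorization of `S_i`, by `exchange_letters` and `move_rows`. -/
theorem Layer.junctionClosed {M S : ℕ → Plactic} {p c : ℕ → ℕ} (h : Layer M S p c)
    {x : ℕ → Plactic × Plactic} {i a b : ℕ} (ha : p i ≤ a) (hb : ∀ j, j + 1 = i → c j ≤ b) :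
    JunctionClosed a b {g | Admissible (chainSet M S) (Function.update x i g)} := by
  cases i with
  | zero =>
    constructor
    -- At the left end `q_0 = 1`, so there is no letter beyond column `b` to exchange.
    · intro A D y₀ yp xm xp y' x' w hmem _ _ _ _ _ _ _ hw
      have := hmem.1
      rw [Function.update_self] at this
      have := eq_nil_of_pl_eq_one (mul_eq_one_plactic this).2
      rw [this] at hw
      simp at hw
    · intro A d K hd hmem
      have hl := h.length_le hmem.2 (i := 0) (fun j hj => by omega)
      rw [linkSeq, Function.update_self] at hl
      obtain ⟨e1, e2⟩ := rowsProd_of_length_le hd (((length_tab_le_mul _ _).trans hl).trans ha)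
      rw [e1, e2, mul_one]
      exact hmem
  | succ i =>
    have hUi : ∀ g, linkSeq (Function.update x (i + 1) g) i = (x i).2 * g.1 := fun g => by
      rw [linkSeq, Function.update_self, Function.update_of_ne (by omega)]
    have hUi' : ∀ g, linkSeq (Function.update x (i + 1) g) (i + 1) = g.2 * (x (i + 2)).1 :=
      fun g => by rw [linkSeq, Function.update_self, Function.update_of_ne (by omega)]
    have hUn : ∀ g g' j, j ≠ i → j ≠ i + 1 → linkSeq (Function.update x (i + 1) g) j =
        linkSeq (Function.update x (i + 1) g') j := fun g g' j h1 h2 => by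
      rw [linkSeq, linkSeq, Function.update_of_ne h2, Function.update_of_ne (by omega),
        Function.update_of_ne h2, Function.update_of_ne (by omega)]
    have h0 : ∀ g, (Function.update x (i + 1) g 0).1 = (x 0).1 := fun g => by
      rw [Function.update_of_ne (by omega)]
    obtain ⟨m1, hm1, hM1⟩ := h.rect i
    obtain ⟨m2, hm2, hM2⟩ := h.rect (i + 1)
    constructor
    · intro A D y₀ yp xm xp y' x' w hmem hy hx hy' hm hw₀ hwp hwx hw hpl
      by_cases hS : S i = 1
      · have hwid := (h.widthLE hmem.2 hS).mono (hb i rfl)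
        rw [hUi] at hwid
        have := hwid.length_le hy (mul_assoc _ _ _)
        rw [List.drop_eq_nil_of_le this] at hw
        simp at hw
      · obtain ⟨X, Y, hXY, h1, h2, hclosed⟩ := h.exists_split hmem.2 hS
        obtain ⟨t, t1, t2, t3⟩ := h.exists_threshold hS
        rw [hUi, hM1, ← mul_assoc] at h1
        rw [hUi', hM2, mul_assoc] at h2
        obtain ⟨X', Y', hXY', h1', h2'⟩ := exchange_letters hm1 hm2 (hM1 ▸ t1) (hM2 ▸ t2) t3
          (h.width i) (h.rows i) hXY (hb i rfl) h1 h2 hy hx hy' hm hw₀ hwp hwx hw hpl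
        refine ⟨(h0 _).trans ((h0 _).symm.trans hmem.1), hclosed X' Y' _ hXY'
          (fun j hj hj' => hUn _ _ j hj hj') ?_ ?_⟩
        · rw [hUi, hM1, ← mul_assoc, h1']
        · rw [hUi', hM2, mul_assoc, h2']
    · intro A d K hd hmem
      by_cases hS : S i = 1
      · have hl := h.length_le hmem.2 (i := i + 1) (fun j hj => by
          rw [show j = i by omega]; exact hS)
        rw [hUi'] at hl
        obtain ⟨e1, e2⟩ := rowsProd_of_length_le hd (((length_tab_le_mul _ _).trans hl).trans ha)
        rw [e1, e2, mul_one]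
        exact hmem
      · obtain ⟨X, Y, hXY, h1, h2, hclosed⟩ := h.exists_split hmem.2 hS
        obtain ⟨t, t1, t2, t3⟩ := h.exists_threshold hS
        rw [hUi, hM1] at h1
        rw [hUi', hM2] at h2
        obtain ⟨X', Y', hXY', h1', h2'⟩ := move_rows (m1 := m1) hm2 (hM2 ▸ t2) t3 (h.width i) hXY ha
          hd h1 h2
        refine ⟨(h0 _).trans ((h0 _).symm.trans hmem.1), hclosed X' Y' _ hXY'
          (fun j hj hj' => hUn _ _ j hj hj') ?_ ?_⟩
        · rw [hUi, hM1, ← mul_assoc, h1']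
        · rw [hUi', hM2, h2']

/-! ### Factor sequences in the plactic monoid -/

/-- The top row of a diagram of plactic classes. -/
def topRow (n : ℕ) (T : ℕ → ℕ → Plactic) (i : ℕ) : Plactic := if i < n then T i (i + 1) else 1

/-- The sequence `q_i M_i p_i`. -/
def sandwich (M : ℕ → Plactic) (x : ℕ → Plactic × Plactic) (i : ℕ) : Plactic :=
  (x i).1 * M i * (x i).2

/-- The factor sequences of a diagram of plactic classes. -/
def placticSeqs : ℕ → (ℕ → ℕ → Plactic) → Set (ℕ → Plactic)
  | 0, _ => {1}
  | n + 1, T => sandwich (topRow (n + 1) T) '' {x | Admissible (placticSeqs n (dropTop T)) x}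

theorem linkSeq_one : linkSeq 1 = 1 := rfl

theorem eq_one_of_linkSeq {x : ℕ → Plactic × Plactic} {i : ℕ} (h : linkSeq x i = 1) :
    (x i).2 = 1 ∧ (x (i + 1)).1 = 1 := mul_eq_one_plactic h

theorem eq_one_of_admissible_one {x : ℕ → Plactic × Plactic} (h : Admissible {1} x) : x = 1 := by
  have h1 : linkSeq x = 1 := h.2
  funext i
  refine Prod.ext ?_ (eq_one_of_linkSeq (congrFun h1 i)).1
  cases i with
  | zero => exact h.1
  | succ i => exact (eq_one_of_linkSeq (congrFun h1 i)).2

theorem placticSeqs_of_trivial {n : ℕ} {T : ℕ → ℕ → Plactic}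
    (h : ∀ i j, i < j → j ≤ n → T i j = 1) : placticSeqs n T = {1} := by
  induction n generalizing T with
  | zero => rfl
  | succ n ih =>
    have htop : topRow (n + 1) T = 1 := by
      funext i
      rw [topRow]
      split_ifs with hi
      · exact h i (i + 1) (by omega) (by omega)
      · rfl
    rw [placticSeqs, ih (T := dropTop T) fun i j hij hj => h i (j + 1) (by omega) (by omega), htop]
    ext W
    constructor
    · rintro ⟨x, hx, rfl⟩
      rw [eq_one_of_admissible_one hx]
      funext i
      simp [sandwich]
    · rintro rfl
      exact ⟨1, ⟨rfl, linkSeq_one⟩, by funext i; simp [sandwich]⟩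

theorem placticSeqs_of_one_row {n : ℕ} {T : ℕ → ℕ → Plactic}
    (h : ∀ i j, i + 2 ≤ j → j ≤ n → T i j = 1) : placticSeqs n T = {topRow n T} := by
  cases n with
  | zero =>
    have : topRow 0 T = 1 := funext fun i => if_neg (by omega)
    rw [this]
    rfl
  | succ n =>
    rw [placticSeqs, placticSeqs_of_trivial (n := n) (T := dropTop T) fun i j hij hj =>
      h i (j + 1) (by omega) (by omega)]
    ext W
    constructor
    · rintro ⟨x, hx, rfl⟩
      rw [eq_one_of_admissible_one hx]
      funext i
      simp [sandwich]
    · rintro rfl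
      exact ⟨1, ⟨rfl, linkSeq_one⟩, by funext i; simp [sandwich]⟩

theorem placticSeqs_of_two_rows {n : ℕ} {T : ℕ → ℕ → Plactic}
    (h : ∀ i j, i + 3 ≤ j → j ≤ n → T i j = 1) :
    placticSeqs n T = chainSet (topRow n T) (fun i => if i + 1 < n then T i (i + 2) else 1) := by
  cases n with
  | zero =>
    have : topRow 0 T = 1 := funext fun i => if_neg (by omega)
    rw [this]
    ext W
    constructor
    · rintro rfl
      exact ⟨1, rfl, fun i => by simp, fun i => by simp⟩
    · rintro ⟨x, h0, h1, h2⟩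
      have : x = 1 := by
        refine eq_one_of_admissible_one ⟨h0, ?_⟩
        funext i
        rw [linkSeq, h1]
        exact if_neg (by omega)
      funext i
      rw [h2, this]
      simp
  | succ n =>
    rw [placticSeqs, placticSeqs_of_one_row (n := n) (T := dropTop T) fun i j hij hj =>
      h i (j + 1) (by omega) (by omega)]
    have e : ∀ i, topRow n (dropTop T) i = if i + 1 < n + 1 then T i (i + 2) else 1 := by
      intro i
      rw [topRow]
      by_cases hi : i < n
      · rw [if_pos hi, if_pos (by omega)]; rfl
      · rw [if_neg hi, if_neg (by omega)]
    ext W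
    constructor
    · rintro ⟨x, ⟨h0, h1⟩, rfl⟩
      refine ⟨x, h0, fun i => ?_, fun i => rfl⟩
      beta_reduce
      rw [← e, ← show linkSeq x = _ from h1]
      rfl
    · rintro ⟨x, h0, h1, h2⟩
      refine ⟨x, ⟨h0, ?_⟩, funext fun i => (h2 i).symm⟩
      funext i
      rw [e]
      exact h1 i

theorem eq_one_of_mem_placticSeqs {n : ℕ} {T : ℕ → ℕ → Plactic} {W : ℕ → Plactic}
    (h : W ∈ placticSeqs n T) {i : ℕ} (hi : n ≤ i) : W i = 1 := by
  induction n generalizing T W i with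
  | zero => rw [show W = 1 from h]; rfl
  | succ n ih =>
    obtain ⟨x, ⟨_, hx⟩, rfl⟩ := h
    obtain ⟨i, rfl⟩ : ∃ j, i = j + 1 := ⟨i - 1, by omega⟩
    rw [sandwich, topRow, if_neg (by omega), (eq_one_of_linkSeq (ih hx (i := i) (by omega))).2,
      (eq_one_of_linkSeq (ih hx (i := i + 1) (by omega))).1]
    rfl

theorem Admissible.eq_one {n : ℕ} {T : ℕ → ℕ → Plactic} {x : ℕ → Plactic × Plactic}
    (h : Admissible (placticSeqs n T) x) {i : ℕ} (hi : n ≤ i) : (x i).2 = 1 ∧ (x (i + 1)).1 = 1 :=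
  eq_one_of_linkSeq (eq_one_of_mem_placticSeqs h.2 hi)

theorem exists_letter_of_mem_placticSeqs {n : ℕ} {T : ℕ → ℕ → Plactic} {W : ℕ → Plactic}
    (h : W ∈ placticSeqs n T) {i : ℕ} {y : ℤ} (hy : IsLetter y (W i)) :
    ∃ k l, k ≤ i ∧ i + 1 ≤ l ∧ l ≤ n ∧ IsLetter y (T k l) := by
  induction n generalizing T W i with
  | zero =>
    rw [show W = 1 from h] at hy
    exact absurd hy not_isLetter_one
  | succ n ih =>
    obtain ⟨x, ⟨h0, hx⟩, rfl⟩ := h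
    rw [sandwich, isLetter_mul, isLetter_mul] at hy
    rcases hy with (hy | hy) | hy
    · cases i with
      | zero => rw [h0] at hy; exact absurd hy not_isLetter_one
      | succ i =>
        obtain ⟨k, l, h1, h2, h3, h4⟩ := ih hx (i := i) (isLetter_mul_right hy)
        exact ⟨k, l + 1, by omega, by omega, by omega, h4⟩
    · rw [topRow] at hy
      split_ifs at hy with hi
      · exact ⟨i, i + 1, le_rfl, le_rfl, by omega, hy⟩
      · exact absurd hy not_isLetter_one
    · obtain ⟨k, l, h1, h2, h3, h4⟩ := ih hx (i := i) (isLetter_mul_left hy)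
      exact ⟨k, l + 1, by omega, by omega, by omega, h4⟩

/-! ### Sparse diagrams -/

/-- A tableau diagram for sparse rank conditions, in terms of plactic classes. -/
structure SparseDiagram (n : ℕ) (r : ℕ → ℕ → ℕ) (T : ℕ → ℕ → Plactic) : Prop where
  rect : ∀ i j, i < j → j ≤ n →
    ∃ t, IsRect (rectRows r i j) (rectCols r i j) t ∧ T i j = rowsProd (rectRows r i j) t
  lt : ∀ i j k l, j ≤ n → i ≤ k → k < l → l ≤ j → (k, l) ≠ (i, j) →
    ∀ x y, IsLetter x (T i j) → IsLetter y (T k l) → y < x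
  rows_le : ∀ i j, i < j → j + 1 ≤ n → rectRows r i (j + 1) ≤ rectRows r i j
  cols_le : ∀ i j, i + 1 < j → j ≤ n → rectCols r i j ≤ rectCols r (i + 1) j
  low : ∀ i j, i + 4 ≤ j → j ≤ n → T i j = 1
  sparse : ∀ i, i + 4 ≤ n → T i (i + 3) = 1 ∨ T (i + 1) (i + 4) = 1

theorem rectCols_dropTop (r : ℕ → ℕ → ℕ) {i j : ℕ} (h : i < j) :
    rectCols (dropTop r) i j = rectCols r i (j + 1) := by
  rw [rectCols, rectCols, dropTop, dropTop, Nat.sub_add_cancel (by omega), Nat.add_sub_cancel]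

theorem SparseDiagram.dropTop {n : ℕ} {r : ℕ → ℕ → ℕ} {T : ℕ → ℕ → Plactic}
    (h : SparseDiagram (n + 1) r T) :
    SparseDiagram n (QuiverFactor.dropTop r) (QuiverFactor.dropTop T) where
  rect i j hij hj := by
    rw [rectCols_dropTop r hij]
    exact h.rect i (j + 1) (by omega) (by omega)
  lt i j k l hj hik hkl hlj hne := by
    refine h.lt i (j + 1) k (l + 1) (by omega) hik (by omega) (by omega) fun he => hne ?_
    rw [Prod.mk.injEq] at he ⊢
    omega
  rows_le i j hij hj := h.rows_le i (j + 1) (by omega) (by omega)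
  cols_le i j hij hj := by
    rw [rectCols_dropTop r (by omega), rectCols_dropTop r hij]
    exact h.cols_le i (j + 1) (by omega) (by omega)
  low i j hij hj := h.low i (j + 1) (by omega) (by omega)
  -- The third row of the shortened diagram is the fourth row of the original one, which is trivial.
  sparse i hi := Or.inl (h.low i (i + 4) le_rfl (by omega))

theorem isRect_zero : IsRect 0 0 fun _ => [] :=
  ⟨fun k hk => by omega, fun k hk => by omega, fun k hk => by omega⟩

theorem tab_one : tab 1 = [] := tab_cl isTableau_nil

theorem SparseDiagram.layer {n : ℕ} {r : ℕ → ℕ → ℕ} {T : ℕ → ℕ → Plactic}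
    (h : SparseDiagram (n + 1) r T) :
    Layer (fun i => if i < n then T i (i + 2) else 1)
      (fun i => if i + 1 < n then T i (i + 3) else 1)
      (fun i => if i < n then rectRows r i (i + 2) else 0)
      (fun i => if i < n then rectCols r i (i + 2) else 0) where
  rect i := by
    by_cases hi : i < n
    · simp only [if_pos hi]
      exact h.rect i (i + 2) (by omega) (by omega)
    · simp only [if_neg hi]
      exact ⟨_, isRect_zero, rfl⟩
  lt_left i x y hx hy := by
    split_ifs at hx hy with h1 h2
    · exact h.lt i (i + 3) i (i + 2) (by omega) le_rfl (by omega) (by omega)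
        (by simp) y x hy hx
    · exact absurd hy not_isLetter_one
    · exact absurd hx not_isLetter_one
    · exact absurd hx not_isLetter_one
  lt_right i x y hx hy := by
    split_ifs at hx hy with h1
    · exact h.lt i (i + 3) (i + 1) (i + 3) (by omega) (by omega) (by omega) (by omega)
        (by simp) y x hy hx
    · exact absurd hx not_isLetter_one
  width i := by
    by_cases hi : i + 1 < n
    · simp only [if_pos hi]
      obtain ⟨t, ht, he⟩ := h.rect i (i + 3) (by omega) (by omega)
      rw [he]
      exact ht.widthLE.mono (h.cols_le i (i + 3) (by omega) (by omega))
    · simp only [if_neg hi]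
      exact widthLE_one _
  rows i := by
    by_cases hi : i + 1 < n
    · simp only [if_pos hi, if_pos (show i < n by omega)]
      obtain ⟨t, ht, he⟩ := h.rect i (i + 3) (by omega) (by omega)
      rw [he]
      exact (length_tab_rowsProd_le ht.isRow).trans (h.rows_le i (i + 2) (by omega) (by omega))
    · simp only [if_neg hi, tab_one]
      simp
  sparse i := by
    by_cases hi : i + 1 + 1 < n
    · simp only [if_pos hi, if_pos (show i + 1 < n by omega)]
      exact h.sparse i (by omega)
    · right
      simp only [if_neg hi]

theorem SparseDiagram.placticSeqs_dropTop {n : ℕ} {r : ℕ → ℕ → ℕ} {T : ℕ → ℕ → Plactic}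
    (h : SparseDiagram (n + 1) r T) : placticSeqs n (QuiverFactor.dropTop T) =
      chainSet (fun i => if i < n then T i (i + 2) else 1)
        (fun i => if i + 1 < n then T i (i + 3) else 1) := by
  rw [placticSeqs_of_two_rows (T := QuiverFactor.dropTop T) fun i j hij hj =>
    h.low i (j + 1) (by omega) (by omega)]
  rfl

theorem SparseDiagram.junctionClosed {n : ℕ} {r : ℕ → ℕ → ℕ} {T : ℕ → ℕ → Plactic}
    (h : SparseDiagram (n + 1) r T) (x : ℕ → Plactic × Plactic) (i : ℕ) :
    JunctionClosed (rectRows r i (i + 1)) (rectCols r i (i + 1))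
      {g | Admissible (placticSeqs n (QuiverFactor.dropTop T)) (Function.update x i g)} := by
  rw [h.placticSeqs_dropTop]
  refine h.layer.junctionClosed ?_ ?_
  · split_ifs with hi
    · exact h.rows_le i (i + 1) (by omega) (by omega)
    · exact Nat.zero_le _
  · rintro j rfl
    split_ifs with hj
    · exact h.cols_le j (j + 2) (by omega) (by omega)
    · exact Nat.zero_le _

/-- The letters of `q_i` and `p_i` come from rectangles further down whose index interval contains
that of the top rectangle. -/
theorem SparseDiagram.lt_letter {n : ℕ} {r : ℕ → ℕ → ℕ} {T : ℕ → ℕ → Plactic}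
    (h : SparseDiagram (n + 1) r T) {x : ℕ → Plactic × Plactic}
    (hx : Admissible (placticSeqs n (QuiverFactor.dropTop T)) x) {i : ℕ} {u v : ℤ}
    (hu : IsLetter u (T i (i + 1))) (hv : IsLetter v (x i).1 ∨ IsLetter v (x i).2) : u < v := by
  rcases hv with hv | hv
  · cases i with
    | zero => rw [hx.1] at hv; exact absurd hv not_isLetter_one
    | succ i =>
      obtain ⟨k, l, h1, h2, h3, h4⟩ := exists_letter_of_mem_placticSeqs hx.2 (i := i)
        (isLetter_mul_right hv)
      exact h.lt k (l + 1) (i + 1) (i + 2) (by omega) (by omega) (by omega) (by omega)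
        (by rw [Ne, Prod.mk.injEq]; omega) v u h4 hu
  · obtain ⟨k, l, h1, h2, h3, h4⟩ := exists_letter_of_mem_placticSeqs hx.2 (i := i)
      (isLetter_mul_left hv)
    exact h.lt k (l + 1) i (i + 1) (by omega) (by omega) (by omega) (by omega)
      (by rw [Ne, Prod.mk.injEq]; omega) v u h4 hu

/-! ### The sum over all factorizations -/

theorem ydiag_one : ydiag 1 = ⊥ := by
  rw [ydiag_eq_iff, tab_one]
  symm
  show _ = []
  rw [← List.length_eq_zero_iff, YoungDiagram.length_rowLens]
  by_contra h
  exact YoungDiagram.notMem_bot (0, 0)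
    (YoungDiagram.mem_iff_lt_colLen.2 (Nat.pos_of_ne_zero h))

/-- The sequence of pairs `(q_i, p_i)` made of pairs `(p_i, q_{i+1})`, `0 ≤ i < n`. -/
def extendPairs {n : ℕ} (y : Fin n → Plactic × Plactic) : ℕ → Plactic × Plactic
  | 0 => (1, if h : 0 < n then (y ⟨0, h⟩).1 else 1)
  | i + 1 => (if h : i < n then (y ⟨i, h⟩).2 else 1, if h : i + 1 < n then (y ⟨i + 1, h⟩).1 else 1)

theorem extendPairs_snd {n : ℕ} (y : Fin n → Plactic × Plactic) (i : ℕ) :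
    (extendPairs y i).2 = if h : i < n then (y ⟨i, h⟩).1 else 1 := by
  cases i <;> rfl

theorem extendPairs_succ {n : ℕ} (y : Fin n → Plactic × Plactic) (i : ℕ) :
    (extendPairs y (i + 1)).1 = if h : i < n then (y ⟨i, h⟩).2 else 1 := rfl

theorem linkSeq_extendPairs {n : ℕ} (y : Fin n → Plactic × Plactic) (i : ℕ) :
    linkSeq (extendPairs y) i = if h : i < n then (y ⟨i, h⟩).1 * (y ⟨i, h⟩).2 else 1 := by
  rw [linkSeq, extendPairs_snd, extendPairs_succ]
  split_ifs <;> simp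

theorem extendPairs_injective {n : ℕ} :
    Function.Injective (extendPairs : (Fin n → Plactic × Plactic) → _) := by
  intro y y' h
  funext i
  refine Prod.ext ?_ ?_
  · have := congrArg Prod.snd (congrFun h i)
    rw [extendPairs_snd, extendPairs_snd, dif_pos i.2, dif_pos i.2] at this
    exact this
  · have := congrArg Prod.fst (congrFun h (i + 1))
    rw [extendPairs_succ, extendPairs_succ, dif_pos i.2, dif_pos i.2] at this
    exact this

/-- The tensor product of the Schur functions of the rectangles with attachments. -/
noncomputable def pairTensor (n : ℕ) (r : ℕ → ℕ → ℕ) (x : ℕ → Plactic × Plactic) :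
    ⨂[ℤ] _ : Fin n, SymFun :=
  ⨂ₜ[ℤ] i : Fin n, pairSchur (rectRows r i (i + 1)) (rectCols r i (i + 1)) (x i)

theorem finsum_card_smul {P Y M : Type*} [DecidableEq P] (R : Type*) [Ring R] [AddCommGroup M] [Module R M]
    (s : Finset Y) (sh : Y → P) (f : P → M) :
    ∑ᶠ p, ((s.filter fun y => sh y = p).card : R) • f p = ∑ y ∈ s, f (sh y) := by
  rw [finsum_eq_sum_of_support_subset (s := s.image sh), Finset.sum_comp]
  · exact Finset.sum_congr rfl fun p _ => Nat.cast_smul_eq_nsmul R _ _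
  · intro p hp
    rw [Function.mem_support] at hp
    have : (s.filter fun y => sh y = p).Nonempty := by
      rw [Finset.nonempty_iff_ne_empty]
      intro h
      rw [h, Finset.card_empty, Nat.cast_zero, zero_smul] at hp
      exact hp rfl
    obtain ⟨y, hy⟩ := this
    rw [Finset.mem_filter] at hy
    exact Finset.mem_coe.2 (Finset.mem_image.2 ⟨y, hy⟩)

open scoped Classical in
-- A product of Littlewood-Richardson coefficients counts families of factorizations with given
-- shapes, so the sum over shapes turns into a sum over the factorizations themselves.
theorem replaceBasis_ydiag (n : ℕ) (r : ℕ → ℕ → ℕ) (U : Fin n → Plactic) :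
    replaceBasis n r (fun i => ydiag (U i)) =
      ∑ y ∈ Fintype.piFinset fun i => factorizations (U i),
        if ∀ i : Fin n, (tab (y i).1).length ≤ rectRows r i (i + 1) then
          pairTensor (n + 1) r (extendPairs y) else 0 := by
  set Y := Fintype.piFinset fun i => factorizations (U i) with hY
  set sh : (Fin n → Plactic × Plactic) → (Fin n → YoungDiagram) × (Fin n → YoungDiagram) :=
    fun y => (fun i => ydiag (y i).1, fun i => ydiag (y i).2) with hsh
  set f : (Fin n → YoungDiagram) × (Fin n → YoungDiagram) → ⨂[ℤ] _ : Fin (n + 1), SymFun :=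
    fun p => if ∀ i : Fin n, (p.1 i).colLen 0 ≤ rectRows r i (i + 1) then
      ⨂ₜ[ℤ] i : Fin (n + 1), schur (attach (rectRows r i (i + 1)) (rectCols r i (i + 1))
          ((Fin.snoc p.1 ⊥ : Fin (n + 1) → YoungDiagram) i)
          ((Fin.cons ⊥ p.2 : Fin (n + 1) → YoungDiagram) i)) else 0 with hf
  have hcard : ∀ p, ∏ i, lrCoeff (ydiag (U i)) (p.1 i) (p.2 i) =
      ((Y.filter fun y => sh y = p).card : ℤ) := by
    intro p
    simp only [lrCoeff_ydiag]
    rw [← Nat.cast_prod, ← Fintype.card_piFinset]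
    congr 2
    ext y
    simp only [Fintype.mem_piFinset, Finset.mem_filter, hY, hsh, Prod.ext_iff, funext_iff]
    exact ⟨fun h => ⟨fun i => (h i).1, fun i => (h i).2.1, fun i => (h i).2.2⟩,
      fun h i => ⟨h.1 i, h.2.1 i, h.2.2 i⟩⟩
  have hterm : ∀ p : (Fin n → YoungDiagram) × (Fin n → YoungDiagram),
      (if ∀ i : Fin n, (p.1 i).colLen 0 ≤ rectRows r i (i + 1) then
      (∏ i, lrCoeff (ydiag (U i)) (p.1 i) (p.2 i)) •
        ⨂ₜ[ℤ] i : Fin (n + 1), schur (attach (rectRows r i (i + 1)) (rectCols r i (i + 1))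
          ((Fin.snoc p.1 ⊥ : Fin (n + 1) → YoungDiagram) i)
          ((Fin.cons ⊥ p.2 : Fin (n + 1) → YoungDiagram) i))
      else 0) = ((Y.filter fun y => sh y = p).card : ℤ) • f p := by
    intro p
    rw [hcard, hf]
    beta_reduce
    split_ifs
    · rfl
    · exact (smul_zero _).symm
  rw [replaceBasis, finsum_congr hterm]
  refine (finsum_card_smul ℤ Y sh f).trans ?_
  · refine Finset.sum_congr rfl fun y _ => ?_
    simp only [hf, hsh, colLen_ydiag]
    congr 1
    rw [pairTensor]
    congr 1
    funext i
    rw [pairSchur]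
    congr 2
    · refine Fin.lastCases ?_ (fun i => ?_) i
      · rw [Fin.snoc_last, extendPairs_snd, dif_neg (by simp), ydiag_one]
      · rw [Fin.snoc_castSucc, extendPairs_snd, dif_pos (by simp)]
        rfl
    · refine Fin.cases ?_ (fun i => ?_) i
      · rw [Fin.cons_zero]
        exact ydiag_one.symm
      · rw [Fin.cons_succ, Fin.val_succ, extendPairs_succ, dif_pos i.2]

theorem quiverP_add_two (n : ℕ) (r : ℕ → ℕ → ℕ) :
    quiverP (n + 2) r = ((tensorBasis (n + 1)).repr (quiverP (n + 1) (dropTop r))).sum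
      fun μ c => c • replaceBasis (n + 1) r μ := rfl

theorem tensorBasis_apply (n : ℕ) (μ : Fin n → YoungDiagram) :
    tensorBasis n μ = ⨂ₜ[ℤ] i : Fin n, schur (μ i).rowLens := by
  rw [tensorBasis, Basis.piTensorProduct_apply]
  simp only [schurBasis_apply]

theorem rowLens_bot : (⊥ : YoungDiagram).rowLens = [] := by
  rw [← ydiag_one, rowLens_ydiag, tab_one]
  rfl

theorem pairSchur_one (a b : ℕ) : pairSchur a b (1, 1) = schur (List.replicate a b) := by
  rw [pairSchur, ydiag_one, attach, rowLens_bot, List.append_nil]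
  congr 1
  rw [List.eq_replicate_iff]
  refine ⟨by simp, fun v hv => ?_⟩
  obtain ⟨k, _, rfl⟩ := List.mem_map.1 hv
  rw [rowLen_eq_getD, rowLens_bot]
  rfl

theorem quiverP_one_eq (r : ℕ → ℕ → ℕ) :
    quiverP 1 r = replaceBasis 0 r fun i => ydiag ((1 : ℕ → Plactic) i) := by
  classical
  rw [replaceBasis_ydiag, Fintype.piFinset_of_isEmpty, Finset.univ_unique, Finset.sum_singleton,
    if_pos (fun i => i.elim0), pairTensor, quiverP]
  congr 1
  funext i
  rw [Subsingleton.elim i 0]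
  exact (pairSchur_one _ _).symm

/-- This treats the case of one map as a replacement too, applied to the empty tensor product, so
that the main induction can start at `n = 0`. -/
theorem quiverP_succ {n : ℕ} {r : ℕ → ℕ → ℕ} {s : Finset (ℕ → Plactic)}
    (hs : n = 0 → s = {1})
    (h : quiverP n (dropTop r) = ∑ U ∈ s, ⨂ₜ[ℤ] i : Fin n, schur (ydiag (U i)).rowLens) :
    quiverP (n + 1) r = ∑ U ∈ s, replaceBasis n r fun i => ydiag (U i) := by
  cases n with
  | zero => rw [hs rfl, Finset.sum_singleton, quiverP_one_eq]
  | succ n =>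
    have hb : ∀ U : ℕ → Plactic, (⨂ₜ[ℤ] i : Fin (n + 1), schur (ydiag (U i)).rowLens) =
        tensorBasis (n + 1) fun i => ydiag (U i) := fun U => (tensorBasis_apply _ _).symm
    rw [Finset.sum_congr rfl fun U _ => hb U] at h
    rw [quiverP_add_two, h, ← Finsupp.linearCombination_apply, map_sum, map_sum]
    refine Finset.sum_congr rfl fun U _ => ?_
    rw [Module.Basis.repr_self, Finsupp.linearCombination_single, one_smul]

open scoped Classical in
-- A sequence of pairs determines the sequence of products that it factors, so the double sum over
-- `U` and its factorizations has no repetitions.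
theorem exists_admissible_sum {n : ℕ} {r : ℕ → ℕ → ℕ} {T : ℕ → ℕ → Plactic}
    {s : Finset (ℕ → Plactic)} (hs : ∀ U, U ∈ s ↔ U ∈ placticSeqs n T)
    (h : quiverP n (dropTop r) = ∑ U ∈ s, ⨂ₜ[ℤ] i : Fin n, schur (ydiag (U i)).rowLens) :
    ∃ X : Finset (ℕ → Plactic × Plactic), (∀ x, x ∈ X ↔ Admissible (placticSeqs n T) x) ∧
      quiverP (n + 1) r = ∑ x ∈ X.filter fun x =>
        ∀ i < n + 1, (tab (x i).2).length ≤ rectRows r i (i + 1), pairTensor (n + 1) r x := by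
  have hlink : ∀ U ∈ s, ∀ y ∈ Fintype.piFinset (fun i : Fin n => factorizations (U i)),
      linkSeq (extendPairs y) = U := by
    intro U hU y hy
    rw [Fintype.mem_piFinset] at hy
    funext i
    rw [linkSeq_extendPairs]
    split_ifs with hi
    · exact mem_factorizations.1 (hy ⟨i, hi⟩)
    · exact (eq_one_of_mem_placticSeqs ((hs U).1 hU) (by omega)).symm
  refine ⟨(s.sigma fun U => Fintype.piFinset fun i : Fin n => factorizations (U i)).image
    fun p => extendPairs p.2, fun x => ?_, ?_⟩
  · simp only [Finset.mem_image, Finset.mem_sigma]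
    constructor
    · rintro ⟨⟨U, y⟩, ⟨hU, hy⟩, rfl⟩
      refine ⟨rfl, ?_⟩
      rw [hlink U hU y hy]
      exact (hs U).1 hU
    · intro hx
      refine ⟨⟨linkSeq x, fun i => ((x i).2, (x (i + 1)).1)⟩, ⟨(hs _).2 hx.2, ?_⟩, ?_⟩
      · rw [Fintype.mem_piFinset]
        exact fun i => mem_factorizations.2 rfl
      · funext i
        refine Prod.ext ?_ ?_
        · cases i with
          | zero => exact hx.1.symm
          | succ i =>
            rw [extendPairs_succ]
            split_ifs with hi
            · rfl
            · exact (hx.eq_one (by omega)).2.symm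
        · rw [extendPairs_snd]
          split_ifs with hi
          · rfl
          · exact (hx.eq_one (by omega)).1.symm
  · rw [quiverP_succ (s := s) ?_ h]
    · simp only [replaceBasis_ydiag]
      rw [Finset.sum_sigma', Finset.sum_filter, Finset.sum_image]
      · refine Finset.sum_congr rfl fun p hp => ?_
        congr 1
        rw [eq_iff_iff]
        constructor
        · intro hp i hi
          rw [extendPairs_snd]
          split_ifs with hin
          · exact hp ⟨i, hin⟩
          · rw [tab_one]; exact Nat.zero_le _
        · intro hp i
          have := hp i (by omega)
          rwa [extendPairs_snd, dif_pos i.2] at this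
      · rintro ⟨U, y⟩ hp ⟨U', y'⟩ hp' he
        rw [Finset.mem_coe, Finset.mem_sigma] at hp hp'
        have h1 : y = y' := extendPairs_injective he
        have h2 : U = U' := by
          rw [← hlink U hp.1 y hp.2, ← hlink U' hp'.1 y' hp'.2, h1]
        rw [h1, h2]
    · rintro rfl
      ext U
      rw [hs, Finset.mem_singleton]
      rfl

/-! ### Treating one junction at a time -/

open scoped Classical in
-- Only the tensor factor at `m` varies, so the sum moves inside by multilinearity. It reduces the
-- change of conditions at a junction to an identity between symmetric functions.
theorem sum_tprod_update {α : Type*} {n : ℕ} (v : ℕ → α → SymFun) (x : ℕ → α) {m : ℕ}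
    (hm : m < n) (C : Finset α) :
    ∑ g ∈ C, (⨂ₜ[ℤ] i : Fin n, v i (Function.update x m g i)) =
      PiTensorProduct.tprod ℤ (Function.update (fun i : Fin n => v i (x i)) ⟨m, hm⟩
        (∑ g ∈ C, v m g)) := by
  rw [MultilinearMap.map_update_sum]
  refine Finset.sum_congr rfl fun g _ => ?_
  congr 1
  funext i
  by_cases hi : i = ⟨m, hm⟩
  · subst hi
    rw [Function.update_self, Function.update_self]
  · rw [Function.update_of_ne hi, Function.update_of_ne fun h => hi (Fin.ext h)]

open scoped Classical in
theorem sum_congr_coordinate {α M : Type*} [AddCommMonoid M] (g₀ : α) (X : Finset (ℕ → α)) (m : ℕ)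
    (p₁ p₂ : α → Prop) (Q : (ℕ → α) → Prop) (hQ : ∀ x g, Q (Function.update x m g) ↔ Q x)
    (F : (ℕ → α) → M)
    (h : ∀ x ∈ X, ∀ G : Finset α, (∀ g, g ∈ G ↔ Function.update x m g ∈ X) →
      ∑ g ∈ G.filter p₁, F (Function.update x m g) =
        ∑ g ∈ G.filter p₂, F (Function.update x m g)) :
    ∑ x ∈ X.filter (fun x => Q x ∧ p₁ (x m)), F x =
      ∑ x ∈ X.filter (fun x => Q x ∧ p₂ (x m)), F x := by
  set e : (ℕ → α) → ℕ → α := fun x => Function.update x m g₀ with he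
  rw [← Finset.sum_fiberwise_of_maps_to (s := X.filter fun x => Q x ∧ p₁ (x m))
      (t := X.image e) (g := e) fun x hx => Finset.mem_image_of_mem e (Finset.mem_filter.1 hx).1,
    ← Finset.sum_fiberwise_of_maps_to (s := X.filter fun x => Q x ∧ p₂ (x m))
      (t := X.image e) (g := e) fun x hx => Finset.mem_image_of_mem e (Finset.mem_filter.1 hx).1]
  refine Finset.sum_congr rfl fun b hb => ?_
  obtain ⟨x, hx, rfl⟩ := Finset.mem_image.1 hb
  set G := (X.filter fun x' => e x' = e x).image fun x' => x' m with hG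
  have hupd : ∀ x', e x' = e x → x' = Function.update x m (x' m) := by
    intro x' hx'
    funext i
    by_cases hi : i = m
    · rw [hi, Function.update_self]
    · have := congrFun hx' i
      simp only [he] at this
      rw [Function.update_of_ne hi, Function.update_of_ne hi] at this
      rw [Function.update_of_ne hi, this]
  have heu : ∀ g, e (Function.update x m g) = e x := fun g => by
    simp only [he, Function.update_idem]
  have hGm : ∀ g, g ∈ G ↔ Function.update x m g ∈ X := by
    intro g
    simp only [hG, Finset.mem_image, Finset.mem_filter]
    constructor
    · rintro ⟨x', ⟨h1, h2⟩, rfl⟩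
      rw [← hupd x' h2]
      exact h1
    · intro hg
      exact ⟨_, ⟨hg, heu g⟩, Function.update_self _ _ _⟩
  have key : ∀ p : α → Prop, ∑ x' ∈ (X.filter fun x => Q x ∧ p (x m)).filter (fun x' => e x' = e x),
      F x' = if Q x then ∑ g ∈ G.filter p, F (Function.update x m g) else 0 := by
    intro p
    split_ifs with hQx
    · symm
      refine Finset.sum_bij (fun g _ => Function.update x m g) ?_ ?_ ?_ ?_
      · intro g hg
        rw [Finset.mem_filter, hGm] at hg
        rw [Finset.mem_filter, Finset.mem_filter, hQ, Function.update_self]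
        exact ⟨⟨hg.1, hQx, hg.2⟩, heu g⟩
      · intro g _ g' _ hgg
        have := congrFun hgg m
        rwa [Function.update_self, Function.update_self] at this
      · intro x' hx'
        rw [Finset.mem_filter, Finset.mem_filter] at hx'
        refine ⟨x' m, ?_, (hupd x' hx'.2).symm⟩
        rw [Finset.mem_filter, hGm, ← hupd x' hx'.2]
        exact ⟨hx'.1.1, hx'.1.2.2⟩
      · intro _ _
        rfl
    · refine Finset.sum_eq_zero fun x' hx' => ?_
      rw [Finset.mem_filter, Finset.mem_filter] at hx'
      rw [hupd x' hx'.2, hQ] at hx'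
      exact absurd hx'.1.2.1 hQx
  rw [key p₁, key p₂, h x hx G hGm]

open scoped Classical in
-- The conditions are exchanged one coordinate at a time. The hypothesis concerns complete fibers of
-- `X`, independently of the conditions at the other coordinates, so the order does not matter.
theorem sum_all_coordinates {α M : Type*} [AddCommMonoid M] (g₀ : α) (X : Finset (ℕ → α)) (n : ℕ)
    (p₁ p₂ : ℕ → α → Prop) (F : (ℕ → α) → M)
    (h : ∀ x ∈ X, ∀ m < n, ∀ G : Finset α, (∀ g, g ∈ G ↔ Function.update x m g ∈ X) →
      ∑ g ∈ G.filter (p₁ m), F (Function.update x m g) =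
        ∑ g ∈ G.filter (p₂ m), F (Function.update x m g)) :
    ∑ x ∈ X.filter (fun x => ∀ i < n, p₁ i (x i)), F x =
      ∑ x ∈ X.filter (fun x => ∀ i < n, p₂ i (x i)), F x := by
  have main : ∀ k ≤ n, ∑ x ∈ X.filter (fun x => ∀ i < n, p₁ i (x i)), F x =
      ∑ x ∈ X.filter (fun x => ∀ i < n, if i < k then p₂ i (x i) else p₁ i (x i)), F x := by
    intro k
    induction k with
    | zero => intro _; simp
    | succ k ih =>
      intro hk
      rw [ih (by omega)]
      have hsplit : ∀ (p : α → Prop) (x : ℕ → α) (q : ℕ → Prop), (q k ↔ p (x k)) →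
          (∀ i, i ≠ k → (q i ↔ if i < k then p₂ i (x i) else p₁ i (x i))) →
          ((∀ i < n, q i) ↔ (∀ i < n, i ≠ k → if i < k then p₂ i (x i) else p₁ i (x i)) ∧
            p (x k)) := by
        intro p x q h1 h2
        constructor
        · exact fun hq => ⟨fun i hi hik => (h2 i hik).1 (hq i hi), h1.1 (hq k (by omega))⟩
        · rintro ⟨h3, h4⟩ i hi
          by_cases hik : i = k
          · rw [hik]; exact h1.2 h4
          · exact (h2 i hik).2 (h3 i hi hik)
      have e1 : X.filter (fun x => ∀ i < n, if i < k then p₂ i (x i) else p₁ i (x i)) =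
          X.filter (fun x => (∀ i < n, i ≠ k → if i < k then p₂ i (x i) else p₁ i (x i)) ∧
            p₁ k (x k)) := by
        refine Finset.filter_congr fun x _ => hsplit _ x _ ?_ fun i hi => Iff.rfl
        rw [if_neg (lt_irrefl k)]
      have e2 : X.filter (fun x => ∀ i < n, if i < k + 1 then p₂ i (x i) else p₁ i (x i)) =
          X.filter (fun x => (∀ i < n, i ≠ k → if i < k then p₂ i (x i) else p₁ i (x i)) ∧
            p₂ k (x k)) := by
        refine Finset.filter_congr fun x _ => hsplit _ x _ ?_ fun i hi => ?_
        · rw [if_pos (Nat.lt_succ_self k)]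
        · by_cases hik : i < k
          · rw [if_pos hik, if_pos (by omega)]
          · rw [if_neg hik, if_neg (by omega)]
      rw [e1, e2]
      convert sum_congr_coordinate g₀ X k (p₁ k) (p₂ k)
        (fun x => ∀ i < n, i ≠ k → if i < k then p₂ i (x i) else p₁ i (x i)) (fun x g => ?_) F
        fun x hx G hG => h x hx k (by omega) G hG
      constructor
      · intro hx i hi hik
        have := hx i hi hik
        rwa [Function.update_of_ne hik] at this
      · intro hx i hi hik
        rw [Function.update_of_ne hik]
        exact hx i hi hik
  rw [main n le_rfl]
  refine Finset.sum_congr (Finset.filter_congr fun x _ => ?_) fun _ _ => rfl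
  exact forall₂_congr fun i hi => by rw [if_pos hi]

/-! ### The main induction -/

/-- Junctions are straightened from left to right. The step at junction `k` changes only the pair
there, so earlier pairs remain good. -/
theorem SparseDiagram.exists_good_sequence {n : ℕ} {r : ℕ → ℕ → ℕ} {T : ℕ → ℕ → Plactic}
    (h : SparseDiagram (n + 1) r T) {x : ℕ → Plactic × Plactic}
    (hx : Admissible (placticSeqs n (QuiverFactor.dropTop T)) x) :
    ∃ x', Admissible (placticSeqs n (QuiverFactor.dropTop T)) x' ∧
      (∀ i < n + 1, Good (rectRows r i (i + 1)) (rectCols r i (i + 1)) (x' i)) ∧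
      sandwich (topRow (n + 1) T) x' = sandwich (topRow (n + 1) T) x := by
  have main : ∀ k ≤ n + 1, ∃ x', Admissible (placticSeqs n (QuiverFactor.dropTop T)) x' ∧
      (∀ i < k, Good (rectRows r i (i + 1)) (rectCols r i (i + 1)) (x' i)) ∧
      sandwich (topRow (n + 1) T) x' = sandwich (topRow (n + 1) T) x := by
    intro k
    induction k with
    | zero => exact fun _ => ⟨x, hx, fun i hi => by omega, rfl⟩
    | succ k ih =>
      intro hk
      obtain ⟨x₁, h1, h2, h3⟩ := ih (by omega)
      obtain ⟨t, ht, hT⟩ := h.rect k (k + 1) (by omega) hk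
      obtain ⟨g, hg, hgood, heq⟩ := exists_good ht (h.junctionClosed x₁ k) (by
        intro g hg j hj u hu v hv
        refine h.lt_letter hg (i := k) ?_ (by rwa [Function.update_self])
        rw [hT, isLetter_rowsProd]
        exact ⟨j, hj, hu⟩) (g := x₁ k) (by
          show Admissible _ (Function.update x₁ k (x₁ k))
          rwa [Function.update_eq_self])
      refine ⟨Function.update x₁ k g, hg, fun i hi => ?_, ?_⟩
      · by_cases hik : i = k
        · subst hik
          rwa [Function.update_self]
        · rw [Function.update_of_ne hik]
          exact h2 i (by omega)
      · rw [← h3]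
        funext i
        by_cases hik : i = k
        · subst hik
          rw [sandwich, sandwich, Function.update_self, topRow, if_pos (by omega), hT]
          exact heq
        · rw [sandwich, sandwich, Function.update_of_ne hik]
  exact main (n + 1) le_rfl

/-- In a factor sequence the letters of the top rectangles are known, so good pairs are read off
factor by factor. -/
theorem SparseDiagram.sandwich_injective {n : ℕ} {r : ℕ → ℕ → ℕ} {T : ℕ → ℕ → Plactic}
    (h : SparseDiagram (n + 1) r T) {x x' : ℕ → Plactic × Plactic}
    (hx : Admissible (placticSeqs n (QuiverFactor.dropTop T)) x)
    (hx' : Admissible (placticSeqs n (QuiverFactor.dropTop T)) x')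
    (hg : ∀ i < n + 1, Good (rectRows r i (i + 1)) (rectCols r i (i + 1)) (x i))
    (hg' : ∀ i < n + 1, Good (rectRows r i (i + 1)) (rectCols r i (i + 1)) (x' i))
    (he : sandwich (topRow (n + 1) T) x = sandwich (topRow (n + 1) T) x') : x = x' := by
  funext i
  by_cases hi : i < n + 1
  · obtain ⟨t, ht, hT⟩ := h.rect i (i + 1) (by omega) (by omega)
    have hlet : ∀ x, Admissible (placticSeqs n (QuiverFactor.dropTop T)) x →
        ∀ k < rectRows r i (i + 1), ∀ u ∈ t k, ∀ v, IsLetter v (x i).1 ∨ IsLetter v (x i).2 →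
          u < v := by
      intro x hx k hk u hu v hv
      refine h.lt_letter hx ?_ hv
      rw [hT, isLetter_rowsProd]
      exact ⟨k, hk, hu⟩
    refine good_injective ht (hlet x hx) (hg i hi) (hlet x' hx') (hg' i hi) ?_
    have := congrFun he i
    rw [sandwich, sandwich, topRow, if_pos hi, hT] at this
    exact this
  · obtain ⟨j, rfl⟩ : ∃ j, i = j + 1 := ⟨i - 1, by omega⟩
    refine Prod.ext ?_ ?_
    · rw [(hx.eq_one (i := j) (by omega)).2, (hx'.eq_one (i := j) (by omega)).2]
    · rw [(hx.eq_one (by omega)).1, (hx'.eq_one (by omega)).1]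

/-- In the induction step `sum_junction`, applied at each junction, cuts the sum down to sequences
of good pairs. For these the terms are products of genuine Schur functions of the shapes of `W_i`,
and `sandwich` is a bijection onto the factor sequences. -/
theorem SparseDiagram.exists_quiverP_eq {n : ℕ} {r : ℕ → ℕ → ℕ} {T : ℕ → ℕ → Plactic}
    (h : SparseDiagram n r T) : ∃ s : Finset (ℕ → Plactic), (∀ W, W ∈ s ↔ W ∈ placticSeqs n T) ∧
      quiverP n r = ∑ W ∈ s, ⨂ₜ[ℤ] i : Fin n, schur (ydiag (W i)).rowLens := by
  classical
  induction n generalizing r T with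
  | zero =>
    refine ⟨{1}, fun W => Finset.mem_singleton, ?_⟩
    rw [Finset.sum_singleton, quiverP]
    congr 1
    funext i
    exact i.elim0
  | succ n ih =>
    obtain ⟨s, hs, hsum⟩ := ih h.dropTop
    obtain ⟨X, hX, hXsum⟩ := exists_admissible_sum hs hsum
    have hsum' := sum_all_coordinates (1, 1) X (n + 1)
      (fun i g => (tab g.2).length ≤ rectRows r i (i + 1))
      (fun i g => Good (rectRows r i (i + 1)) (rectCols r i (i + 1)) g) (pairTensor (n + 1) r) ?_
    · refine ⟨(X.filter fun x => ∀ i < n + 1,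
        Good (rectRows r i (i + 1)) (rectCols r i (i + 1)) (x i)).image
          (sandwich (topRow (n + 1) T)), fun W => ?_, ?_⟩
      · rw [Finset.mem_image, placticSeqs]
        constructor
        · rintro ⟨x, hx, rfl⟩
          exact ⟨x, (hX x).1 (Finset.mem_filter.1 hx).1, rfl⟩
        · rintro ⟨x, hx, rfl⟩
          obtain ⟨x', h1, h2, h3⟩ := h.exists_good_sequence hx
          exact ⟨x', Finset.mem_filter.2 ⟨(hX x').2 h1, h2⟩, h3⟩
      · rw [Finset.sum_image]
        · refine hXsum.trans (Eq.trans (b := ∑ x ∈ X.filter fun x => ∀ i < n + 1,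
            Good (rectRows r i (i + 1)) (rectCols r i (i + 1)) (x i), pairTensor (n + 1) r x)
            (by convert hsum') ?_)
          refine Finset.sum_congr rfl fun x hx => ?_
          rw [Finset.mem_filter, hX] at hx
          rw [pairTensor]
          congr 1
          funext i
          obtain ⟨t, ht, hT⟩ := h.rect i (i + 1) (by omega) (by omega)
          rw [sandwich, topRow, if_pos i.2, hT]
          refine (schur_ydiag_good ht ?_ (hx.2 i i.2)).symm
          intro k hk u hu v hv
          refine h.lt_letter hx.1 ?_ hv
          rw [hT, isLetter_rowsProd]
          exact ⟨k, hk, hu⟩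
        · intro x hx x' hx' he
          rw [Finset.mem_coe, Finset.mem_filter, hX] at hx hx'
          exact h.sandwich_injective hx.1 hx'.1 hx.2 hx'.2 he
    · intro x _ m hm G hG
      simp only [pairTensor]
      have hupd := sum_tprod_update
        (fun i => pairSchur (rectRows r i (i + 1)) (rectCols r i (i + 1))) x hm
      refine (hupd _).trans (Eq.trans ?_ (hupd _).symm)
      congr 2
      convert sum_junction (a := rectRows r m (m + 1)) (b := rectCols r m (m + 1)) G ?_
      have : (G : Set (Plactic × Plactic)) =
          {g | Admissible (placticSeqs n (QuiverFactor.dropTop T)) (Function.update x m g)} := by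
        ext g
        rw [Finset.mem_coe, hG, hX]
        rfl
      rw [this]
      exact h.junctionClosed x m

/-! ### Factor sequences of tableaux -/

/-- The sequence of plactic classes of a sequence of fillings, continued by `1`. -/
def clSeq {n : ℕ} (W : Fin n → Filling) (i : ℕ) : Plactic := if h : i < n then cl (W ⟨i, h⟩) else 1

theorem clSeq_fin {n : ℕ} (W : Fin n → Filling) (i : Fin n) : clSeq W i = cl (W i) := dif_pos i.2

theorem clSeq_tab {n : ℕ} {V : ℕ → Plactic} (hV : ∀ i, n ≤ i → V i = 1) :
    clSeq (fun i : Fin n => tab (V i)) = V := by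
  funext i
  rw [clSeq]
  split_ifs with hi
  · exact cl_tab _
  · exact (hV i (by omega)).symm

theorem sandwich_extendPairs {n : ℕ} {T : ℕ → ℕ → Filling}
    {P Q : Fin n → Filling}
    (hQ : ∀ i, IsTableau (Q i)) (i : Fin (n + 1)) :
    sandwich (topRow (n + 1) fun i j => cl (T i j)) (extendPairs fun i => (cl (P i), cl (Q i))) i =
      cl (tabMul (tabMul ((Fin.cons [] Q : Fin (n + 1) → Filling) i) (T i (i + 1)))
        ((Fin.snoc P [] : Fin (n + 1) → Filling) i)) := by
  have hcons : IsTableau ((Fin.cons [] Q : Fin (n + 1) → Filling) i) := by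
    refine Fin.cases ?_ (fun i => ?_) i
    · exact isTableau_nil
    · exact hQ i
  rw [cl_tabMul (hcons.tabMul _), cl_tabMul hcons, sandwich, topRow, if_pos i.2]
  congr 2
  · refine Fin.cases rfl (fun i => ?_) i
    rw [Fin.cons_succ, Fin.val_succ, extendPairs_succ, dif_pos i.2]
  · refine Fin.lastCases ?_ (fun i => ?_) i
    · rw [Fin.snoc_last, extendPairs_snd, dif_neg (by simp)]
      rfl
    · rw [Fin.snoc_castSucc, extendPairs_snd, dif_pos (by simp)]
      rfl

/-- Tableaux correspond bijectively and multiplicatively to plactic classes, so the two recursive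
definitions match; sequences of classes are continued by `1` beyond the range. -/
theorem isFactorSeq_iff {n : ℕ} {T : ℕ → ℕ → Filling}
    (hT : ∀ i j, i < j → j ≤ n → IsTableau (T i j)) (W : Fin n → Filling) :
    IsFactorSeq n T W ↔
      (∀ i, IsTableau (W i)) ∧ clSeq W ∈ placticSeqs n fun i j => cl (T i j) := by
  match n with
  | 0 =>
    refine ⟨fun _ => ⟨fun i => i.elim0, ?_⟩, fun _ => trivial⟩
    rw [placticSeqs, Set.mem_singleton_iff]
    funext i
    exact dif_neg (by omega)
  | 1 =>
    rw [placticSeqs_of_one_row (fun i j h1 h2 => by omega), Set.mem_singleton_iff, IsFactorSeq]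
    have h01 := hT 0 1 (by omega) le_rfl
    constructor
    · intro h
      refine ⟨fun i => ?_, ?_⟩
      · rw [Subsingleton.elim i 0, h]
        exact h01
      · funext i
        rw [clSeq, topRow]
        split_ifs with hi
        · obtain rfl : i = 0 := by omega
          exact congrArg cl h
        · rfl
    · rintro ⟨h1, h2⟩
      exact cl_injOn (h1 0) h01 (congrFun h2 0)
  | n + 2 =>
    have ih := isFactorSeq_iff (n := n + 1) (T := dropTop T)
      fun i j hij hj => hT i (j + 1) (by omega) (by omega)
    have hprod : ∀ (P Q : Fin (n + 1) → Filling), (∀ i, IsTableau (Q i)) → ∀ i : Fin (n + 2),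
        IsTableau (tabMul (tabMul ((Fin.cons [] Q : Fin (n + 2) → Filling) i) (T i (i + 1)))
          ((Fin.snoc P [] : Fin (n + 2) → Filling) i)) := by
      intro P Q hQ i
      refine IsTableau.tabMul (IsTableau.tabMul ?_ _) _
      refine Fin.cases ?_ (fun i => ?_) i
      · exact isTableau_nil
      · exact hQ i
    constructor
    · rintro ⟨U, P, Q, hU, hPQ, hW⟩
      refine ⟨fun i => ?_, extendPairs fun i => (cl (P i), cl (Q i)), ⟨rfl, ?_⟩, ?_⟩
      · rw [hW]
        exact hprod P Q (fun i => (hPQ i).2.1) i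
      · have hlink : linkSeq (extendPairs fun i => (cl (P i), cl (Q i))) = clSeq U := ?_
        · rw [hlink]
          exact ((ih U).1 hU).2
        funext i
        rw [linkSeq_extendPairs, clSeq]
        split_ifs with hi
        · rw [(hPQ ⟨i, hi⟩).2.2, cl_tabMul (hPQ ⟨i, hi⟩).1]
        · rfl
      · funext i
        by_cases hi : i < n + 2
        · have := sandwich_extendPairs (T := T) (P := P) (fun i => (hPQ i).2.1) ⟨i, hi⟩
          rw [clSeq, dif_pos hi, hW]
          exact this
        · obtain ⟨i, rfl⟩ : ∃ j, i = j + 1 := ⟨i - 1, by omega⟩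
          rw [clSeq, dif_neg hi, sandwich, topRow, if_neg hi, extendPairs_succ, extendPairs_snd,
            dif_neg (by omega), dif_neg (by omega)]
          rfl
    · rintro ⟨hW, x, hx, hxW⟩
      have hx1 : ∀ i, n + 1 ≤ i → linkSeq x i = 1 := fun i hi => eq_one_of_mem_placticSeqs hx.2 hi
      have hPQ : (extendPairs fun i : Fin (n + 1) =>
          (cl (tab (x i).2), cl (tab (x (i + 1)).1))) = x := by
        funext i
        refine Prod.ext ?_ ?_
        · cases i with
          | zero => exact hx.1.symm
          | succ i =>
            rw [extendPairs_succ]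
            split_ifs with hi
            · exact cl_tab _
            · exact (eq_one_of_linkSeq (hx1 i (by omega))).2.symm
        · rw [extendPairs_snd]
          split_ifs with hi
          · exact cl_tab _
          · exact (eq_one_of_linkSeq (hx1 i (by omega))).1.symm
      refine ⟨fun i => tab (linkSeq x i), fun i => tab (x i).2, fun i => tab (x (i + 1)).1,
        (ih _).2 ⟨fun i => isTableau_tab _, ?_⟩,
        fun i => ⟨isTableau_tab _, isTableau_tab _, ?_⟩, fun i => ?_⟩
      · rw [clSeq_tab hx1]
        exact hx.2
      · refine cl_injOn (isTableau_tab _) ((isTableau_tab _).tabMul _) ?_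
        rw [cl_tabMul (isTableau_tab _), cl_tab, cl_tab, cl_tab]
        rfl
      · refine cl_injOn (hW i) (hprod _ _ (fun i => isTableau_tab _) i) ?_
        rw [← sandwich_extendPairs (fun i => isTableau_tab _), hPQ, hxW, clSeq_fin]

/-! ### Rank conditions -/

section Rank

variable {K V V' : Type*} [Field K] [AddCommGroup V] [Module K V] [FiniteDimensional K V]
  [AddCommGroup V'] [Module K V']

/-- The kernel of `f` on `A` is contained in its kernel on `B`, so `f` loses at least as much
dimension on `B`. -/
theorem finrank_map_add_le (f : V →ₗ[K] V') {A B : Submodule K V} (h : A ≤ B) :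
    Module.finrank K (B.map f) + Module.finrank K A ≤
      Module.finrank K B + Module.finrank K (A.map f) := by
  have hA := (f.domRestrict A).finrank_range_add_finrank_ker
  have hB := (f.domRestrict B).finrank_range_add_finrank_ker
  rw [LinearMap.range_domRestrict] at hA hB
  have hk : Module.finrank K (LinearMap.ker (f.domRestrict A)) ≤
      Module.finrank K (LinearMap.ker (f.domRestrict B)) := by
    refine LinearMap.finrank_le_finrank_of_injective
      (f := (Submodule.inclusion h).restrict (p := LinearMap.ker (f.domRestrict A))
        (q := LinearMap.ker (f.domRestrict B)) fun x hx => hx) ?_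
    intro x y hxy
    have := congrArg (fun z : LinearMap.ker (f.domRestrict B) => ((z : B) : V)) hxy
    exact Subtype.ext (Subtype.ext this)
  omega

end Rank

/-- The image of `V_i` in `V_j`; all of `V_j` if `j ≤ i`. -/
noncomputable def imageIn {d : ℕ → ℕ}
    (f : ∀ i, (Fin (d i) → ℂ) →ₗ[ℂ] (Fin (d (i + 1)) → ℂ)) (i : ℕ) :
    ∀ j : ℕ, Submodule ℂ (Fin (d j) → ℂ)
  | 0 => ⊤
  | j + 1 => if i ≤ j then (imageIn f i j).map (f j) else ⊤

section ImageIn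

variable {d : ℕ → ℕ} (f : ∀ i, (Fin (d i) → ℂ) →ₗ[ℂ] (Fin (d (i + 1)) → ℂ))

theorem imageIn_of_le {i j : ℕ} (h : j ≤ i) : imageIn f i j = ⊤ := by
  cases j with
  | zero => rfl
  | succ j => exact if_neg (by omega)

theorem imageIn_succ {i j : ℕ} (h : i ≤ j) : imageIn f i (j + 1) = (imageIn f i j).map (f j) :=
  if_pos h

theorem imageIn_le (i j : ℕ) : imageIn f i j ≤ imageIn f (i + 1) j := by
  induction j with
  | zero => exact le_rfl
  | succ j ih =>
    by_cases h : i + 1 ≤ j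
    · rw [imageIn_succ f h, imageIn_succ f (by omega)]
      exact Submodule.map_mono ih
    · rw [imageIn_of_le f (i := i + 1) (by omega)]
      exact le_top

theorem imageIn_add (i k : ℕ) : imageIn f i (i + k) = LinearMap.range (compMap f i k) := by
  induction k with
  | zero => exact (imageIn_of_le f le_rfl).trans LinearMap.range_id.symm
  | succ k ih =>
    rw [compMap, LinearMap.range_comp, ← ih]
    exact imageIn_succ f (Nat.le_add_right i k)

end ImageIn

theorem CanOccur.exists_imageIn {n : ℕ} {r : ℕ → ℕ → ℕ} (h : CanOccur n r) :
    ∃ f : ∀ i, (Fin (r i i) → ℂ) →ₗ[ℂ] (Fin (r (i + 1) (i + 1)) → ℂ),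
      ∀ i j, i ≤ j → j ≤ n →
        Module.finrank ℂ (imageIn (d := fun i => r i i) f i j) = r i j := by
  obtain ⟨f, hf⟩ := h
  refine ⟨f, fun i j hij hj => ?_⟩
  obtain ⟨k, rfl⟩ := Nat.exists_eq_add_of_le hij
  rw [imageIn_add, hf i k hj]

theorem CanOccur.le_succ_left {n : ℕ} {r : ℕ → ℕ → ℕ} (h : CanOccur n r) {i j : ℕ} (hij : i < j)
    (hj : j ≤ n) : r i j ≤ r (i + 1) j := by
  obtain ⟨f, hf⟩ := h.exists_imageIn
  rw [← hf i j hij.le hj, ← hf (i + 1) j hij hj]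
  exact Submodule.finrank_mono (imageIn_le _ _ _)

theorem CanOccur.succ_right_le {n : ℕ} {r : ℕ → ℕ → ℕ} (h : CanOccur n r) {i j : ℕ} (hij : i ≤ j)
    (hj : j + 1 ≤ n) : r i (j + 1) ≤ r i j := by
  obtain ⟨f, hf⟩ := h.exists_imageIn
  rw [← hf i j hij (by omega), ← hf i (j + 1) (by omega) hj, imageIn_succ _ hij]
  exact Submodule.finrank_map_le _ _

/-- This inequality says that passing to the next row of the rectangle diagram does not increase the
side that has to fit against the rectangle above: rows for `R_{i,j+1}` against `R_{ij}`, columns for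
`R_{i,j+1}` against `R_{i+1,j+1}`. -/
theorem CanOccur.add_le_add {n : ℕ} {r : ℕ → ℕ → ℕ} (h : CanOccur n r) {i j : ℕ} (hij : i < j)
    (hj : j + 1 ≤ n) : r (i + 1) (j + 1) + r i j ≤ r (i + 1) j + r i (j + 1) := by
  obtain ⟨f, hf⟩ := h.exists_imageIn
  rw [← hf i j hij.le (by omega), ← hf (i + 1) j hij (by omega), ← hf i (j + 1) (by omega) hj,
    ← hf (i + 1) (j + 1) (by omega) hj, imageIn_succ _ hij, imageIn_succ _ hij.le]
  exact finrank_map_add_le _ (imageIn_le _ _ _)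

/-! ### The formula for the coefficients -/

theorem IsTableauDiagram.sparseDiagram {n : ℕ} {r : ℕ → ℕ → ℕ} {T : ℕ → ℕ → Filling}
    (hT : IsTableauDiagram n r T) (hr : CanOccur n r) (hs : SparseBelow n r) :
    SparseDiagram n r fun i j => cl (T i j) := by
  have hempty : ∀ i j, i < j → j ≤ n → RectEmpty r i j → cl (T i j) = 1 := by
    intro i j hij hj he
    have h := (hT i j hij hj).2.1
    have : T i j = [] := by
      rw [← List.map_eq_nil_iff (f := List.length)]
      refine h.trans ?_
      split_ifs with hc
      · rfl
      · rw [he.resolve_right hc]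
        rfl
    rw [this, cl_nil]
  refine ⟨fun i j hij hj => ?_, fun i j k l hj hik hkl hlj hne x y hx hy => ?_,
    fun i j hij hj => ?_, fun i j hij hj => ?_,
    fun i j hij hj => hempty i j (by omega) hj (hs.1 i j hij hj), fun i hi => ?_⟩
  · obtain ⟨h1, h2, _⟩ := hT i j hij hj
    -- If the rectangle has no columns, the tableau is the empty list, but `rowsOf` still reads it
    -- as the required number of empty rows.
    have hlen : (T i j).length ≤ rectRows r i j := by
      rw [← List.length_map (f := List.length) (as := T i j)]
      refine (congrArg List.length h2).trans_le ?_
      split_ifs <;> simp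
    refine ⟨rowsOf (T i j), ⟨fun k _ => h1.isTabFun.1 k, fun k hk => ?_,
      fun k _ => h1.isTabFun.2 k⟩, (rowsProd_rowsOf hlen).symm⟩
    have h3 : (shape (T i j)).getD k 0 = rectCols r i j := by
      rw [h2]
      split_ifs with hc
      · exact hc.symm
      · simp [hk]
    rw [← h3, shape_getD]
  · exact (hT i j (by omega) hj).2.2 k l hik hkl hlj hne x (isLetter_cl.1 hx) y (isLetter_cl.1 hy)
  · have := hr.add_le_add hij hj
    have := hr.le_succ_left hij (by omega)
    rw [rectRows, rectRows]
    omega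
  · obtain ⟨j, rfl⟩ : ∃ k, j = k + 1 := ⟨j - 1, by omega⟩
    have := hr.add_le_add (i := i) (j := j) (by omega) hj
    have := hr.succ_right_le (i := i + 1) (j := j) (by omega) hj
    rw [rectCols, rectCols, Nat.add_sub_cancel]
    omega
  · exact (hs.2 i hi).imp (hempty _ _ (by omega) (by omega)) (hempty _ _ (by omega) (by omega))

theorem repr_sum_tensorBasis {n : ℕ} {ι : Type*} (s : Finset ι) (w : ι → Fin n → YoungDiagram)
    [DecidableEq (Fin n → YoungDiagram)] (μ : Fin n → YoungDiagram) :
    (tensorBasis n).repr (∑ x ∈ s, ⨂ₜ[ℤ] i : Fin n, schur (w x i).rowLens) μ =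
      (s.filter fun x => w x = μ).card := by
  simp only [← tensorBasis_apply]
  rw [map_sum, Finsupp.finsetSum_apply, Finset.card_filter]
  push_cast
  refine Finset.sum_congr rfl fun x _ => ?_
  rw [Module.Basis.repr_self, Finsupp.single_apply]

/-- The coefficient at `μ` of a sum of basis elements counts the terms with index `μ`; taking
tableaux identifies these terms with the factor sequences of shape `μ`, which are therefore also
finitely many. -/
theorem quiverCoeff_eq_ncard {n : ℕ} {r : ℕ → ℕ → ℕ} {T : ℕ → ℕ → Filling}
    (hT : IsTableauDiagram n r T) (hr : CanOccur n r) (hs : SparseBelow n r)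
    (μ : Fin n → YoungDiagram) :
    (factorSeqs n T μ).Finite ∧ quiverCoeff n r μ = ((factorSeqs n T μ).ncard : ℤ) := by
  classical
  obtain ⟨s, hsm, hsum⟩ := (hT.sparseDiagram hr hs).exists_quiverP_eq
  set φ : (ℕ → Plactic) → Fin n → Filling := fun W i => tab (W i) with hφ
  have himage : factorSeqs n T μ =
      ↑((s.filter fun W => (fun i : Fin n => ydiag (W i)) = μ).image φ) := by
    ext W
    rw [Finset.mem_coe, Finset.mem_image]
    have hiff := isFactorSeq_iff (fun i j hij hj => (hT i j hij hj).1) (T := T)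
    constructor
    · rintro ⟨h1, h2⟩
      rw [hiff] at h1
      have h3 : φ (clSeq W) = W := by
        funext i
        rw [hφ]
        beta_reduce
        rw [clSeq_fin, tab_cl (h1.1 i)]
      refine ⟨clSeq W, Finset.mem_filter.2 ⟨(hsm _).2 h1.2, ?_⟩, h3⟩
      funext i
      rw [ydiag_eq_iff, ← h2, ← congrFun h3 i]
    · rintro ⟨V, hV, rfl⟩
      rw [Finset.mem_filter, hsm] at hV
      refine ⟨(hiff _).2 ⟨fun i => isTableau_tab _, ?_⟩, fun i => ?_⟩
      · rw [clSeq_tab fun i hi => eq_one_of_mem_placticSeqs hV.1 hi]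
        exact hV.1
      · rw [← hV.2, rowLens_ydiag]
  refine ⟨himage ▸ Finset.finite_toSet _, ?_⟩
  rw [himage, Set.ncard_coe_finset, Finset.card_image_of_injOn, quiverCoeff, hsum,
    repr_sum_tensorBasis]
  intro V hV V' hV' he
  rw [Finset.mem_coe, Finset.mem_filter, hsm] at hV hV'
  have hclSeq : ∀ V ∈ placticSeqs n fun i j => cl (T i j), clSeq (φ V) = V := fun V hV =>
    clSeq_tab fun i hi => eq_one_of_mem_placticSeqs hV hi
  rw [← hclSeq V hV.1, ← hclSeq V' hV'.1, he]

end QuiverFactor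

theorem mainTheorem1 (n : ℕ) (r : ℕ → ℕ → ℕ) (hr : QuiverFactor.CanOccur n r) :
    (QuiverFactor.SparseBelow n r →
      ∀ T : ℕ → ℕ → QuiverFactor.Filling, QuiverFactor.IsTableauDiagram n r T →
        ∀ μ : Fin n → YoungDiagram,
          (QuiverFactor.factorSeqs n T μ).Finite ∧
          QuiverFactor.quiverCoeff n r μ = ((QuiverFactor.factorSeqs n T μ).ncard : ℤ)) ∧
    (n ≤ 3 → QuiverFactor.SparseBelow n r) :=
  ⟨fun hs _ hT μ => QuiverFactor.quiverCoeff_eq_ncard hT hr hs μ,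
    fun hn => ⟨fun _ _ h1 h2 => by omega, fun _ h => by omega⟩⟩
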